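/- **Setting.** Let $K$ be a field of characteristic $0$, let $V$ be a finite-dimensional $K$-vector space, and let $A=S(V)_0\subset S(V)$ be the non-unital algebra of polynomials without constant term, with product $m\colon A^{\otimes 2}\to A$. For $i\in\mathbb Z$ let $\mathrm{Hom}^i(A)$ be the total space of the spaces $\mathrm{Hom}(A^{\otimes k},A^{\otimes l})$ with $k,l\ge 0$ and $k-l=i$. This may be read either as the direct sum or as the direct product; the theorem is asserted for both readings. For $\Psi\colon A^{\otimes k}\to A^{\otimes l}$ of degree $i=k-l$ let $\iota(\Psi)$ be the operator on the tensor algebra $T(A[1])=\bigoplus_{N\ge0}A^{\otimes N}$ (all letters odd) $$\iota(\Psi)(a_1\otimes\dots\otimes a_N)=\sum_{j=0}^{N-k}(-1)^{ij}\,a_1\otimes\dots\otimes a_j\otimes\Psi(a_{j+1}\otimes\dots\otimes a_{j+k})\otimes a_{j+k+1}\otimes\dots\otimes a_N$$ (zero for $N<k$), extended linearly to $\mathrm{Hom}^i(A)$. The map $\iota$ is injective, and the bracket of $\Psi_1\in\mathrm{Hom}^i(A)$ and $\Psi_2\in\mathrm{Hom}^j(A)$ is the unique $[\Psi_1,\Psi_2]\in\mathrm{Hom}^{i+j}(A)$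 with $$\iota([\Psi_1,\Psi_2])=\iota(\Psi_1)\iota(\Psi_2)-(-1)^{ij}\iota(\Psi_2)\iota(\Psi_1).$$ With the differential $d=[m,\cdot\,]$, $\mathrm{Hom}^\bullet(A)$ is a dg Lie algebra; $H^\bullet=\bigoplus_i H^i(\mathrm{Hom}^\bullet(A))$ denotes its cohomology with the induced bracket. Let $\mathrm{Clif}(V\oplus V^*)$ be the Clifford algebra of the quadratic form $(v,\xi)\mapsto\xi(v)$, so $v\xi+\xi v=\xi(v)$. **Theorem.** The map $\Lambda^\bullet(V)\otimes\Lambda^\bullet(V^*)\to\mathrm{Clif}(V\oplus V^*)$, $w\otimes\eta\mapsto w\cdot\eta$ (product of the images of $w$ and $\eta$ under the algebra maps extending $V,V^*\subset\mathrm{Clif}(V\oplus V^*)$), is a linear isomorphism; use it to identify the two spaces. There is a linear isomorphism $$\kappa\colon\Lambda^\bullet(V)\otimes\Lambda^\bullet(V^*)\longrightarrow H^\bullet(\mathrm{Hom}^\bullet(S(V)_0))$$ such that: 1. For all $v_1,\dots,v_l\in V$ and $\xi_1,\dots,\xi_k\in V^*$, the class $\kappa(v_1\wedge\dots\wedge v_l\otimes\xi_1\wedge\dots\wedge\xi_k)$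 lies in $H^{k-l}$ and is represented by a cocycle in $\mathrm{Hom}^{k-l}(S(V)_0)$ whose components on $A^{\otimes n}$ vanish for $n<k$ and whose component on $A^{\otimes k}$ is $$a_1\otimes\dots\otimes a_k\longmapsto\xi_k(a_1)\,\xi_{k-1}(a_2)\cdots\xi_1(a_k)\sum_{\sigma\in S_l}\mathrm{sgn}(\sigma)\,v_{\sigma(1)}\otimes\dots\otimes v_{\sigma(l)},$$ where each $\xi_i$ is extended to $S(V)_0$ by $0$ on $S^n(V)$, $n\ge2$. 2. Under $\kappa$ the induced bracket on $H^\bullet$ is the graded commutator of the Clifford algebra: for $a\in\Lambda^l(V)\otimes\Lambda^k(V^*)$ and $b\in\Lambda^{l'}(V)\otimes\Lambda^{k'}(V^*)$, $$[\kappa(a),\kappa(b)]=\kappa\bigl(a\cdot b-(-1)^{(k-l)(k'-l')}\,b\cdot a\bigr),$$ the products on the right being taken in $\mathrm{Clif}(V\oplus V^*)$. -/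

import Mathlib

open scoped TensorProduct DirectSum

noncomputable section

namespace TensorHom

section General

variable (K : Type*) [Field K]

/-- The sign `(-1)^i` as a scalar. -/
def sgn (i : ℤ) : K := ((i.negOnePow : ℤ) : K)

variable {K}

theorem sgn_add (i j : ℤ) : sgn K (i + j) = sgn K i * sgn K j := by
  simp [sgn, Int.negOnePow_add]

theorem sgn_mul_self (i : ℤ) : sgn K i * sgn K i = 1 := by
  rw [← sgn_add]; simp [sgn, ← two_mul]

theorem sgn_neg (i : ℤ) : sgn K (-i) = sgn K i := by simp [sgn]

@[simp] theorem sgn_zero : sgn K 0 = 1 := by simp [sgn]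

@[simp] theorem sgn_one : sgn K 1 = -1 := by simp [sgn]

theorem sgn_cases (i : ℤ) : sgn K i = 1 ∨ sgn K i = -1 := by
  rcases Int.even_or_odd i with h | h
  · left; simp [sgn, Int.negOnePow_even i h]
  · right; simp [sgn, Int.negOnePow_odd i h]

variable (K) (A : Type*) [AddCommGroup A] [Module K A]

/-- The component `A^{⊗n}` of the tensor algebra, for `n : ℤ` (zero for negative `n`). -/
def tpow : ℤ → Submodule K (TensorAlgebra K A)
  | Int.ofNat n => LinearMap.range (TensorAlgebra.ι K : A →ₗ[K] TensorAlgebra K A) ^ n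
  | Int.negSucc _ => ⊥

variable {K A}

local notation "T" => TensorAlgebra K A
local notation "ιT" => TensorAlgebra.ι K (M := A)

instance instAddCommGroupEnd : AddCommGroup (T →ₗ[K] T) := LinearMap.addCommGroup

theorem tpow_natCast (n : ℕ) : tpow K A n = LinearMap.range ιT ^ n := rfl

theorem tpow_of_neg {n : ℤ} (h : n < 0) : tpow K A n = ⊥ := by
  cases n with
  | ofNat n => simp at h; omega
  | negSucc n => rfl

theorem one_mem_tpow : (1 : T) ∈ tpow K A 0 := by
  change (1 : T) ∈ tpow K A ((0 : ℕ) : ℤ)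
  rw [tpow_natCast, pow_zero]; exact Submodule.one_le.mp le_rfl

theorem ι_mem_tpow (a : A) : ιT a ∈ tpow K A 1 := by
  change _ ∈ tpow K A ((1 : ℕ) : ℤ)
  rw [tpow_natCast, pow_one]; exact ⟨a, rfl⟩

theorem mul_mem_tpow {p q : ℤ} {x y : T} (hx : x ∈ tpow K A p) (hy : y ∈ tpow K A q) :
    x * y ∈ tpow K A (p + q) := by
  rcases lt_or_ge p 0 with hp | hp
  · rw [tpow_of_neg hp, Submodule.mem_bot] at hx; simp [hx]
  rcases lt_or_ge q 0 with hq | hq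
  · rw [tpow_of_neg hq, Submodule.mem_bot] at hy; simp [hy]
  lift p to ℕ using hp
  lift q to ℕ using hq
  rw [← Nat.cast_add]
  rw [tpow_natCast] at *
  rw [pow_add]
  exact Submodule.mul_mem_mul hx hy

/-- Induction on the number of letters, adding letters on the left. -/
theorem tpow_induction {C : (n : ℕ) → T → Prop}
    (one : C 0 1) (cons : ∀ (n : ℕ) a x, x ∈ tpow K A n → C n x → C (n + 1) (ιT a * x))
    (add : ∀ n x y, C n x → C n y → C n (x + y)) (smul : ∀ n (r : K) x, C n x → C n (r • x))
    (n : ℕ) (x : T) (hx : x ∈ tpow K A n) : C n x := by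
  rw [tpow_natCast] at hx
  induction hx using Submodule.pow_induction_on_left' with
  | algebraMap r => rw [Algebra.algebraMap_eq_smul_one]; exact smul _ _ _ one
  | add x y i hx hy ihx ihy => exact add _ _ _ ihx ihy
  | mem_mul m hm i x hx ih => obtain ⟨a, rfl⟩ := hm; exact cons _ _ _ hx ih

theorem tpow_induction_right {C : (n : ℕ) → T → Prop}
    (one : C 0 1) (snoc : ∀ (n : ℕ) x b, x ∈ tpow K A n → C n x → C (n + 1) (x * ιT b))
    (add : ∀ n x y, C n x → C n y → C n (x + y)) (smul : ∀ n (r : K) x, C n x → C n (r • x))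
    (n : ℕ) (x : T) (hx : x ∈ tpow K A n) : C n x := by
  rw [tpow_natCast] at hx
  induction hx using Submodule.pow_induction_on_right' with
  | algebraMap r => rw [Algebra.algebraMap_eq_smul_one]; exact smul _ _ _ one
  | add x y i hx hy ihx ihy => exact add _ _ _ ihx ihy
  | mul_mem i x hx ih m hm => obtain ⟨a, rfl⟩ := hm; exact snoc _ _ _ hx ih

theorem induction_left {C : T → Prop} (one : C 1) (cons : ∀ a x, C x → C (ιT a * x))
    (add : ∀ x y, C x → C y → C (x + y)) (smul : ∀ (r : K) x, C x → C (r • x)) (x : T) : C x := by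
  have h : ∀ n : ℕ, ∀ x ∈ tpow K A n, C x := fun n x hx =>
    tpow_induction (C := fun _ x => C x) one (fun _ a x _ h => cons a x h)
      (fun _ x y => add x y) (fun _ r x => smul r x) n x hx
  have hz : C 0 := by simpa using smul 0 1 one
  refine DirectSum.Decomposition.inductionOn
    (fun n : ℕ => LinearMap.range ιT ^ n) hz (fun {i} m => h i m m.2) (fun m m' => add m m') x

/-- Two linear maps agreeing on all components are equal. -/
theorem ext_tpow {M : Type*} [AddCommGroup M] [Module K M] {f g : T →ₗ[K] M}
    (h : ∀ n : ℕ, ∀ x ∈ tpow K A n, f x = g x) : f = g := by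
  ext x
  refine DirectSum.Decomposition.inductionOn
    (fun n : ℕ => LinearMap.range ιT ^ n) (by simp) (fun {i} m => h i m m.2)
    (fun m m' h h' => by simp [h, h']) x

/-- One step of deconcatenation: adding the letter `a` on the left. -/
def deconcStep : A →ₗ[K] Module.End K (T × (T ⊗[K] T)) :=
  LinearMap.mk₂ K
    (fun a s => (ιT a * s.1, (1 : T) ⊗ₜ[K] (ιT a * s.1) + (ιT a ⊗ₜ[K] (1 : T)) * s.2))
    (by intro a b s; ext <;> simp [add_mul, TensorProduct.tmul_add, TensorProduct.add_tmul]; abel)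
    (by intro r a s; ext <;> simp [← TensorProduct.smul_tmul'])
    (by intro a s t; ext <;> simp [mul_add, TensorProduct.tmul_add]; abel)
    (by intro r a s; ext <;> simp)

theorem deconcStep_apply (a : A) (s : T × (T ⊗[K] T)) : deconcStep a s =
    (ιT a * s.1, (1 : T) ⊗ₜ[K] (ιT a * s.1) + (ιT a ⊗ₜ[K] (1 : T)) * s.2) := rfl

/-- The deconcatenation coproduct
`x₁ ⋯ x_N ↦ ∑_{0 ≤ j ≤ N} x₁ ⋯ x_j ⊗ x_{j+1} ⋯ x_N` on the tensor algebra, determined by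
`Δ(1) = 1 ⊗ 1` and `Δ(a x) = 1 ⊗ a x + (a ⊗ 1) Δ(x)`. -/
def deconc : T →ₗ[K] T ⊗[K] T :=
  LinearMap.snd K _ _ ∘ₗ
    (LinearMap.applyₗ ((1 : T), (1 : T) ⊗ₜ[K] (1 : T))) ∘ₗ
      (TensorAlgebra.lift K (deconcStep (K := K) (A := A))).toLinearMap

theorem deconc_one : deconc (1 : T) = 1 ⊗ₜ[K] 1 := by simp [deconc]

theorem lift_deconcStep_fst (x : T) (s) :
    (TensorAlgebra.lift K (deconcStep (K := K) (A := A)) x s).1 = x * s.1 := by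
  induction x using induction_left with
  | one => simp
  | cons a x h => simp [deconcStep_apply, h, mul_assoc]
  | add x y hx hy => simp [hx, hy, add_mul]
  | smul r x hx => simp [hx]

theorem deconc_cons (a : A) (x : T) :
    deconc (ιT a * x) = 1 ⊗ₜ[K] (ιT a * x) + (ιT a ⊗ₜ[K] (1 : T)) * deconc x := by
  have := lift_deconcStep_fst (K := K) (A := A) x ((1 : T), (1 : T) ⊗ₜ[K] (1 : T))
  simp only [mul_one] at this
  simp [deconc, deconcStep_apply, this]

/-- The convolution `x ↦ ∑ f(x') g(x'')`, summed over all ways to write the word `x` as a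
concatenation `x' x''`. -/
def conv (f g : Module.End K T) : Module.End K T :=
  LinearMap.mul' K T ∘ₗ TensorProduct.map f g ∘ₗ deconc

/-- Left multiplication. -/
def lm (x : T) : Module.End K T := LinearMap.mulLeft K x
/-- Right multiplication. -/
def rm (x : T) : Module.End K T := LinearMap.mulRight K x

@[simp] theorem lm_apply (x y : T) : lm x y = x * y := rfl
@[simp] theorem rm_apply (x y : T) : rm x y = y * x := rfl

@[simp] theorem conv_one (f g : Module.End K T) : conv f g 1 = f 1 * g 1 := by
  simp [conv, deconc_one]

theorem conv_cons (f g : Module.End K T) (a : A) (x : T) :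
    conv f g (ιT a * x) = f 1 * g (ιT a * x) + conv (f ∘ₗ lm (ιT a)) g x := by
  simp only [conv, LinearMap.comp_apply, deconc_cons, map_add]
  congr 1
  · generalize deconc x = d
    induction d with
    | zero => simp
    | add x y hx hy => simp only [mul_add, map_add, hx, hy]
    | tmul x y => simp

theorem conv_add_left (f f' g : Module.End K T) : conv (f + f') g = conv f g + conv f' g := by
  ext x; simp [conv, TensorProduct.map_add_left]

theorem conv_add_right (f g g' : Module.End K T) : conv f (g + g') = conv f g + conv f g' := by
  ext x; simp [conv, TensorProduct.map_add_right]

theorem conv_smul_left (r : K) (f g : Module.End K T) : conv (r • f) g = r • conv f g := by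
  ext x; simp [conv, TensorProduct.map_smul_left]

theorem conv_smul_right (r : K) (f g : Module.End K T) : conv f (r • g) = r • conv f g := by
  ext x; simp [conv, TensorProduct.map_smul_right]

theorem conv_lm (c : T) (f g : Module.End K T) : conv (lm c ∘ₗ f) g = lm c ∘ₗ conv f g := by
  ext x
  simp only [conv, LinearMap.comp_apply]
  generalize deconc x = d
  induction d with
  | zero => simp
  | add x y hx hy => simp only [map_add, hx, hy]
  | tmul x y => simp [mul_assoc]

theorem conv_rm (c : T) (f g : Module.End K T) : conv f (rm c ∘ₗ g) = rm c ∘ₗ conv f g := by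
  ext x
  simp only [conv, LinearMap.comp_apply]
  generalize deconc x = d
  induction d with
  | zero => simp
  | add x y hx hy => simp only [map_add, hx, hy]
  | tmul x y => simp [mul_assoc]

theorem conv_zero_left (g : Module.End K T) : conv 0 g = 0 := by ext x; simp [conv]

theorem conv_comp_lm (f g : Module.End K T) (a : A) :
    conv f g ∘ₗ lm (ιT a) = lm (f 1) ∘ₗ g ∘ₗ lm (ιT a) + conv (f ∘ₗ lm (ιT a)) g := by
  ext x; simp [conv_cons]

theorem conv_snoc (f g : Module.End K T) (b : A) (x : T) :
    conv f g (x * ιT b) = f (x * ιT b) * g 1 + conv f (g ∘ₗ rm (ιT b)) x := by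
  induction x using induction_left generalizing f with
  | one =>
    have := conv_cons f g b 1
    simp only [mul_one] at this
    simp [this]; abel
  | cons a x h => rw [mul_assoc, conv_cons, conv_cons, h]; simp [mul_assoc]; abel
  | add x y hx hy => simp [add_mul, hx, hy]; abel
  | smul r x hx => simp [hx]

theorem conv_assoc (f g h : Module.End K T) : conv (conv f g) h = conv f (conv g h) := by
  ext x
  induction x using induction_left generalizing f g with
  | one => simp [mul_assoc]
  | cons a x ih =>
    rw [conv_cons, conv_cons, conv_comp_lm, conv_add_left, conv_lm, LinearMap.add_apply, ih,
      conv_cons]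
    simp [mul_add, mul_assoc, add_assoc]
  | add x y hx hy => simp [hx, hy]
  | smul r x hx => simp [hx]

/-- The algebra automorphism of the tensor algebra which is `(-1)^(i * n)` on `A^{⊗n}`. -/
def twist (i : ℤ) : T →ₐ[K] T := TensorAlgebra.lift K (sgn K i • ιT)

@[simp] theorem twist_ι (i : ℤ) (a : A) : twist i (ιT a) = sgn K i • ιT a := by simp [twist]

theorem twist_zero : (twist 0 : T →ₐ[K] T) = AlgHom.id K T := by ext a; simp

theorem sgn_mul_natCast_succ (i : ℤ) (n : ℕ) :
    sgn K (i * ((n + 1 : ℕ) : ℤ)) = sgn K i * sgn K (i * n) := by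
  rw [← sgn_add]; congr 1; push_cast; ring

theorem twist_apply (i : ℤ) {n : ℤ} {x : T} (hx : x ∈ tpow K A n) :
    twist i x = sgn K (i * n) • x := by
  rcases lt_or_ge n 0 with hn | hn
  · rw [tpow_of_neg hn, Submodule.mem_bot] at hx; simp [hx]
  lift n to ℕ using hn
  refine tpow_induction (C := fun n x => twist i x = sgn K (i * n) • x) (by simp) ?_ ?_ ?_ n x hx
  · intro n a x hx h
    rw [sgn_mul_natCast_succ, map_mul, h, twist_ι, smul_mul_smul_comm]
  · intro n x y hx hy
    simp [hx, hy]
  · intro n r x hx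
    simp [hx, smul_comm r]

/-- The operator `i(Ψ)` on the tensor algebra of `A[1]` attached to a map `Ψ` of degree `i`:
`i(Ψ)(x₁ ⋯ x_N) = ∑ (-1)^(i * j) x₁ ⋯ x_j Ψ(x_{j+1} ⋯ x_{j+k}) x_{j+k+1} ⋯ x_N`,
summed over all consecutive blocks of letters; the sign is the Koszul sign for moving `Ψ` past
the `j` odd letters `x₁, …, x_j`. -/
def ins (i : ℤ) : Module.End K T →ₗ[K] Module.End K T where
  toFun Ψ := conv (twist i).toLinearMap (conv Ψ LinearMap.id)
  map_add' Ψ Φ := by rw [conv_add_left, conv_add_right]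
  map_smul' r Ψ := by rw [conv_smul_left, conv_smul_right]; rfl

theorem ins_def (i : ℤ) (Ψ : Module.End K T) :
    ins i Ψ = conv (twist i).toLinearMap (conv Ψ LinearMap.id) := rfl

/-- The projection of the tensor algebra onto `A^{⊗n}`. -/
def tproj (n : ℕ) : Module.End K T :=
  GradedAlgebra.proj (fun n : ℕ => LinearMap.range ιT ^ n) n

theorem tproj_same {n : ℕ} {x : T} (hx : x ∈ tpow K A n) : tproj n x = x := by
  rw [tpow_natCast] at hx
  simp [tproj, GradedAlgebra.proj_apply, DirectSum.decompose_of_mem_same _ hx]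

theorem tproj_ne {n m : ℕ} {x : T} (hx : x ∈ tpow K A n) (h : n ≠ m) : tproj m x = 0 := by
  rw [tpow_natCast] at hx
  simp [tproj, GradedAlgebra.proj_apply, DirectSum.decompose_of_mem_ne _ hx h]

theorem tproj_one : tproj 0 (1 : T) = 1 := tproj_same one_mem_tpow

theorem cons_mem (n : ℕ) (a : A) {x : T} (hx : x ∈ tpow K A n) :
    ιT a * x ∈ tpow K A ((n + 1 : ℕ) : ℤ) := by
  have := mul_mem_tpow (ι_mem_tpow a) hx
  rwa [add_comm, ← Nat.cast_succ] at this

theorem tproj_zero_lm (a : A) : tproj 0 ∘ₗ lm (ιT a) = 0 := by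
  refine ext_tpow fun n x hx => ?_
  simp only [LinearMap.comp_apply, lm_apply, LinearMap.zero_apply]
  exact tproj_ne (cons_mem n a hx) (by omega)

theorem tproj_succ_lm (n : ℕ) (a : A) : tproj (n + 1) ∘ₗ lm (ιT a) = lm (ιT a) ∘ₗ tproj n := by
  refine ext_tpow fun m x hx => ?_
  simp only [LinearMap.comp_apply, lm_apply]
  by_cases h : m = n
  · subst h; rw [tproj_same (cons_mem m a hx), tproj_same hx]
  · rw [tproj_ne (cons_mem m a hx) (by omega), tproj_ne hx h, mul_zero]

theorem conv_tproj_left (f : Module.End K T) : conv (tproj 0) f = f := by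
  ext x
  induction x using induction_left with
  | one => simp [tproj_one]
  | cons a x h => simp [conv_cons, tproj_one, tproj_zero_lm, conv_zero_left]
  | add x y hx hy => simp [hx, hy]
  | smul r x hx => simp [hx]

theorem tproj_zero_cons (a : A) (x : T) : tproj 0 (ιT a * x) = 0 :=
  LinearMap.congr_fun (tproj_zero_lm a) x

theorem conv_tproj_right (f : Module.End K T) : conv f (tproj 0) = f := by
  ext x
  induction x using induction_left generalizing f with
  | one => simp [tproj_one]
  | cons a x h => rw [conv_cons, h, tproj_zero_cons]; simp
  | add x y hx hy => simp [hx, hy]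
  | smul r x hx => simp [hx]

/-- The convolution inverse of `twist i`. -/
def untwist (i : ℤ) : Module.End K T := tproj 0 - sgn K i • tproj 1

theorem untwist_lm (i : ℤ) (a : A) :
    untwist i ∘ₗ lm (ιT a) = (-sgn K i) • (lm (ιT a) ∘ₗ tproj 0) := by
  ext x
  have h0 := LinearMap.congr_fun (tproj_zero_lm (K := K) a) x
  have h1 := LinearMap.congr_fun (tproj_succ_lm (K := K) 0 a) x
  simp only [LinearMap.comp_apply, lm_apply, LinearMap.zero_apply, zero_add] at h0 h1
  simp [untwist, h0, h1]

theorem tproj_one_one : tproj 1 (1 : T) = 0 := tproj_ne (n := 0) one_mem_tpow (by omega)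

theorem untwist_one (i : ℤ) : untwist i (1 : T) = 1 := by
  simp [untwist, tproj_one, tproj_one_one]

theorem conv_untwist_twist (i : ℤ) :
    conv (untwist i) (twist i).toLinearMap = (tproj 0 : Module.End K T) := by
  ext x
  induction x using induction_left with
  | one => simp [untwist_one, tproj_one]
  | cons a x h =>
    rw [conv_cons, untwist_lm, tproj_zero_cons, untwist_one, conv_smul_left, conv_lm,
      conv_tproj_left]
    simp
  | add x y hx hy => simp only [map_add, hx, hy]
  | smul r x hx => simp only [map_smul, hx]

theorem twist_lm (i : ℤ) (a : A) : (twist i).toLinearMap ∘ₗ lm (ιT a) =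
    lm (sgn K i • ιT a) ∘ₗ (twist i).toLinearMap := by
  ext x; simp

theorem conv_twist_untwist (i : ℤ) :
    conv (twist i).toLinearMap (untwist i) = (tproj 0 : Module.End K T) := by
  ext x
  induction x using induction_left with
  | one => simp [untwist_one, tproj_one]
  | cons a x h =>
    rw [conv_cons, twist_lm, conv_lm, LinearMap.comp_apply, h, tproj_zero_cons]
    have := LinearMap.congr_fun (untwist_lm (K := K) i a) x
    simp only [LinearMap.comp_apply, lm_apply] at this
    simp [this]
  | add x y hx hy => simp only [map_add, hx, hy]
  | smul r x hx => simp only [map_smul, hx]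

/-- `Ψ ↦ i(Ψ)` is invertible on the space of all linear endomorphisms of the tensor algebra:
`Ψ` is recovered from `F = i(Ψ)` by
`Ψ(a y b) = F(a y b) ∓ a F(y b) - F(a y) b ± a F(y) b`, `Ψ(a) = F(a) ∓ a F(1) - F(1) a` and
`Ψ(1) = F(1)`. -/
def insEquiv (i : ℤ) : Module.End K T ≃ₗ[K] Module.End K T :=
  LinearEquiv.ofLinearMap (ins i)
    { toFun F := conv (untwist i) (conv F (untwist 0))
      map_add' F G := by rw [conv_add_left, conv_add_right]
      map_smul' r F := by rw [conv_smul_left, conv_smul_right]; rfl }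
    (by
      refine LinearMap.ext fun F => ?_
      have h := conv_untwist_twist (K := K) (A := A) 0
      rw [twist_zero] at h
      change conv _ (conv (conv _ (conv F _)) LinearMap.id) = F
      rw [conv_assoc, conv_assoc, ← conv_assoc (twist i).toLinearMap, conv_twist_untwist,
        conv_tproj_left]
      erw [h]
      rw [conv_tproj_right])
    (by
      refine LinearMap.ext fun F => ?_
      have h := conv_twist_untwist (K := K) (A := A) 0
      rw [twist_zero] at h
      change conv _ (conv (conv _ (conv F LinearMap.id)) _) = F
      rw [conv_assoc, conv_assoc, ← conv_assoc (untwist i), conv_untwist_twist,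
        conv_tproj_left]
      erw [h]
      rw [conv_tproj_right])

@[simp] theorem insEquiv_apply (i : ℤ) (Ψ : Module.End K T) : insEquiv i Ψ = ins i Ψ := rfl

@[simp] theorem ins_insEquiv_symm (i : ℤ) (F : Module.End K T) :
    ins i ((insEquiv i).symm F) = F := (insEquiv i).apply_symm_apply F

theorem ins_injective (i : ℤ) : Function.Injective (ins i : Module.End K T →ₗ[K] _) :=
  (insEquiv i).injective

/-- The graded commutator of operators of degrees `i` and `j`. -/
def comm (i j : ℤ) : Module.End K T →ₗ[K] Module.End K T →ₗ[K] Module.End K T :=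
  LinearMap.mk₂ K (fun F G => F ∘ₗ G - sgn K (i * j) • (G ∘ₗ F))
    (by intro F F' G; ext x; simp [smul_add]; abel)
    (by intro r F G; ext x; simp [smul_sub, smul_comm r])
    (by intro F G G'; ext x; simp [smul_add]; abel)
    (by intro r F G; ext x; simp [smul_sub, smul_comm r])

theorem comm_apply (i j : ℤ) (F G : Module.End K T) :
    comm i j F G = F ∘ₗ G - sgn K (i * j) • (G ∘ₗ F) := rfl

/-- The bracket of maps `Ψ₁`, `Ψ₂` of degrees `i`, `j`: the unique `Ψ₃` with
`i(Ψ₃) = i(Ψ₁) i(Ψ₂) - (-1)^(i * j) i(Ψ₂) i(Ψ₁)`. -/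
def bracket (i j : ℤ) : Module.End K T →ₗ[K] Module.End K T →ₗ[K] Module.End K T :=
  ((comm i j).compl₁₂ (ins i) (ins j)).compr₂ (insEquiv (i + j)).symm.toLinearMap

theorem bracket_apply (i j : ℤ) (Ψ Φ : Module.End K T) :
    bracket i j Ψ Φ = (insEquiv (i + j)).symm (comm i j (ins i Ψ) (ins j Φ)) := rfl

theorem ins_bracket (i j : ℤ) (Ψ Φ : Module.End K T) :
    ins (i + j) (bracket i j Ψ Φ) = comm i j (ins i Ψ) (ins j Φ) := by
  rw [bracket_apply, ins_insEquiv_symm]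

theorem ins_cons (i : ℤ) (Ψ : Module.End K T) (a : A) (x : T) :
    ins i Ψ (ιT a * x) = sgn K i • (ιT a * ins i Ψ x) + conv Ψ LinearMap.id (ιT a * x) := by
  rw [ins_def, conv_cons, twist_lm, conv_lm]
  simp [add_comm]

theorem ins_snoc (i : ℤ) (Ψ : Module.End K T) (x : T) (b : A) :
    ins i Ψ (x * ιT b) = ins i Ψ x * ιT b + conv (twist i).toLinearMap Ψ (x * ιT b) := by
  have : (LinearMap.id : Module.End K T) ∘ₗ rm (ιT b) = rm (ιT b) ∘ₗ LinearMap.id := by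
    ext; simp
  rw [ins_def, ← conv_assoc, conv_snoc, this, conv_rm]
  simp [add_comm]

theorem conv_id_snoc (Ψ : Module.End K T) (x : T) (b : A) :
    conv Ψ LinearMap.id (x * ιT b) = Ψ (x * ιT b) + conv Ψ LinearMap.id x * ιT b := by
  have : (LinearMap.id : Module.End K T) ∘ₗ rm (ιT b) = rm (ιT b) ∘ₗ LinearMap.id := by
    ext; simp
  rw [conv_snoc, this, conv_rm]
  simp

theorem conv_twist_cons (i : ℤ) (Ψ : Module.End K T) (a : A) (x : T) :
    conv (twist i).toLinearMap Ψ (ιT a * x) =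
      Ψ (ιT a * x) + sgn K i • (ιT a * conv (twist i).toLinearMap Ψ x) := by
  rw [conv_cons, twist_lm, conv_lm]; simp

variable (K A)

/-- The linear endomorphisms of the tensor algebra mapping `A^{⊗k}` to `A^{⊗(k-i)}` for all `k`. -/
def degHom (i : ℤ) : Submodule K (Module.End K T) where
  carrier := {Ψ | ∀ k : ℕ, ∀ x ∈ tpow K A k, Ψ x ∈ tpow K A (k - i)}
  add_mem' h h' k x hx := add_mem (h k x hx) (h' k x hx)
  zero_mem' _ _ _ := zero_mem _
  smul_mem' r _ h k x hx := Submodule.smul_mem _ r (h k x hx)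

/-- The linear endomorphisms of the tensor algebra vanishing on `A^{⊗k}` for all large `k`. -/
def finHom : Submodule K (Module.End K T) where
  carrier := {Ψ | ∃ p : ℕ, ∀ k : ℕ, p ≤ k → ∀ x ∈ tpow K A k, Ψ x = 0}
  add_mem' := by
    rintro Ψ Φ ⟨p, hp⟩ ⟨q, hq⟩
    refine ⟨max p q, fun k hk x hx => ?_⟩
    simp [hp k (le_trans (le_max_left _ _) hk) x hx, hq k (le_trans (le_max_right _ _) hk) x hx]
  zero_mem' := ⟨0, by simp⟩
  smul_mem' := by
    rintro r Ψ ⟨p, hp⟩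
    exact ⟨p, fun k hk x hx => by simp [hp k hk x hx]⟩

/-- The two ways to form the total space of a bigraded space. -/
inductive Totalization
  | directSum
  | directProduct

/-- The space `Hom^i(A)`: the direct sum, or the direct product, over all `k, l ≥ 0` with
`k - l = i` of the spaces `Hom(A^{⊗k}, A^{⊗l})`. Its elements are families of linear maps
`Ψ_k : A^{⊗k} → A^{⊗(k-i)}` (zero if `k < i`), with only finitely many nonzero members in the case
of the direct sum; such a family is the same thing as a linear endomorphism of
`T(A) = ⨁ₖ A^{⊗k}` which is homogeneous of degree `-i`. -/
def homDeg : Totalization → ℤ → Submodule K (Module.End K T)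
  | .directSum, i => degHom K A i ⊓ finHom K A
  | .directProduct, i => degHom K A i

variable {K A}

theorem mem_tpow_of_eq {p q : ℤ} {x : T} (hx : x ∈ tpow K A p) (h : p = q) :
    x ∈ tpow K A q := h ▸ hx

theorem degHom_apply {i : ℤ} {Ψ : Module.End K T} (hΨ : Ψ ∈ degHom K A i) {n m : ℤ} {x : T}
    (hx : x ∈ tpow K A n) (h : n - i = m) : Ψ x ∈ tpow K A m := by
  subst h
  rcases lt_or_ge n 0 with hn | hn
  · rw [tpow_of_neg hn, Submodule.mem_bot] at hx; simp [hx]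
  lift n to ℕ using hn
  exact hΨ n x hx

theorem homDeg_le_degHom (t : Totalization) (i : ℤ) : homDeg K A t i ≤ degHom K A i := by
  cases t
  · exact inf_le_left
  · exact le_rfl

theorem lm_mem (a : A) : lm (ιT a) ∈ degHom K A (-1) := fun k x hx =>
  mem_tpow_of_eq (mul_mem_tpow (ι_mem_tpow a) hx) (by ring)

theorem comp_mem {i j k : ℤ} {F G : Module.End K T} (hF : F ∈ degHom K A i)
    (hG : G ∈ degHom K A j) (h : i + j = k) : F ∘ₗ G ∈ degHom K A k := fun n x hx =>
  degHom_apply hF (hG n x hx) (by omega)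

theorem conv_mem {i j k : ℤ} {F G : Module.End K T} (hF : F ∈ degHom K A i)
    (hG : G ∈ degHom K A j) (h : i + j = k) : conv F G ∈ degHom K A k := by
  intro n x hx
  revert F i k
  refine tpow_induction (C := fun n x => ∀ {i k : ℤ} {F : Module.End K T}, F ∈ degHom K A i →
    i + j = k → conv F G x ∈ tpow K A (n - k)) ?_ ?_ ?_ ?_ n x hx
  · intro i k F hF h
    rw [conv_one]
    exact mem_tpow_of_eq (mul_mem_tpow (degHom_apply hF one_mem_tpow rfl)
      (degHom_apply hG one_mem_tpow rfl)) (by push_cast; omega)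
  · intro n a x hx ih i k F hF h
    rw [conv_cons]
    refine add_mem ?_ ?_
    · exact mem_tpow_of_eq (mul_mem_tpow (degHom_apply hF one_mem_tpow rfl)
        (degHom_apply hG (cons_mem n a hx) rfl)) (by push_cast; omega)
    · exact mem_tpow_of_eq (ih (k := k - 1) (comp_mem hF (lm_mem a) rfl) (by omega))
        (by push_cast; omega)
  · intro n x y hx hy i k F hF h
    rw [map_add]; exact add_mem (hx hF h) (hy hF h)
  · intro n r x hx i k F hF h
    rw [map_smul]; exact Submodule.smul_mem _ _ (hx hF h)

theorem twist_mem (i : ℤ) : (twist i).toLinearMap ∈ degHom K A 0 := fun n x hx => by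
  change twist i x ∈ _
  rw [twist_apply i hx, sub_zero]; exact Submodule.smul_mem _ _ hx

theorem id_mem : (LinearMap.id : Module.End K T) ∈ degHom K A 0 := fun n x hx => by
  simpa using hx

theorem tproj_mem (m : ℕ) : (tproj m : Module.End K T) ∈ degHom K A 0 := fun n x hx => by
  by_cases h : n = m
  · subst h; rw [tproj_same hx]; simpa using hx
  · rw [tproj_ne hx h]; exact zero_mem _

theorem untwist_mem (i : ℤ) : untwist i ∈ degHom K A 0 :=
  sub_mem (tproj_mem 0) (Submodule.smul_mem _ _ (tproj_mem 1))

theorem ins_mem {i : ℤ} {Ψ : Module.End K T} (h : Ψ ∈ degHom K A i) : ins i Ψ ∈ degHom K A i :=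
  conv_mem (twist_mem i) (conv_mem h id_mem (add_zero i)) (zero_add i)

theorem insEquiv_symm_mem {i : ℤ} {F : Module.End K T} (h : F ∈ degHom K A i) :
    (insEquiv i).symm F ∈ degHom K A i :=
  conv_mem (untwist_mem i) (conv_mem h (untwist_mem 0) (add_zero i)) (zero_add i)

theorem comm_mem {i j : ℤ} {F G : Module.End K T} (hF : F ∈ degHom K A i)
    (hG : G ∈ degHom K A j) : comm i j F G ∈ degHom K A (i + j) :=
  sub_mem (comp_mem hF hG rfl) (Submodule.smul_mem _ _ (comp_mem hG hF (add_comm j i)))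

theorem bracket_mem_degHom {i j : ℤ} {Ψ Φ : Module.End K T} (hΨ : Ψ ∈ degHom K A i)
    (hΦ : Φ ∈ degHom K A j) : bracket i j Ψ Φ ∈ degHom K A (i + j) := by
  rw [bracket_apply]
  exact insEquiv_symm_mem (comm_mem (ins_mem hΨ) (ins_mem hΦ))

/-! ### The bracket of finitely supported maps is finitely supported -/

theorem conv_mul_right_of_vanish {Ψ : Module.End K T} {p : ℕ}
    (hp : ∀ k : ℕ, p ≤ k → ∀ x ∈ tpow K A k, Ψ x = 0) {n : ℕ} (hn : p ≤ n + 1) {x : T}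
    (hx : x ∈ tpow K A n) (y : T) :
    conv Ψ LinearMap.id (x * y) = conv Ψ LinearMap.id x * y := by
  revert Ψ p
  refine tpow_induction (C := fun n x => ∀ {Ψ : Module.End K T} {p : ℕ},
    (∀ k : ℕ, p ≤ k → ∀ x ∈ tpow K A k, Ψ x = 0) → p ≤ n + 1 →
    conv Ψ LinearMap.id (x * y) = conv Ψ LinearMap.id x * y) ?_ ?_ ?_ ?_ n x hx
  · intro Ψ p hp h
    have hz : ∀ k : ℕ, ∀ y ∈ tpow K A k, conv Ψ LinearMap.id y = Ψ 1 * y := by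
      intro k y hy
      refine tpow_induction (C := fun k y => conv Ψ LinearMap.id y = Ψ 1 * y)
        (by simp) ?_ ?_ ?_ k y hy
      · intro n a x hx _
        have h0 : Ψ ∘ₗ lm (ιT a) = 0 := ext_tpow fun m z hz =>
          hp (m + 1) (by omega) _ (cons_mem m a hz)
        rw [conv_cons, h0, conv_zero_left]; simp
      · intro n x y hx hy; simp [hx, hy, mul_add]
      · intro n r x hx; simp [hx]
    have : conv Ψ LinearMap.id = lm (Ψ 1) := ext_tpow hz
    simp [this]
  · intro n a x hx ih Ψ p hp h
    have := ih (Ψ := Ψ ∘ₗ lm (ιT a)) (p := p - 1)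
      (fun k hk x hx => hp (k + 1) (by omega) _ (cons_mem k a hx)) (by omega)
    rw [mul_assoc, conv_cons, conv_cons, this]
    simp [add_mul, mul_assoc]
  · intro n x y hx hy Ψ p hp h
    simp [add_mul, hx hp h, hy hp h]
  · intro n r x hx Ψ p hp h
    simp [hx hp h]

theorem mul_snoc_mem {n : ℕ} (b : A) {x : T} (hx : x ∈ tpow K A n) :
    x * ιT b ∈ tpow K A ((n + 1 : ℕ) : ℤ) := by
  have := mul_mem_tpow hx (ι_mem_tpow b)
  rwa [← Nat.cast_succ] at this

theorem conv_twist_mul_left_of_vanish (i : ℤ) {Ψ : Module.End K T} {p : ℕ}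
    (hp : ∀ k : ℕ, p ≤ k → ∀ x ∈ tpow K A k, Ψ x = 0) {n : ℕ} (hn : p ≤ n + 1) {y : T}
    (hy : y ∈ tpow K A n) (x : T) :
    conv (twist i).toLinearMap Ψ (x * y) = twist i x * conv (twist i).toLinearMap Ψ y := by
  have key : ∀ a : A, ∀ x : T, ∀ m : ℕ, p ≤ m + 1 → x ∈ tpow K A m →
      conv (twist i).toLinearMap Ψ (ιT a * x) =
        sgn K i • (ιT a * conv (twist i).toLinearMap Ψ x) := by
    intro a x m hm hx
    rw [conv_twist_cons, hp (m + 1) hm _ (cons_mem m a hx), zero_add]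
  have : ∀ m : ℕ, ∀ x ∈ tpow K A m, conv (twist i).toLinearMap Ψ (x * y) =
      twist i x * conv (twist i).toLinearMap Ψ y := by
    intro m x hx
    refine tpow_induction (C := fun m x => conv (twist i).toLinearMap Ψ (x * y) =
      twist i x * conv (twist i).toLinearMap Ψ y) (by simp) ?_ ?_ ?_ m x hx
    · intro m a x hx ih
      have hxy : x * y ∈ tpow K A ((m + n : ℕ) : ℤ) := by
        rw [Nat.cast_add]; exact mul_mem_tpow hx hy
      rw [mul_assoc, key a _ _ (by omega) hxy, ih]
      simp [mul_assoc]
    · intro m x z hx hz; simp [add_mul, hx, hz]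
    · intro m r x hx; simp [hx]
  have h2 := ext_tpow (f := conv (twist i).toLinearMap Ψ ∘ₗ rm y)
    (g := rm (conv (twist i).toLinearMap Ψ y) ∘ₗ (twist i).toLinearMap) this
  exact LinearMap.congr_fun h2 x

theorem cons_snoc_formula (i : ℤ) (Ψ : Module.End K T) (a b : A) (y : T) :
    Ψ (ιT a * y * ιT b) = ins i Ψ (ιT a * y * ιT b) - sgn K i • (ιT a * ins i Ψ (y * ιT b))
      - ins i Ψ (ιT a * y) * ιT b + sgn K i • (ιT a * ins i Ψ y * ιT b) := by
  have h1 := ins_cons i Ψ a (y * ιT b)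
  have h2 := ins_cons i Ψ a y
  have h3 := conv_id_snoc Ψ (ιT a * y) b
  rw [mul_assoc] at h3 ⊢
  rw [h1, h2, h3]
  simp only [add_mul, smul_mul_assoc]
  abel

theorem ins_cons_snoc (i : ℤ) (Ψ : Module.End K T) (a b : A) (y : T) :
    ins i Ψ (ιT a * y * ιT b) = sgn K i • (ιT a * ins i Ψ y * ιT b)
      + sgn K i • (ιT a * conv (twist i).toLinearMap Ψ (y * ιT b))
      + conv Ψ LinearMap.id (ιT a * y) * ιT b + Ψ (ιT a * y * ιT b) := by
  have h1 := ins_cons i Ψ a (y * ιT b)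
  have h2 := ins_snoc i Ψ y b
  have h3 := conv_id_snoc Ψ (ιT a * y) b
  rw [mul_assoc] at h3 ⊢
  rw [h1, h2, h3]
  simp only [mul_add, smul_add, mul_assoc]
  abel

theorem comp_formula (i j : ℤ) (Ψ Φ : Module.End K T) (a b : A) (y : T) :
    ins i Ψ (ins j Φ (ιT a * y * ιT b))
      - sgn K (i + j) • (ιT a * ins i Ψ (ins j Φ (y * ιT b)))
      - ins i Ψ (ins j Φ (ιT a * y)) * ιT b
      + sgn K (i + j) • (ιT a * ins i Ψ (ins j Φ y) * ιT b) =
    sgn K j • Ψ (ιT a * ins j Φ y * ιT b)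
      + sgn K j • conv Ψ LinearMap.id (ιT a * conv (twist j).toLinearMap Φ (y * ιT b))
      + conv (twist i).toLinearMap Ψ (conv Φ LinearMap.id (ιT a * y) * ιT b)
      + ins i Ψ (Φ (ιT a * y * ιT b)) := by
  rw [ins_cons_snoc j, ins_snoc j Φ y b, ins_cons j Φ a y]
  simp only [map_add, map_smul]
  rw [ins_cons_snoc i, ins_cons i, ins_snoc i Ψ (conv Φ LinearMap.id (ιT a * y)),
    ins_snoc i Ψ (ins j Φ y), ins_cons i Ψ a (ins j Φ y), sgn_add]
  simp only [mul_add, add_mul, smul_add, smul_smul, smul_mul_assoc, mul_assoc, mul_comm (sgn K i)]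
  abel

theorem exists_split {P : T → Prop} (p q : ℕ) (mul : ∀ (m n : ℕ) u v, p ≤ m → q ≤ n →
      u ∈ tpow K A m → v ∈ tpow K A n → P (u * v))
    (add : ∀ x y, P x → P y → P (x + y)) {n : ℕ} (hn : p + q ≤ n) {x : T}
    (hx : x ∈ tpow K A n) : P x := by
  obtain ⟨m, rfl⟩ : ∃ m, n = p + m := ⟨n - p, by omega⟩
  rw [tpow_natCast, pow_add] at hx
  exact Submodule.mul_induction_on hx
    (fun u hu v hv => mul p m u v le_rfl (by omega) hu hv) add

theorem bracket_mem_finHom {i j : ℤ} {Ψ Φ : Module.End K T} (hΨ : Ψ ∈ degHom K A i)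
    (hΦ : Φ ∈ degHom K A j) (hΨ' : Ψ ∈ finHom K A) (hΦ' : Φ ∈ finHom K A) :
    bracket i j Ψ Φ ∈ finHom K A := by
  obtain ⟨p₀, hp₀⟩ := hΨ'
  obtain ⟨q₀, hq₀⟩ := hΦ'
  obtain ⟨p, hp⟩ : ∃ p : ℕ, ∀ k : ℕ, p ≤ k →
      (∀ x ∈ tpow K A k, Ψ x = 0) ∧ (∀ x ∈ tpow K A k, Φ x = 0) :=
    ⟨max p₀ q₀, fun k hk => ⟨hp₀ k (by omega), hq₀ k (by omega)⟩⟩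
  have hΨ0 : ∀ k : ℕ, p ≤ k → ∀ x ∈ tpow K A k, Ψ x = 0 := fun k hk => (hp k hk).1
  have hΦ0 : ∀ k : ℕ, p ≤ k → ∀ x ∈ tpow K A k, Φ x = 0 := fun k hk => (hp k hk).2
  have hΨz : ∀ k : ℤ, (p : ℤ) ≤ k → ∀ x ∈ tpow K A k, Ψ x = 0 := by
    intro k hk x hx
    lift k to ℕ using by omega
    exact hΨ0 k (by omega) x hx
  have hΦz : ∀ k : ℤ, (p : ℤ) ≤ k → ∀ x ∈ tpow K A k, Φ x = 0 := by
    intro k hk x hx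
    lift k to ℕ using by omega
    exact hΦ0 k (by omega) x hx
  have key : ∀ a b : A, ∀ n : ℕ, 2 * p + i.natAbs + j.natAbs + 2 ≤ n → ∀ y ∈ tpow K A n,
      bracket i j Ψ Φ (ιT a * y * ιT b) = 0 := by
    intro a b n hn y hy
    have hmem : ιT a * y * ιT b ∈ tpow K A ((n + 1 + 1 : ℕ) : ℤ) :=
      mul_snoc_mem b (cons_mem n a hy)
    have e1 := comp_formula i j Ψ Φ a b y
    have e2 := comp_formula j i Φ Ψ a b y
    have z1 : Ψ (ιT a * ins j Φ y * ιT b) = 0 :=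
      hΨz (1 + (n - j) + 1) (by omega) _ (mul_mem_tpow (mul_mem_tpow (ι_mem_tpow a)
        (degHom_apply (ins_mem hΦ) hy rfl)) (ι_mem_tpow b))
    have z2 : Φ (ιT a * ins i Ψ y * ιT b) = 0 :=
      hΦz (1 + (n - i) + 1) (by omega) _ (mul_mem_tpow (mul_mem_tpow (ι_mem_tpow a)
        (degHom_apply (ins_mem hΨ) hy rfl)) (ι_mem_tpow b))
    have z3 : Φ (ιT a * y * ιT b) = 0 := hΦ0 _ (by omega) _ hmem
    have z4 : Ψ (ιT a * y * ιT b) = 0 := hΨ0 _ (by omega) _ hmem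
    have aux : ∀ (i j : ℤ) (Ψ Φ : Module.End K T), Ψ ∈ degHom K A i → Φ ∈ degHom K A j →
        (∀ k : ℕ, p ≤ k → ∀ x ∈ tpow K A k, Ψ x = 0) →
        (∀ k : ℕ, p ≤ k → ∀ x ∈ tpow K A k, Φ x = 0) →
        sgn K j • conv Ψ LinearMap.id (ιT a * conv (twist j).toLinearMap Φ (y * ιT b)) =
          sgn K (i * j) •
            conv (twist j).toLinearMap Φ (conv Ψ LinearMap.id (ιT a * y) * ιT b) := by
      intro i j Ψ Φ hΨ hΦ hΨ0 hΦ0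
      refine exists_split (P := fun y =>
        sgn K j • conv Ψ LinearMap.id (ιT a * conv (twist j).toLinearMap Φ (y * ιT b)) =
          sgn K (i * j) •
            conv (twist j).toLinearMap Φ (conv Ψ LinearMap.id (ιT a * y) * ιT b))
        p p ?_ ?_ (by omega) hy
      · intro m l u v hm hl hu hv
        have hPu : conv Ψ LinearMap.id (ιT a * u) ∈ tpow K A ((m + 1 : ℕ) - i) :=
          degHom_apply (conv_mem hΨ id_mem (add_zero i)) (cons_mem m a hu) rfl
        rw [mul_assoc u v, conv_twist_mul_left_of_vanish j hΦ0 (by omega) (mul_snoc_mem b hv),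
          ← mul_assoc, ← mul_assoc, twist_apply j hu, mul_smul_comm, smul_mul_assoc, map_smul,
          conv_mul_right_of_vanish hΨ0 (by omega) (cons_mem m a hu),
          conv_mul_right_of_vanish hΨ0 (by omega) (cons_mem m a hu), mul_assoc _ v,
          conv_twist_mul_left_of_vanish j hΦ0 (by omega) (mul_snoc_mem b hv),
          twist_apply j hPu, smul_mul_assoc, smul_smul, smul_smul, ← sgn_add, ← sgn_add]
        congr 2
        push_cast; ring
      · intro x y hx hy
        simp only [add_mul, mul_add, map_add, smul_add, hx, hy]
    have a1 := aux i j Ψ Φ hΨ hΦ hΨ0 hΦ0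
    have a2 := aux j i Φ Ψ hΦ hΨ hΦ0 hΨ0
    rw [z1, z3, map_zero, smul_zero, zero_add, add_zero, a1] at e1
    rw [z2, z4, map_zero, smul_zero, zero_add, add_zero, a2, mul_comm j i, add_comm j i] at e2
    rw [cons_snoc_formula (i + j), ins_bracket, comm_apply]
    have hs : sgn K (i * j) * sgn K (i * j) = 1 := sgn_mul_self _
    have e3 := congrArg (fun z => sgn K (i * j) • z) e2
    simp only [smul_add, smul_sub, smul_smul, hs, one_smul] at e3
    simp only [LinearMap.sub_apply, LinearMap.smul_apply, LinearMap.comp_apply, mul_sub, sub_mul,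
      mul_smul_comm, smul_mul_assoc, smul_sub, smul_smul]
    have e4 := e1.trans ((add_comm _ _).trans e3.symm)
    rw [← sub_eq_zero] at e4
    simp only [mul_comm (sgn K (i * j))] at e4
    rw [← e4]
    abel
  refine ⟨2 * p + i.natAbs + j.natAbs + 4, fun k hk x hx => ?_⟩
  obtain ⟨n, rfl⟩ : ∃ n, k = 1 + n + 1 := ⟨k - 2, by omega⟩
  rw [tpow_natCast, pow_add, pow_add, pow_one] at hx
  refine Submodule.mul_induction_on hx ?_ (fun x y hx hy => by simp [hx, hy])
  rintro w hw _ ⟨b, rfl⟩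
  refine Submodule.mul_induction_on hw ?_ (fun x y hx hy => by simp [add_mul, hx, hy])
  rintro _ ⟨a, rfl⟩ y hy
  exact key a b n (by omega) y hy

/-- The bracket of `Hom^i(A)` and `Hom^j(A)` lands in `Hom^{i+j}(A)`. -/
theorem bracket_mem {t : Totalization} {i j : ℤ} {Ψ Φ : Module.End K T}
    (hΨ : Ψ ∈ homDeg K A t i) (hΦ : Φ ∈ homDeg K A t j) :
    bracket i j Ψ Φ ∈ homDeg K A t (i + j) := by
  cases t
  · exact ⟨bracket_mem_degHom hΨ.1 hΦ.1, bracket_mem_finHom hΨ.1 hΦ.1 hΨ.2 hΦ.2⟩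
  · exact bracket_mem_degHom hΨ hΦ

/-! ### The differential -/

theorem comm_comm_self (i : ℤ) {b F : Module.End K T} (hb : b ∘ₗ b = 0) :
    comm 1 (1 + i) b (comm 1 i b F) = 0 := by
  ext x
  have h : ∀ y, b (b y) = 0 := fun y => LinearMap.congr_fun hb y
  simp [comm_apply, h, sgn_add]

theorem comm_leibniz (i j : ℤ) (b F G : Module.End K T) :
    comm 1 (i + j) b (comm i j F G) =
      comm (1 + i) j (comm 1 i b F) G + sgn K i • comm i (1 + j) F (comm 1 j b G) := by
  ext x
  simp only [comm_apply, LinearMap.sub_apply, LinearMap.comp_apply, LinearMap.smul_apply,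
    LinearMap.add_apply, map_sub, map_smul, one_mul, add_mul, mul_add, mul_one, sgn_add]
  rcases sgn_cases (K := K) i with hi | hi <;> rcases sgn_cases (K := K) j with hj | hj <;>
    rcases sgn_cases (K := K) (i * j) with hij | hij <;> simp [hi, hj, hij] <;> abel

end General

section Algebra

variable {K : Type*} [Field K] {A : Type*} [NonUnitalRing A] [Module K A] [IsScalarTower K A A]
  [SMulCommClass K A A]

local notation "T" => TensorAlgebra K A
local notation "ιT" => TensorAlgebra.ι K (M := A)

variable (K A) in
/-- The product `m : A^{⊗2} → A` of `A`, extended by zero to the other components `A^{⊗k}`. -/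
def mulMap : Module.End K T :=
  ιT ∘ₗ Unitization.sndHom K K A ∘ₗ
    (TensorAlgebra.lift K (Unitization.inrHom K K A)).toLinearMap ∘ₗ tproj 2

theorem mulMap_ne {n : ℕ} {x : T} (hx : x ∈ tpow K A n) (h : n ≠ 2) : mulMap K A x = 0 := by
  simp [mulMap, tproj_ne hx h]

theorem mulMap_two (a c : A) : mulMap K A (ιT a * ιT c) = ιT (a * c) := by
  have : ιT a * ιT c ∈ tpow K A (2 : ℕ) := by
    have := cons_mem (K := K) 1 a (ι_mem_tpow c)
    simpa using this
  simp [mulMap, tproj_same this, ← Unitization.inr_mul]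

theorem mulMap_mem (t : Totalization) : mulMap K A ∈ homDeg K A t 1 := by
  have h1 : mulMap K A ∈ degHom K A 1 := by
    intro k x hx
    by_cases h : k = 2
    · subst h; exact mem_tpow_of_eq (ι_mem_tpow _) (by norm_num)
    · rw [mulMap_ne hx h]; exact zero_mem _
  cases t
  · exact ⟨h1, 3, fun k hk x hx => mulMap_ne hx (by omega)⟩
  · exact h1

theorem mulMap_one : mulMap K A 1 = 0 := mulMap_ne (n := 0) one_mem_tpow (by omega)

theorem mulMap_ι (a : A) : mulMap K A (ιT a) = 0 := mulMap_ne (n := 1) (ι_mem_tpow a) (by omega)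

theorem mulMap_lm_lm (a c : A) :
    (mulMap K A ∘ₗ lm (ιT a)) ∘ₗ lm (ιT c) = lm (ιT (a * c)) ∘ₗ tproj 0 := by
  refine ext_tpow fun n x hx => ?_
  simp only [LinearMap.comp_apply, lm_apply]
  by_cases h : n = 0
  · subst h
    rw [tproj_same hx]
    rw [tpow_natCast, pow_zero, Submodule.mem_one] at hx
    obtain ⟨r, rfl⟩ := hx
    simp [Algebra.algebraMap_eq_smul_one, mulMap_two]
  · rw [tproj_ne hx h, mulMap_ne (cons_mem _ a (cons_mem n c hx)) (by omega), mul_zero]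

theorem conv_mulMap_one (a : A) : conv (mulMap K A) LinearMap.id (ιT a) = 0 := by
  have := conv_cons (mulMap K A) LinearMap.id a 1
  simpa [mulMap_one, mulMap_ι] using this

theorem conv_mulMap_cons (a c : A) (y : T) :
    conv (mulMap K A) LinearMap.id (ιT a * (ιT c * y)) = ιT (a * c) * y := by
  rw [conv_cons, conv_cons, mulMap_lm_lm, conv_lm, conv_tproj_left]
  simp [mulMap_one, mulMap_ι]

theorem ins_mulMap_one : ins 1 (mulMap K A) 1 = 0 := by simp [ins_def, mulMap_one]

theorem ins_mulMap_cons (a : A) (x : T) : ins 1 (mulMap K A) (ιT a * x) =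
    -(ιT a * ins 1 (mulMap K A) x) + conv (mulMap K A) LinearMap.id (ιT a * x) := by
  rw [ins_cons]; simp

/-- The bar differential squares to zero. -/
theorem ins_mulMap_sq : ins 1 (mulMap K A) ∘ₗ ins 1 (mulMap K A) = 0 := by
  have hh : ∀ a c : A, ∀ y : T, conv (mulMap K A) LinearMap.id
      (ιT a * conv (mulMap K A) LinearMap.id (ιT c * y)) =
      conv (mulMap K A) LinearMap.id (ιT (a * c) * y) := by
    intro a c y
    induction y using induction_left with
    | one => simp [conv_mulMap_one]
    | cons e z _ => rw [conv_mulMap_cons, conv_mulMap_cons, conv_mulMap_cons, mul_assoc]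
    | add x y hx hy => simp only [mul_add, map_add, hx, hy]
    | smul r x hx => simp only [mul_smul_comm, map_smul, hx]
  have hb : ∀ a : A, ∀ x : T,
      conv (mulMap K A) LinearMap.id (ιT a * ins 1 (mulMap K A) x) =
        ins 1 (mulMap K A) (conv (mulMap K A) LinearMap.id (ιT a * x)) := by
    intro a x
    induction x using induction_left with
    | one => simp [ins_mulMap_one, conv_mulMap_one]
    | cons c y _ =>
      rw [ins_mulMap_cons, conv_mulMap_cons, ins_mulMap_cons, mul_add, map_add, hh, mul_neg,
        map_neg, conv_mulMap_cons]
    | add x y hx hy => simp only [mul_add, map_add, hx, hy]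
    | smul r x hx => simp only [mul_smul_comm, map_smul, hx]
  ext x
  simp only [LinearMap.comp_apply, LinearMap.zero_apply]
  induction x using induction_left with
  | one => simp [ins_mulMap_one]
  | cons a x h =>
    rw [ins_mulMap_cons, map_add, map_neg, ins_mulMap_cons, h, hb]; simp
  | add x y hx hy => simp [hx, hy]
  | smul r x hx => simp [hx]

variable (K A)

/-- The differential `Ψ ↦ [m, Ψ]` of `Hom^•(A)` on maps of degree `i`. -/
def diff (i : ℤ) : Module.End K T →ₗ[K] Module.End K T := bracket 1 i (mulMap K A)

/-- The cocycles of degree `i`. -/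
def cocycles (t : Totalization) (i : ℤ) : Submodule K (Module.End K T) :=
  homDeg K A t i ⊓ LinearMap.ker (diff K A i)

/-- The coboundaries of degree `i`. -/
def coboundaries (t : Totalization) (i : ℤ) : Submodule K (Module.End K T) :=
  (homDeg K A t (i - 1)).map (diff K A (i - 1))

variable {K A}

theorem ins_diff (i : ℤ) (Ψ : Module.End K T) : ins (1 + i) (diff K A i Ψ) =
    comm 1 i (ins 1 (mulMap K A)) (ins i Ψ) := ins_bracket _ _ _ _

theorem diff_eq_zero_iff (i : ℤ) (Ψ : Module.End K T) : diff K A i Ψ = 0 ↔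
    comm 1 i (ins 1 (mulMap K A)) (ins i Ψ) = 0 := by
  rw [← ins_diff, map_eq_zero_iff _ (ins_injective _)]

theorem diff_mem {t : Totalization} {i : ℤ} {Ψ : Module.End K T} (h : Ψ ∈ homDeg K A t i) :
    diff K A i Ψ ∈ homDeg K A t (1 + i) := bracket_mem (mulMap_mem t) h

theorem diff_diff (i : ℤ) (Ψ : Module.End K T) : diff K A (1 + i) (diff K A i Ψ) = 0 := by
  rw [diff_eq_zero_iff, ins_diff, comm_comm_self i ins_mulMap_sq]

theorem coboundaries_le_cocycles (t : Totalization) (i : ℤ) :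
    coboundaries K A t i ≤ cocycles K A t i := by
  rintro _ ⟨Ψ, hΨ, rfl⟩
  obtain ⟨k, rfl⟩ : ∃ k, i = 1 + k := ⟨i - 1, by ring⟩
  rw [add_sub_cancel_left] at hΨ ⊢
  exact ⟨diff_mem hΨ, diff_diff k Ψ⟩

theorem diff_bracket (i j : ℤ) (Ψ Φ : Module.End K T) :
    diff K A (i + j) (bracket i j Ψ Φ) =
      bracket (1 + i) j (diff K A i Ψ) Φ + sgn K i • bracket i (1 + j) Ψ (diff K A j Φ) := by
  apply ins_injective (1 + (i + j))
  have h1 := ins_bracket (1 + i) j (diff K A i Ψ) Φ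
  have h2 := ins_bracket i (1 + j) Ψ (diff K A j Φ)
  rw [show 1 + i + j = 1 + (i + j) by ring] at h1
  rw [show i + (1 + j) = 1 + (i + j) by ring] at h2
  rw [ins_diff, ins_bracket, map_add, map_smul, h1, h2, ins_diff, ins_diff, comm_leibniz]

theorem bracket_mem_cocycles {t : Totalization} {i j : ℤ} {Ψ Φ : Module.End K T}
    (hΨ : Ψ ∈ cocycles K A t i) (hΦ : Φ ∈ cocycles K A t j) :
    bracket i j Ψ Φ ∈ cocycles K A t (i + j) := by
  refine ⟨bracket_mem hΨ.1 hΦ.1, ?_⟩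
  have h1 : diff K A i Ψ = 0 := hΨ.2
  have h2 : diff K A j Φ = 0 := hΦ.2
  change diff K A (i + j) (bracket i j Ψ Φ) = 0
  rw [diff_bracket, h1, h2]; simp

theorem bracket_mem_coboundaries_left {t : Totalization} {i j : ℤ} {Ψ Φ : Module.End K T}
    (hΨ : Ψ ∈ coboundaries K A t i) (hΦ : Φ ∈ cocycles K A t j) :
    bracket i j Ψ Φ ∈ coboundaries K A t (i + j) := by
  obtain ⟨X, hX, rfl⟩ := hΨ
  obtain ⟨k, rfl⟩ : ∃ k, i = 1 + k := ⟨i - 1, by ring⟩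
  rw [add_sub_cancel_left] at hX ⊢
  have h2 : diff K A j Φ = 0 := hΦ.2
  have h := diff_bracket k j X Φ
  rw [h2, map_zero, smul_zero, add_zero] at h
  refine ⟨bracket k j X Φ, ?_, ?_⟩
  · have := bracket_mem hX hΦ.1
    rwa [show 1 + k + j - 1 = k + j by ring]
  · rw [show 1 + k + j - 1 = k + j by ring, h]

theorem bracket_mem_coboundaries_right {t : Totalization} {i j : ℤ} {Ψ Φ : Module.End K T}
    (hΨ : Ψ ∈ cocycles K A t i) (hΦ : Φ ∈ coboundaries K A t j) :
    bracket i j Ψ Φ ∈ coboundaries K A t (i + j) := by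
  obtain ⟨X, hX, rfl⟩ := hΦ
  obtain ⟨k, rfl⟩ : ∃ k, j = 1 + k := ⟨j - 1, by ring⟩
  rw [add_sub_cancel_left] at hX ⊢
  have h1 : diff K A i Ψ = 0 := hΨ.2
  have h := diff_bracket i k Ψ X
  rw [h1, map_zero, LinearMap.zero_apply, zero_add] at h
  refine ⟨sgn K i • bracket i k Ψ X, ?_, ?_⟩
  · have := Submodule.smul_mem _ (sgn K i) (bracket_mem hΨ.1 hX)
    rwa [show i + (1 + k) - 1 = i + k by ring]
  · rw [show i + (1 + k) - 1 = i + k by ring, map_smul, h, smul_smul, sgn_mul_self, one_smul]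

variable (K A)

/-- The cohomology `H^i(Hom^•(A))`. -/
abbrev Cohomology (t : Totalization) (i : ℤ) : Type _ :=
  cocycles K A t i ⧸ (coboundaries K A t i).submoduleOf (cocycles K A t i)

variable {K A}

/-- The cohomology class of a cocycle. -/
def toCohomology (t : Totalization) (i : ℤ) : cocycles K A t i →ₗ[K] Cohomology K A t i :=
  Submodule.mkQ _

/-- The bracket of two cocycles, as a cohomology class. -/
def cocycleBracket (t : Totalization) (i j : ℤ) :
    cocycles K A t i →ₗ[K] cocycles K A t j →ₗ[K] Cohomology K A t (i + j) :=
  LinearMap.mk₂ K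
    (fun x y => toCohomology t (i + j) ⟨bracket i j x y, bracket_mem_cocycles x.2 y.2⟩)
    (by intro x x' y; rw [← map_add]; congr 1; ext1; simp)
    (by intro r x y; rw [← map_smul]; congr 1; ext1; simp)
    (by intro x y y'; rw [← map_add]; congr 1; ext1; simp)
    (by intro r x y; rw [← map_smul]; congr 1; ext1; simp)

theorem cocycleBracket_left (t : Totalization) (i j : ℤ) :
    (coboundaries K A t i).submoduleOf (cocycles K A t i) ≤
      LinearMap.ker (cocycleBracket (K := K) (A := A) t i j) := by
  intro x hx
  ext y
  exact (Submodule.Quotient.mk_eq_zero _).mpr (bracket_mem_coboundaries_left hx y.2)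

theorem cocycleBracket_right (t : Totalization) (i j : ℤ) :
    (coboundaries K A t j).submoduleOf (cocycles K A t j) ≤
      LinearMap.ker (cocycleBracket (K := K) (A := A) t i j).flip := by
  intro y hy
  ext x
  exact (Submodule.Quotient.mk_eq_zero _).mpr (bracket_mem_coboundaries_right x.2 hy)

/-- The bracket `H^i × H^j → H^{i+j}` induced on the cohomology of `Hom^•(A)`. -/
def cohomologyBracket (t : Totalization) (i j : ℤ) :
    Cohomology K A t i →ₗ[K] Cohomology K A t j →ₗ[K] Cohomology K A t (i + j) :=
  Submodule.liftQ _ ((Submodule.liftQ _ _ (cocycleBracket_right t i j)).flip) (by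
    intro x hx
    have h := LinearMap.mem_ker.mp (cocycleBracket_left t i j hx)
    ext y
    exact LinearMap.congr_fun h y)

theorem cohomologyBracket_toCohomology (t : Totalization) (i j : ℤ) (x : cocycles K A t i)
    (y : cocycles K A t j) :
    cohomologyBracket t i j (toCohomology t i x) (toCohomology t j y) =
      toCohomology t (i + j) ⟨bracket i j x y, bracket_mem_cocycles x.2 y.2⟩ := rfl

variable (K A)

/-- The total cohomology `H^•(Hom^•(A)) = ⨁ᵢ H^i(Hom^•(A))`. -/
abbrev TotalCohomology (t : Totalization) : Type _ := ⨁ i : ℤ, Cohomology K A t i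

variable {K A}

/-- The class in the total cohomology of a cocycle of degree `i`. -/
def cls (t : Totalization) (i : ℤ) : cocycles K A t i →ₗ[K] TotalCohomology K A t :=
  DirectSum.lof K ℤ (fun i => Cohomology K A t i) i ∘ₗ toCohomology t i

/-- The bracket induced on the total cohomology of `Hom^•(A)`. -/
def totalBracket (t : Totalization) :
    TotalCohomology K A t →ₗ[K] TotalCohomology K A t →ₗ[K] TotalCohomology K A t :=
  DirectSum.toModule K ℤ _ fun i => LinearMap.flip <| DirectSum.toModule K ℤ _ fun j =>
    ((cohomologyBracket t i j).compr₂
      (DirectSum.lof K ℤ (fun i => Cohomology K A t i) (i + j))).flip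

theorem totalBracket_cls (t : Totalization) (i j : ℤ) (x : cocycles K A t i)
    (y : cocycles K A t j) :
    totalBracket t (cls t i x) (cls t j y) =
      cls t (i + j) ⟨bracket i j x y, bracket_mem_cocycles x.2 y.2⟩ := by
  simp [totalBracket, cls, cohomologyBracket_toCohomology]

end Algebra

section Polynomials

variable (K : Type*) [Field K] (V : Type*) [AddCommGroup V] [Module K V]

/-- The non-unital algebra `S(V)₀` of polynomials without constant term. -/
def S₀ : NonUnitalSubalgebra K (SymmetricAlgebra K V) where
  carrier := {f | SymmetricAlgebra.algebraMapInv f = 0}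
  add_mem' {f g} hf hg := by simp_all
  zero_mem' := map_zero SymmetricAlgebra.algebraMapInv
  mul_mem' {f g} hf hg := by simp_all
  smul_mem' r f hf := by simp_all

variable {K V}

/-- The generators `V → S(V)₀`. -/
def gen : V →ₗ[K] S₀ K V :=
  (SymmetricAlgebra.ι K V).codRestrict (S₀ K V).toSubmodule
    (fun v => SymmetricAlgebra.algebraMapInv_ι v)

/-- The linear form on `S(V)₀` equal to `ξ` on `V` and to zero on `S^n(V)` for `n ≥ 2`, obtained
as the coefficient of `ε` of the algebra map `S(V) → K[ε]/(ε²)`, `v ↦ ξ(v) ε`. -/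
def linForm (ξ : Module.Dual K V) : S₀ K V →ₗ[K] K :=
  TrivSqZeroExt.sndHom K K ∘ₗ
    (SymmetricAlgebra.lift (TrivSqZeroExt.inrHom K K ∘ₗ ξ)).toLinearMap ∘ₗ
      (S₀ K V).toSubmodule.subtype

/-- The antisymmetrization `∑_σ sgn(σ) v_{σ(1)} ⊗ ⋯ ⊗ v_{σ(l)}` in `S(V)₀^{⊗l}`. -/
def antisymm {l : ℕ} (v : Fin l → V) : TensorAlgebra K (S₀ K V) :=
  ∑ σ : Equiv.Perm (Fin l),
    (Equiv.Perm.sign σ : ℤ) • TensorAlgebra.tprod K (S₀ K V) l (fun i => gen (v (σ i)))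

/-- `v_1 ∧ ⋯ ∧ v_l ⊗ ξ_1 ∧ ⋯ ∧ ξ_k` is the leading symbol of `Ψ`: the map `Ψ` vanishes on
`S(V)₀^{⊗n}` for `n < k`, and on `S(V)₀^{⊗k}` it is the map
`a_1 ⊗ ⋯ ⊗ a_k ↦ ξ_k(a_1) ⋯ ξ_1(a_k) ∑_σ sgn(σ) v_{σ(1)} ⊗ ⋯ ⊗ v_{σ(l)}`. -/
def HasSymbol {k l : ℕ} (v : Fin l → V) (ξ : Fin k → Module.Dual K V)
    (Ψ : Module.End K (TensorAlgebra K (S₀ K V))) : Prop :=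
  (∀ n : ℕ, n < k → ∀ x ∈ tpow K (S₀ K V) n, Ψ x = 0) ∧
    ∀ a : Fin k → S₀ K V, Ψ (TensorAlgebra.tprod K (S₀ K V) k a) =
      (∏ i, linForm (ξ i.rev) (a i)) • antisymm v

variable (K V)

/-- The Clifford algebra of `V ⊕ V*` with the quadratic form `(v, ξ) ↦ ξ(v)`. -/
abbrev Clif : Type _ := CliffordAlgebra (QuadraticForm.dualProd K V)

variable {K V}

/-- The subalgebra `Λ(V) → Clif(V ⊕ V*)`. -/
def extV : ExteriorAlgebra K V →ₐ[K] Clif K V :=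
  ExteriorAlgebra.lift K
    ⟨CliffordAlgebra.ι (QuadraticForm.dualProd K V) ∘ₗ LinearMap.inr K (Module.Dual K V) V,
      fun v => by simp [CliffordAlgebra.ι_sq_scalar]⟩

/-- The subalgebra `Λ(V*) → Clif(V ⊕ V*)`. -/
def extDual : ExteriorAlgebra K (Module.Dual K V) →ₐ[K] Clif K V :=
  ExteriorAlgebra.lift K
    ⟨CliffordAlgebra.ι (QuadraticForm.dualProd K V) ∘ₗ LinearMap.inl K (Module.Dual K V) V,
      fun v => by simp [CliffordAlgebra.ι_sq_scalar]⟩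

end Polynomials


end TensorHom

end

/-! The bracket is defined by commutators of the operators i(Ψ), and `insEquiv` makes Ψ ↦ i(Ψ)
bijective on endomorphisms of T(A). Hence the direct-product version of Hom^•(A) is the graded
endomorphism complex of T(A), with differential the commutator with the bar differential `bar`. Over
a field the cohomology of an endomorphism complex is the graded endomorphism algebra of the
homology. For A = S(V)₀ the bar homology is Λ(V), and the Clifford algebra is End Λ(V), with V
acting by wedge and V* by contraction. So κ is Λ(V) ⊗ Λ(V*) → End Λ(V) followed by the inverse of
the identification H^• → End Λ(V). The bracket formula holds because both identifications turn
products into composition.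

Bar homology is needed in explicit form. In characteristic zero the de Rham differential, divided by
total weight, contracts the Koszul complex (`kosD_kosC`). From such a contraction one builds, by
recursion on the first letter, a comparison map γ from the bar complex and a homotopy t
(`Comparison.barP_t`). This is done with coefficients in a ring P over S(V), because two cases are
used. For P = K it gives `bar_htpy`: the antisymmetrization `alt` and the projection `toExt` form a
deformation retraction of the bar complex onto Λ(V). With it, `AugIdeal.exists_comm_eq` and
`AugIdeal.transfer_comp` identify cohomology classes with endomorphisms of Λ(V).

For the direct sum one must also remove infinite tails. Take P = S(V) and let the last letter of a
word be the coefficient. As Λ^q(V) = 0 for q > dim V, γ vanishes on long words, and t yields a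
contraction `lhtpy` compatible with multiplication into the first and the last letter. By
`diff_cons_snoc`, on long words [m, Ψ] is the commutator with the bar differential plus two terms
multiplying into the outer letters, so composing with `lhtpy` kills tails
(`AugIdeal.exists_diff_sub_mem_finHom`).

On the Clifford side, `cliffRep_ordMap_bijective` combines normal ordering, the vacuum projection
and a dimension count. The representatives come from `AugIdeal.symbolOp`, a cocycle operator with
prescribed value on A^{⊗k} and zero on shorter words; its lowest component is unchanged by the
inverse of i (`insEquiv_symm_of_vanish`). -/

noncomputable section

namespace TensorHom

set_option hygiene false

local notation "Λ" => ExteriorAlgebra K V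
local notation "ΛD" => ExteriorAlgebra K (Module.Dual K V)
local notation "S" => SymmetricAlgebra K V
local notation "T" => TensorAlgebra K A
local notation "ιT" => TensorAlgebra.ι K (M := A)

set_option hygiene true

/-! ### Wedge, contraction and degrees in the exterior algebra. -/

section Exterior

variable {K : Type*} [Field K] {V : Type*} [AddCommGroup V] [Module K V]

/-- Exterior multiplication by a vector. -/
def wedge : V →ₗ[K] Module.End K Λ := LinearMap.mul K Λ ∘ₗ ExteriorAlgebra.ι K

/-- Contraction with a linear form. -/
def contr : Module.Dual K V →ₗ[K] Module.End K Λ :=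
  CliffordAlgebra.contractLeft (Q := (0 : QuadraticForm K V))

theorem wedge_apply (v : V) (w : Λ) : wedge v w = ExteriorAlgebra.ι K v * w := rfl

theorem contr_ι_mul (ξ : Module.Dual K V) (v : V) (w : Λ) :
    contr ξ (ExteriorAlgebra.ι K v * w) = ξ v • w - ExteriorAlgebra.ι K v * contr ξ w :=
  CliffordAlgebra.contractLeft_ι_mul ξ v w

theorem contr_wedge (ξ : Module.Dual K V) (v : V) (w : Λ) :
    contr ξ (wedge v w) = ξ v • w - wedge v (contr ξ w) := contr_ι_mul ξ v w

@[simp] theorem contr_one (ξ : Module.Dual K V) : contr ξ (1 : Λ) = 0 :=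
  CliffordAlgebra.contractLeft_one (0 : QuadraticForm K V) ξ

theorem contr_contr (ξ : Module.Dual K V) (w : Λ) : contr ξ (contr ξ w) = 0 :=
  CliffordAlgebra.contractLeft_contractLeft ξ w

theorem one_mem_extPow : (1 : Λ) ∈ ⋀[K]^0 V := by
  rw [ExteriorAlgebra.exteriorPower, pow_zero]; exact Submodule.one_le.mp le_rfl

theorem wedge_mem {q : ℕ} (v : V) {w : Λ} (hw : w ∈ ⋀[K]^q V) : wedge v w ∈ ⋀[K]^(q + 1) V := by
  rw [ExteriorAlgebra.exteriorPower, pow_succ']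
  exact Submodule.mul_mem_mul ⟨v, rfl⟩ hw

theorem extPow_induction {C : (q : ℕ) → Λ → Prop}
    (one : C 0 1) (cons : ∀ (q : ℕ) v w, w ∈ ⋀[K]^q V → C q w → C (q + 1) (wedge v w))
    (add : ∀ q x y, C q x → C q y → C q (x + y)) (smul : ∀ q (r : K) x, C q x → C q (r • x))
    (q : ℕ) (w : Λ) (hw : w ∈ ⋀[K]^q V) : C q w := by
  rw [ExteriorAlgebra.exteriorPower] at hw
  induction hw using Submodule.pow_induction_on_left' with
  | algebraMap r => rw [Algebra.algebraMap_eq_smul_one]; exact smul _ _ _ one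
  | add x y i hx hy ihx ihy => exact add _ _ _ ihx ihy
  | mem_mul m hm i x hx ih => obtain ⟨v, rfl⟩ := hm; exact cons _ _ _ hx ih

theorem ext_extPow {M : Type*} [AddCommGroup M] [Module K M] {f g : Λ →ₗ[K] M}
    (h : ∀ q : ℕ, ∀ w ∈ ⋀[K]^q V, f w = g w) : f = g := by
  refine LinearMap.ext fun w => ?_
  refine DirectSum.Decomposition.inductionOn (fun q : ℕ => ⋀[K]^q V) (by simp)
    (fun {q} m => h q m m.2) (fun m m' h h' => by simp [h, h']) w

theorem ext_wedge {M : Type*} [AddCommGroup M] [Module K M] {f g : Λ →ₗ[K] M}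
    (h1 : f 1 = g 1) (h : ∀ v w, f w = g w → f (wedge v w) = g (wedge v w)) : f = g :=
  ext_extPow fun q w hw => extPow_induction (C := fun _ w => f w = g w) h1
    (fun _ v w _ ih => h v w ih) (fun _ x y hx hy => by simp [hx, hy])
    (fun _ r x hx => by simp [hx]) q w hw

/-- Natural subtraction gives `0 - 1 = 0`, so the vanishing in degree zero is carried along
separately. The induction needs it to discard `wedge v (contr ξ w)` when `w` is a scalar. -/
theorem contr_mem (ξ : Module.Dual K V) : ∀ (q : ℕ), ∀ w ∈ ⋀[K]^q V,
    (q = 0 → contr ξ w = 0) ∧ contr ξ w ∈ ⋀[K]^(q - 1) V := by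
  refine extPow_induction (by simp) ?_ ?_ ?_
  · intro q v w hw ih
    refine ⟨by simp, ?_⟩
    rw [contr_wedge]
    refine sub_mem (Submodule.smul_mem _ _ hw) ?_
    rcases q with _ | q
    · rw [ih.1 rfl, map_zero]; exact zero_mem _
    · exact wedge_mem v ih.2
  · intro q x y hx hy
    refine ⟨fun h => by simp [hx.1 h, hy.1 h], ?_⟩
    rw [map_add]; exact add_mem hx.2 hy.2
  · intro q r x hx
    refine ⟨fun h => by simp [hx.1 h], ?_⟩
    rw [map_smul]; exact Submodule.smul_mem _ _ hx.2

theorem contr_zero_mem (ξ : Module.Dual K V) {w : Λ} (hw : w ∈ ⋀[K]^0 V) : contr ξ w = 0 :=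
  (contr_mem ξ 0 w hw).1 rfl

theorem contr_succ_mem (ξ : Module.Dual K V) {q : ℕ} {w : Λ} (hw : w ∈ ⋀[K]^(q + 1) V) :
    contr ξ w ∈ ⋀[K]^q V := (contr_mem ξ (q + 1) w hw).2

/-- The augmentation of the exterior algebra. -/
def extAug : Λ →ₐ[K] K := ExteriorAlgebra.algebraMapInv

@[simp] theorem extAug_wedge (v : V) (w : Λ) : extAug (wedge v w) = 0 := by
  simp [extAug, wedge_apply, ExteriorAlgebra.algebraMapInv]

theorem extAug_of_mem {q : ℕ} {w : Λ} (hw : w ∈ ⋀[K]^(q + 1) V) : extAug w = 0 := by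
  have := extPow_induction (C := fun q (w : Λ) => 0 < q → extAug w = 0) (by simp)
    (fun q v w _ _ _ => extAug_wedge v w) (fun q x y hx hy h => by simp [hx h, hy h])
    (fun q r x hx h => by simp [hx h]) (q + 1) w hw
  exact this (by omega)

theorem eq_extAug_of_mem {w : Λ} (hw : w ∈ ⋀[K]^0 V) : w = extAug w • (1 : Λ) := by
  rw [ExteriorAlgebra.exteriorPower, pow_zero, Submodule.mem_one] at hw
  obtain ⟨r, rfl⟩ := hw
  simp [Algebra.algebraMap_eq_smul_one]

/-- The operator which is multiplication by `φ q` on `Λ^q(V)`. -/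
def extScale (φ : ℕ → K) : Module.End K Λ :=
  DirectSum.toModule K ℕ Λ (fun q => φ q • (⋀[K]^q V).subtype) ∘ₗ
    (DirectSum.decomposeLinearEquiv (fun q : ℕ => ⋀[K]^q V)).toLinearMap

theorem extScale_apply (φ : ℕ → K) {q : ℕ} {w : Λ} (hw : w ∈ ⋀[K]^q V) :
    extScale φ w = φ q • w := by
  simp only [extScale, LinearMap.comp_apply, LinearEquiv.coe_coe,
    DirectSum.decomposeLinearEquiv_apply]
  rw [DirectSum.decompose_of_mem (fun q : ℕ => ⋀[K]^q V) hw]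
  erw [DirectSum.toModule_lof]
  rfl

variable {σ : Type*} [Fintype σ] (e : Module.Basis σ K V)

theorem sum_coord_smul_wedge (v : V) (w : Λ) : ∑ i, e.coord i v • wedge (e i) w = wedge v w := by
  conv_rhs => rw [← e.sum_repr v]
  simp only [map_sum, LinearMap.sum_apply, map_smul, LinearMap.smul_apply, Module.Basis.coord_apply]

/-- This is the number operator. Moving it past a factor `wedge v` produces one extra term, `∑
e_i(v) e_i ∧ w = v ∧ w`, so each factor raises the eigenvalue by one. It enters both the Koszul
homotopy and the vacuum projection. -/
theorem sum_wedge_contr : ∀ (q : ℕ), ∀ w ∈ ⋀[K]^q V,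
    ∑ i, wedge (e i) (contr (e.coord i) w) = (q : K) • w := by
  refine extPow_induction (by simp) ?_ ?_ ?_
  · intro q v w _ ih
    have h : ∀ i, wedge (e i) (contr (e.coord i) (wedge v w)) =
        e.coord i v • wedge (e i) w + wedge v (wedge (e i) (contr (e.coord i) w)) := by
      intro i
      have := ExteriorAlgebra.ι_add_mul_swap (R := K) (e i) v
      rw [contr_wedge, map_sub, map_smul, sub_eq_add_neg]
      congr 1
      simp only [wedge_apply, ← mul_assoc]
      rw [eq_neg_of_add_eq_zero_right this]
      simp
    simp only [h]
    rw [Finset.sum_add_distrib, sum_coord_smul_wedge, ← map_sum, ih, map_smul]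
    push_cast
    rw [add_smul, one_smul, add_comm]
  · intro q x y hx hy
    simp [Finset.sum_add_distrib, hx, hy]
  · intro q r x hx
    simp [← Finset.smul_sum, hx, smul_comm r]

end Exterior

/-! ### The Koszul complex and its contracting homotopy. -/

section Koszul

variable {K : Type*} [Field K] {V : Type*} [AddCommGroup V] [Module K V]
variable {σ : Type*} [Fintype σ] (e : Module.Basis σ K V)
variable {P : Type*} [CommRing P] [Algebra K P]

variable (K V σ P) in
/-- The underlying space of the Koszul complex, with coefficients in `P`. -/
abbrev Kos : Type _ := MvPolynomial σ P ⊗[K] ExteriorAlgebra K V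

open MvPolynomial

/-- The Koszul differential of a family of polynomials. -/
def kosD (g : σ → MvPolynomial σ P) : Kos K V σ P →ₗ[P] Kos K V σ P :=
  ∑ i, TensorProduct.AlgebraTensorModule.map (LinearMap.mulLeft P (g i)) (contr (e.coord i))

/-- The de Rham differential. -/
def kosR : Kos K V σ P →ₗ[P] Kos K V σ P :=
  ∑ i, TensorProduct.AlgebraTensorModule.map (pderiv i).toLinearMap (wedge (e i))

@[simp] theorem kosD_tmul (g : σ → MvPolynomial σ P) (f : MvPolynomial σ P) (w : Λ) :
    kosD e g (f ⊗ₜ w) = ∑ i, (g i * f) ⊗ₜ[K] contr (e.coord i) w := by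
  simp [kosD]

@[simp] theorem kosR_tmul (f : MvPolynomial σ P) (w : Λ) :
    kosR e (f ⊗ₜ[K] w) = ∑ i, pderiv i f ⊗ₜ[K] wedge (e i) w := by
  simp [kosR]

/-- Division by the total weight. -/
def kosJ : Kos K V σ P →ₗ[P] Kos K V σ P :=
  TensorProduct.AlgebraTensorModule.lift
    ((basisMonomials σ P).constr K fun m =>
      (TensorProduct.mk K (MvPolynomial σ P) Λ (monomial m 1)) ∘ₗ
        extScale (fun q => ((m.degree + q : ℕ) : K)⁻¹))

theorem kosJ_tmul (m : σ →₀ ℕ) (p : P) {q : ℕ} {w : Λ} (hw : w ∈ ⋀[K]^q V) :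
    kosJ (monomial m p ⊗ₜ[K] w) = ((m.degree + q : ℕ) : K)⁻¹ • (monomial m p ⊗ₜ[K] w) := by
  have : monomial m p = p • basisMonomials σ P m := by simp [smul_monomial]
  rw [kosJ, TensorProduct.AlgebraTensorModule.lift_tmul, this, map_smul, Module.Basis.constr_basis]
  simp only [LinearMap.smul_apply, LinearMap.comp_apply, extScale_apply _ hw, map_smul,
    TensorProduct.mk_apply, coe_basisMonomials]
  rw [smul_comm, TensorProduct.smul_tmul']

theorem ext_kos {M : Type*} [AddCommGroup M] [Module K M] {f g : Kos K V σ P →ₗ[K] M}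
    (h : ∀ (m : σ →₀ ℕ) (p : P) (q : ℕ), ∀ w ∈ ⋀[K]^q V,
      f (monomial m p ⊗ₜ[K] w) = g (monomial m p ⊗ₜ[K] w)) : f = g := by
  refine TensorProduct.ext' fun x w => ?_
  induction x using MvPolynomial.induction_on' with
  | monomial m p =>
    exact LinearMap.congr_fun (ext_extPow (f := f ∘ₗ TensorProduct.mk K _ _ (monomial m p))
      (g := g ∘ₗ TensorProduct.mk K _ _ (monomial m p)) (h m p)) w
  | add x y hx hy => simp only [TensorProduct.add_tmul, map_add, hx, hy]

theorem X_mul_monomial (i : σ) (m : σ →₀ ℕ) (p : P) :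
    X i * monomial m p = monomial (m + Finsupp.single i 1) p := by
  rw [mul_comm, monomial_add_single, pow_one]

/-- The Koszul differential at the origin trades one exterior degree for one polynomial degree, so
it preserves the total weight. -/
theorem kosD_X_kosJ (z : Kos K V σ P) : kosD e X (kosJ z) = kosJ (kosD e X z) := by
  refine LinearMap.congr_fun (ext_kos (f := (kosD e X).restrictScalars K ∘ₗ
    kosJ.restrictScalars K) (g := kosJ.restrictScalars K ∘ₗ (kosD e X).restrictScalars K) ?_) z
  intro m p q w hw
  simp only [LinearMap.comp_apply, LinearMap.restrictScalars_apply, kosJ_tmul m p hw]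
  rw [LinearMap.map_smul_of_tower, kosD_tmul, map_sum, Finset.smul_sum]
  refine Finset.sum_congr rfl fun i _ => ?_
  rcases q with _ | q
  · simp [contr_zero_mem _ hw]
  · rw [X_mul_monomial, kosJ_tmul _ _ (contr_succ_mem _ hw)]
    congr 3
    simp; ring

theorem sum_X_pderiv_tmul (m : σ →₀ ℕ) (p : P) (w : Λ) :
    (∑ j, ∑ i, (X i * pderiv j (monomial m p)) ⊗ₜ[K] (e.coord i (e j) • w)) =
      (m.degree : K) • (monomial m p ⊗ₜ[K] w) := by
  classical
  have : ∀ j, (∑ i, (X i * pderiv j (monomial m p)) ⊗ₜ[K] (e.coord i (e j) • w)) =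
      (m j : K) • (monomial m p ⊗ₜ[K] w) := by
    intro j
    rw [Finset.sum_eq_single j]
    · rw [X_mul_pderiv_monomial, e.coord_apply, e.repr_self, Finsupp.single_eq_same, one_smul,
        ← TensorProduct.smul_tmul', Nat.cast_smul_eq_nsmul]
    · intro i _ hij
      rw [e.coord_apply, e.repr_self, Finsupp.single_eq_of_ne hij, zero_smul,
        TensorProduct.tmul_zero]
    · intro h; exact absurd (Finset.mem_univ j) h
  simp only [this]
  rw [← Finset.sum_smul, ← Nat.cast_sum, Finsupp.degree_eq_sum]

theorem sum_pderiv_X_tmul (f : MvPolynomial σ P) {q : ℕ} {w : Λ} (hw : w ∈ ⋀[K]^q V) :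
    (∑ j, ∑ i, (pderiv j (X i) * f) ⊗ₜ[K] (wedge (e j) (contr (e.coord i) w))) =
      (q : K) • (f ⊗ₜ[K] w) := by
  classical
  have : ∀ j, (∑ i, (pderiv j (X i) * f) ⊗ₜ[K] (wedge (e j) (contr (e.coord i) w))) =
      f ⊗ₜ[K] wedge (e j) (contr (e.coord j) w) := by
    intro j
    rw [Finset.sum_eq_single j]
    · rw [pderiv_X_self, one_mul]
    · intro i _ hij
      rw [pderiv_X_of_ne hij, zero_mul, TensorProduct.zero_tmul]
    · intro h; exact absurd (Finset.mem_univ j) h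
  simp only [this]
  rw [← TensorProduct.tmul_sum, sum_wedge_contr e q w hw, TensorProduct.tmul_smul]

theorem kosD_kosR_tmul (g : σ → MvPolynomial σ P) (f : MvPolynomial σ P) (w : Λ) :
    kosD e g (kosR e (f ⊗ₜ w)) = (∑ j, ∑ i, (g i * pderiv j f) ⊗ₜ[K] (e.coord i (e j) • w)) -
      ∑ j, ∑ i, (g i * pderiv j f) ⊗ₜ[K] (wedge (e j) (contr (e.coord i) w)) := by
  simp only [kosR_tmul, map_sum, kosD_tmul, contr_wedge, TensorProduct.tmul_sub,
    Finset.sum_sub_distrib]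

theorem kosR_kosD_tmul (g : σ → MvPolynomial σ P) (f : MvPolynomial σ P) (w : Λ) :
    kosR e (kosD e g (f ⊗ₜ w)) =
      (∑ j, ∑ i, (g i * pderiv j f) ⊗ₜ[K] (wedge (e j) (contr (e.coord i) w))) +
      ∑ j, ∑ i, (pderiv j (g i) * f) ⊗ₜ[K] (wedge (e j) (contr (e.coord i) w)) := by
  simp only [kosR_tmul, map_sum, kosD_tmul, Derivation.leibniz, smul_eq_mul,
    TensorProduct.add_tmul, Finset.sum_add_distrib]
  rw [Finset.sum_comm]
  refine congrArg₂ (· + ·) rfl ?_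
  rw [Finset.sum_comm]
  simp only [mul_comm]

/-- Cartan's formula for the Euler vector field: the Koszul differential is contraction with that
field, and its anticommutator with the de Rham differential is the Lie derivative, which multiplies
by the total weight. -/
theorem kosD_X_kosR (m : σ →₀ ℕ) (p : P) {q : ℕ} {w : Λ} (hw : w ∈ ⋀[K]^q V) :
    kosD e X (kosR e (monomial m p ⊗ₜ w)) + kosR e (kosD e X (monomial m p ⊗ₜ w)) =
      ((m.degree + q : ℕ) : K) • (monomial m p ⊗ₜ[K] w) := by
  rw [kosD_kosR_tmul, kosR_kosD_tmul, sum_X_pderiv_tmul, sum_pderiv_X_tmul e _ hw]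
  push_cast
  rw [add_smul]
  abel

variable (K V σ P) in
/-- The span of `f ⊗ w` with `w` of degree `q`. -/
def kosDeg (q : ℕ) : Submodule P (Kos K V σ P) :=
  LinearMap.range (TensorProduct.AlgebraTensorModule.map
    (LinearMap.id : MvPolynomial σ P →ₗ[P] _) (⋀[K]^q V).subtype)

theorem tmul_mem_kosDeg (f : MvPolynomial σ P) {q : ℕ} {w : Λ} (hw : w ∈ ⋀[K]^q V) :
    f ⊗ₜ[K] w ∈ kosDeg K V σ P q := ⟨f ⊗ₜ ⟨w, hw⟩, by simp⟩

theorem kosDeg_le {q : ℕ} {N : Submodule P (Kos K V σ P)}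
    (h : ∀ f : MvPolynomial σ P, ∀ w ∈ ⋀[K]^q V, f ⊗ₜ[K] w ∈ N) : kosDeg K V σ P q ≤ N := by
  rintro _ ⟨z, rfl⟩
  induction z using TensorProduct.induction_on with
  | zero => simp
  | add x y hx hy => rw [map_add]; exact add_mem hx hy
  | tmul f w => exact h f w w.2

theorem kosJ_mem {q : ℕ} {z : Kos K V σ P} (hz : z ∈ kosDeg K V σ P q) :
    kosJ z ∈ kosDeg K V σ P q := by
  refine kosDeg_le (N := (kosDeg K V σ P q).comap kosJ) (fun f w hw => ?_) hz
  rw [Submodule.mem_comap]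
  induction f using MvPolynomial.induction_on' with
  | monomial m p =>
    rw [kosJ_tmul m p hw]
    exact Submodule.smul_of_tower_mem _ _ (tmul_mem_kosDeg _ hw)
  | add x y hx hy => rw [TensorProduct.add_tmul, map_add]; exact add_mem hx hy

theorem kosR_mem {q : ℕ} {z : Kos K V σ P} (hz : z ∈ kosDeg K V σ P q) :
    kosR e z ∈ kosDeg K V σ P (q + 1) := by
  refine kosDeg_le (N := (kosDeg K V σ P (q + 1)).comap (kosR e)) (fun f w hw => ?_) hz
  rw [Submodule.mem_comap, kosR_tmul]
  exact sum_mem fun i _ => tmul_mem_kosDeg _ (wedge_mem _ hw)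

/-- The augmentation `f ⊗ w ↦ f(π) ε(w)` of the Koszul complex at a point `π`. -/
def kosAug (π : σ → P) : Kos K V σ P →ₗ[P] P :=
  (TensorProduct.AlgebraTensorModule.rid K P P).toLinearMap ∘ₗ
    TensorProduct.AlgebraTensorModule.map (aeval π : MvPolynomial σ P →ₐ[P] P).toLinearMap
      (extAug (K := K) (V := V)).toLinearMap

@[simp] theorem kosAug_tmul (π : σ → P) (f : MvPolynomial σ P) (w : Λ) :
    kosAug π (f ⊗ₜ[K] w) = extAug w • aeval π f := by
  simp [kosAug]

variable (K V σ P) in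
/-- The inclusion of the coefficients into the Koszul complex. -/
def kosUnit : P →ₗ[P] Kos K V σ P :=
  (TensorProduct.AlgebraTensorModule.mk K P (MvPolynomial σ P) Λ).flip 1 ∘ₗ Algebra.linearMap P _

theorem kosUnit_apply (p : P) : kosUnit K V σ P p = C p ⊗ₜ[K] (1 : Λ) := rfl

/-- The contracting homotopy of the Koszul complex at the origin. -/
def kosC₀ : Kos K V σ P →ₗ[P] Kos K V σ P := kosJ ∘ₗ kosR e

theorem kosC₀_mem {q : ℕ} {z : Kos K V σ P} (hz : z ∈ kosDeg K V σ P q) :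
    kosC₀ e z ∈ kosDeg K V σ P (q + 1) := kosJ_mem (kosR_mem e hz)

theorem kosD_kosC₀ [CharZero K] (z : Kos K V σ P) :
    kosD e X (kosC₀ e z) + kosC₀ e (kosD e X z) = z - kosUnit K V σ P (kosAug (fun _ => 0) z) := by
  refine LinearMap.congr_fun (ext_kos
    (f := (kosD e X ∘ₗ kosC₀ e + kosC₀ e ∘ₗ kosD e X).restrictScalars K)
    (g := (LinearMap.id - kosUnit K V σ P ∘ₗ kosAug (fun _ => 0)).restrictScalars K) ?_) z
  intro m p q w hw
  simp only [LinearMap.restrictScalars_apply, LinearMap.add_apply, LinearMap.comp_apply,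
    LinearMap.sub_apply, LinearMap.id_apply, kosC₀, kosD_X_kosJ]
  rw [← map_add, kosD_X_kosR e m p hw, LinearMap.map_smul_of_tower, kosJ_tmul m p hw, smul_smul,
    kosAug_tmul]
  -- In weight zero the convention `0⁻¹ = 0` makes the left side vanish, as it should, since the
  -- term is a constant and equals its own augmentation. In positive weight the factor is invertible
  -- by characteristic zero and the augmentation vanishes.
  by_cases h : m.degree + q = 0
  · obtain ⟨hm, rfl⟩ : m = 0 ∧ q = 0 := by
      rw [Nat.add_eq_zero_iff, Finsupp.degree_eq_zero_iff] at h; exact h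
    subst hm
    rw [eq_extAug_of_mem hw]
    simp [kosUnit_apply, TensorProduct.tmul_smul, TensorProduct.smul_tmul']
  · rw [mul_inv_cancel₀ (by exact_mod_cast h), one_smul]
    have : extAug w • aeval (fun _ => (0 : P)) (monomial m p) = 0 := by
      rcases q with _ | q
      · have hm : m ≠ 0 := by rintro rfl; simp at h
        have : aeval (fun _ => (0 : P)) (monomial m p) = 0 := by
          classical
          rw [aeval_zero', constantCoeff_monomial, if_neg hm, map_zero]
        rw [this, smul_zero]
      · rw [extAug_of_mem hw, zero_smul]
    rw [this, map_zero, sub_zero]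

/-- The translation `X i ↦ X i - π i`. -/
def translate (π : σ → P) : MvPolynomial σ P ≃ₐ[P] MvPolynomial σ P :=
  AlgEquiv.ofAlgHom (aeval fun i => X i - C (π i)) (aeval fun i => X i + C (π i))
    (by ext i; simp) (by ext i; simp)

@[simp] theorem translate_X (π : σ → P) (i : σ) : translate π (X i) = X i - C (π i) := by
  simp [translate]

theorem translate_C (π : σ → P) (p : P) : translate π (C p) = C p :=
  (translate π).commutes p

theorem aeval_translate_symm (π : σ → P) (f : MvPolynomial σ P) :
    aeval (fun _ => (0 : P)) ((translate π).symm f) = aeval π f := by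
  have : (aeval (fun _ => (0 : P))).comp (translate π).symm.toAlgHom =
      (aeval π : MvPolynomial σ P →ₐ[P] P) := by
    ext i; simp [translate]
  exact DFunLike.congr_fun this f

variable (K V) in
/-- The translation on the Koszul complex. -/
def kosT (π : σ → P) : Kos K V σ P ≃ₗ[P] Kos K V σ P :=
  TensorProduct.AlgebraTensorModule.congr (translate π).toLinearEquiv (LinearEquiv.refl K Λ)

@[simp] theorem kosT_tmul (π : σ → P) (f : MvPolynomial σ P) (w : Λ) :
    kosT K V π (f ⊗ₜ w) = translate π f ⊗ₜ w := rfl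

@[simp] theorem kosT_symm_tmul (π : σ → P) (f : MvPolynomial σ P) (w : Λ) :
    (kosT K V π).symm (f ⊗ₜ w) = (translate π).symm f ⊗ₜ w := rfl

theorem kosD_kosT (π : σ → P) (z : Kos K V σ P) :
    kosD e (fun i => X i - C (π i)) (kosT K V π z) = kosT K V π (kosD e X z) := by
  induction z using TensorProduct.induction_on with
  | zero => simp
  | add x y hx hy => simp only [map_add, hx, hy]
  | tmul f w => simp [map_sum]

/-- The contracting homotopy of the Koszul complex at the point `π`. -/
def kosC (π : σ → P) : Kos K V σ P →ₗ[P] Kos K V σ P :=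
  (kosT K V π).toLinearMap ∘ₗ kosC₀ e ∘ₗ (kosT K V π).symm.toLinearMap

theorem kosT_mem (π : σ → P) {q : ℕ} {z : Kos K V σ P} (hz : z ∈ kosDeg K V σ P q) :
    kosT K V π z ∈ kosDeg K V σ P q :=
  kosDeg_le (N := (kosDeg K V σ P q).comap (kosT K V π).toLinearMap)
    (fun _ _ hw => tmul_mem_kosDeg _ hw) hz

theorem kosT_symm_mem (π : σ → P) {q : ℕ} {z : Kos K V σ P} (hz : z ∈ kosDeg K V σ P q) :
    (kosT K V π).symm z ∈ kosDeg K V σ P q :=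
  kosDeg_le (N := (kosDeg K V σ P q).comap (kosT K V π).symm.toLinearMap)
    (fun _ _ hw => tmul_mem_kosDeg _ hw) hz

theorem kosC_mem (π : σ → P) {q : ℕ} {z : Kos K V σ P} (hz : z ∈ kosDeg K V σ P q) :
    kosC e π z ∈ kosDeg K V σ P (q + 1) :=
  kosT_mem π (kosC₀_mem e (kosT_symm_mem π hz))

/-- Translation moves the origin to `π` and carries the family `X i` to `X i - π i`, so the identity
is the conjugate of the one at the origin. -/
theorem kosD_kosC [CharZero K] (π : σ → P) (z : Kos K V σ P) :
    kosD e (fun i => X i - C (π i)) (kosC e π z) + kosC e π (kosD e (fun i => X i - C (π i)) z) =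
      z - kosUnit K V σ P (kosAug π z) := by
  obtain ⟨z, rfl⟩ := (kosT K V π).surjective z
  have h : kosAug π (kosT K V π z) = kosAug (fun _ => 0) z := by
    induction z using TensorProduct.induction_on with
    | zero => simp
    | add x y hx hy => simp only [map_add, hx, hy]
    | tmul f w => rw [kosT_tmul, kosAug_tmul, kosAug_tmul, ← aeval_translate_symm]; simp
  simp only [kosC, LinearMap.comp_apply, LinearEquiv.coe_coe, LinearEquiv.symm_apply_apply,
    kosD_kosT]
  rw [← map_add, kosD_kosC₀, map_sub, h, kosUnit_apply, kosT_tmul, translate_C]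

theorem kosAug_of_mem (π : σ → P) {q : ℕ} {z : Kos K V σ P} (hz : z ∈ kosDeg K V σ P (q + 1)) :
    kosAug π z = 0 :=
  kosDeg_le (N := LinearMap.ker (kosAug π)) (fun f w hw => by
    rw [LinearMap.mem_ker, kosAug_tmul, extAug_of_mem hw, zero_smul]) hz

/-- The homotopy raises the exterior degree by one, while the augmentation only sees exterior degree
zero. -/
theorem kosAug_kosC (π : σ → P) (z : Kos K V σ P) : kosAug π (kosC e π z) = 0 := by
  induction z using TensorProduct.induction_on with
  | zero => simp
  | add x y hx hy => simp only [map_add, hx, hy, add_zero]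
  | tmul f w =>
    exact LinearMap.congr_fun (ext_extPow
      (f := (kosAug π ∘ₗ kosC e π).restrictScalars K ∘ₗ TensorProduct.mk K _ _ f) (g := 0)
      fun q w hw => kosAug_of_mem π (kosC_mem e π (tmul_mem_kosDeg f hw))) w

/-- The derivatives of a constant vanish. This normalization is what makes `toExt` an exact left
inverse of `alt`, and it is used again in `eq_smul_one_of_contr`. -/
theorem kosC₀_one_tmul (w : Λ) : kosC₀ e ((1 : MvPolynomial σ P) ⊗ₜ[K] w) = 0 := by
  simp [kosC₀]

end Koszul

/-! ### The bar complex, with and without coefficients. -/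

section Bar

variable {K : Type*} [Field K] {A : Type*} [NonUnitalRing A] [Module K A] [IsScalarTower K A A]
  [SMulCommClass K A A]

variable (K A) in
/-- The bar differential. -/
abbrev bar : Module.End K T := ins 1 (mulMap K A)

/-- Multiplication of the first letter by `a` on the left (zero on the empty word). -/
def mulFirst : A →ₗ[K] Module.End K T :=
  (LinearMap.mul K T ∘ₗ ιT).compr₂ (conv (mulMap K A) LinearMap.id)

theorem mulFirst_apply (a : A) (x : T) :
    mulFirst a x = conv (mulMap K A) LinearMap.id (ιT a * x) := rfl

@[simp] theorem mulFirst_one (a : A) : mulFirst a (1 : T) = 0 := by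
  rw [mulFirst_apply, mul_one, conv_mulMap_one]

@[simp] theorem mulFirst_cons (a c : A) (x : T) : mulFirst a (ιT c * x) = ιT (a * c) * x :=
  conv_mulMap_cons a c x

/-- A product of neighbouring letters either involves the first letter or lies to its right, where
passing the odd letter `a` costs a sign. This recursion replaces the summation formula in what
follows. -/
theorem bar_cons (a : A) (x : T) : bar K A (ιT a * x) = mulFirst a x - ιT a * bar K A x := by
  rw [ins_mulMap_cons, mulFirst_apply]; abel

/-- The projection of `T(A)` onto its component `A` of words with one letter. -/
def letter : T →ₗ[K] A :=
  Unitization.sndHom K K A ∘ₗ (TensorAlgebra.lift K (Unitization.inrHom K K A)).toLinearMap ∘ₗ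
    tproj 1

@[simp] theorem letter_one : letter (1 : T) = 0 := by simp [letter, tproj_one_one]

@[simp] theorem letter_ι (a : A) : letter (ιT a) = a := by
  simp [letter, tproj_same (n := 1) (ι_mem_tpow a)]

@[simp] theorem letter_cons_cons (a c : A) (x : T) : letter (ιT a * (ιT c * x)) = 0 := by
  have h1 := LinearMap.congr_fun (tproj_succ_lm (K := K) 0 a) (ιT c * x)
  simp only [LinearMap.comp_apply, lm_apply, zero_add, tproj_zero_cons, mul_zero] at h1
  simp [letter, h1]

section Coefficients

variable {P : Type*} [CommRing P] [Algebra K P] (π : A →ₙₐ[K] P)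

/-- Left concatenation with a letter on `P ⊗ T(A)`. -/
def cons (P : Type*) [CommRing P] [Algebra K P] (a : A) : (P ⊗[K] T) →ₗ[P] P ⊗[K] T :=
  (lm (ιT a)).baseChange P

@[simp] theorem cons_tmul (a : A) (p : P) (x : T) :
    cons P a (p ⊗ₜ x) = p ⊗ₜ[K] (ιT a * x) := rfl

theorem cons_add (a b : A) (y : P ⊗[K] T) : cons P (a + b) y = cons P a y + cons P b y := by
  induction y using TensorProduct.induction_on with
  | zero => simp
  | add x y hx hy => simp only [map_add, hx, hy]; abel
  | tmul p x => simp [add_mul, TensorProduct.tmul_add]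

theorem cons_smul (k : K) (a : A) (y : P ⊗[K] T) : cons P (k • a) y = k • cons P a y := by
  induction y using TensorProduct.induction_on with
  | zero => simp
  | add x y hx hy => simp only [map_add, smul_add, hx, hy]
  | tmul p x => simp

theorem cons_induction {C : P ⊗[K] T → Prop} (one : ∀ p : P, C (p ⊗ₜ 1))
    (cons : ∀ a y, C y → C (cons P a y)) (add : ∀ x y, C x → C y → C (x + y)) (y : P ⊗[K] T) :
    C y := by
  induction y using TensorProduct.induction_on with
  | zero => simpa using one 0
  | add x y hx hy => exact add x y hx hy
  | tmul p x =>
    induction x using induction_left generalizing p with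
    | one => exact one p
    | cons a x ih => exact cons a _ (ih p)
    | add x y hx hy => rw [TensorProduct.tmul_add]; exact add _ _ (hx p) (hy p)
    | smul r x hx => rw [← TensorProduct.smul_tmul]; exact hx _

/-- Multiplication of the first letter of words in `P ⊗ T(A)`; on the empty word, the coefficient
is multiplied. -/
def mulFirstP (a : A) : (P ⊗[K] T) →ₗ[P] P ⊗[K] T :=
  (mulFirst a).baseChange P + π a • (tproj 0).baseChange P

@[simp] theorem mulFirstP_one (a : A) (p : P) :
    mulFirstP π a (p ⊗ₜ (1 : T)) = (π a * p) ⊗ₜ 1 := by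
  simp [mulFirstP, tproj_one, TensorProduct.smul_tmul']

theorem mulFirstP_cons (a c : A) (y : P ⊗[K] T) :
    mulFirstP π a (cons P c y) = cons P (a * c) y := by
  induction y using TensorProduct.induction_on with
  | zero => simp
  | add x y hx hy => simp only [map_add, hx, hy]
  | tmul p x => simp [mulFirstP, tproj_zero_cons]

/-- The part of the bar differential which multiplies the last letter into the coefficients. -/
def lastToCoeff : T →ₗ[K] P ⊗[K] T :=
  (TensorProduct.comm K T P).toLinearMap ∘ₗ TensorProduct.map (twist 1).toLinearMap
    ((π : A →ₗ[K] P) ∘ₗ letter) ∘ₗ deconc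

theorem lastToCoeff_one : lastToCoeff π (1 : T) = 0 := by
  simp [lastToCoeff, deconc_one]

theorem lastToCoeff_cons (a : A) (x : T) : lastToCoeff π (ιT a * x) =
    π a • ((1 : P) ⊗ₜ tproj 0 x) - cons P a (lastToCoeff π x) := by
  simp only [lastToCoeff, LinearMap.comp_apply, deconc_cons, map_add]
  rw [sub_eq_add_neg]
  congr 1
  · induction x using induction_left with
    | one => simp [tproj_one, TensorProduct.smul_tmul']
    | cons c x _ => simp [tproj_zero_cons]
    | add x y hx hy => simp only [mul_add, TensorProduct.tmul_add, map_add, smul_add, hx, hy]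
    | smul k x hx =>
      simp only [mul_smul_comm, TensorProduct.tmul_smul, map_smul, hx, smul_comm (π a)]
  · generalize deconc x = d
    induction d with
    | zero => simp
    | add x y hx hy => simp only [mul_add, map_add, hx, hy, neg_add]
    | tmul x y => simp [TensorProduct.tmul_neg]

/-- The bar differential on `P ⊗ T(A)`, with the multiplication of the last letter into the
coefficients. -/
def barP : (P ⊗[K] T) →ₗ[P] P ⊗[K] T :=
  (bar K A).baseChange P + (lastToCoeff π).liftBaseChange P

theorem barP_tmul (p : P) (x : T) :
    barP π (p ⊗ₜ x) = p ⊗ₜ bar K A x + p • lastToCoeff π x := by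
  simp [barP]

@[simp] theorem barP_one (p : P) : barP π (p ⊗ₜ (1 : T)) = 0 := by
  simp [barP_tmul, ins_mulMap_one, lastToCoeff_one]

/-- On a one-letter word the first letter is also the last and is multiplied into the coefficient.
The summand `π a • tproj 0` of `mulFirstP` accounts for this, so the recursion keeps the shape it
has without coefficients. -/
theorem barP_cons (a : A) (y : P ⊗[K] T) :
    barP π (cons P a y) = mulFirstP π a y - cons P a (barP π y) := by
  induction y using TensorProduct.induction_on with
  | zero => simp
  | add x y hx hy => simp only [map_add, hx, hy]; abel
  | tmul p x =>
    rw [cons_tmul, barP_tmul, barP_tmul, bar_cons, lastToCoeff_cons]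
    simp only [mulFirstP, LinearMap.add_apply, LinearMap.smul_apply, LinearMap.baseChange_tmul,
      TensorProduct.tmul_sub, map_add, map_smul, cons_tmul, smul_sub, mul_comm p,
      TensorProduct.smul_tmul', smul_eq_mul, mul_one]
    abel

/-- A linear map on words defined by recursion on the first letter. -/
def wordFold {X : Type*} [AddCommGroup X] [Module K X] [Module P X] [IsScalarTower K P X]
    (op : A →ₗ[K] Module.End P X) (x₀ : X) : (P ⊗[K] T) →ₗ[P] X :=
  ((LinearMap.applyₗ x₀).restrictScalars K ∘ₗ
    (TensorAlgebra.lift K op).toLinearMap).liftBaseChange P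

section WordFold

variable {X : Type*} [AddCommGroup X] [Module K X] [Module P X] [IsScalarTower K P X]
  (op : A →ₗ[K] Module.End P X) (x₀ : X)

@[simp] theorem wordFold_one (p : P) : wordFold op x₀ (p ⊗ₜ (1 : T)) = p • x₀ := by
  simp [wordFold]

theorem wordFold_cons (a : A) (y : P ⊗[K] T) :
    wordFold op x₀ (cons P a y) = op a (wordFold op x₀ y) := by
  induction y using TensorProduct.induction_on with
  | zero => simp
  | add x y hx hy => simp only [map_add, hx, hy]
  | tmul p x => simp [wordFold]

end WordFold

end Coefficients

end Bar

/-! ### Comparison of the bar complex with a contracted complex. -/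

section Homotopy

variable {K : Type*} [Field K] {A : Type*} [NonUnitalRing A] [Module K A] [IsScalarTower K A A]
  [SMulCommClass K A A]
variable {P : Type*} [CommRing P] [Algebra K P] {π : A →ₙₐ[K] P}
variable {L : Type*} [AddCommGroup L] [Module K L] [Module P L] [IsScalarTower K P L]

variable (π) in
/-- A complex `(L, d)` with coefficients in `P` on which `A` acts, with a contracting homotopy
`c`, augmentation `ε` and unit `η`, together with maps `r`, `q` to `P ⊗ T(A)` which compare it with
the bar complex. -/
structure Comparison (L : Type*) [AddCommGroup L] [Module K L] [Module P L]
    [IsScalarTower K P L] where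
  act : A →ₗ[K] Module.End P L
  d : Module.End P L
  c : Module.End P L
  unit : P →ₗ[P] L
  aug : L →ₗ[P] P
  r : L →ₗ[P] P ⊗[K] T
  q : L →ₗ[P] P ⊗[K] T
  act_mul : ∀ a b z, act (a * b) z = act a (act b z)
  d_act : ∀ a z, d (act a z) = act a (d z)
  d_unit : ∀ p, d (unit p) = 0
  d_c : ∀ z, d (c z) + c (d z) = z - unit (aug z)
  aug_c : ∀ z, aug (c z) = 0
  aug_act_unit : ∀ a p, aug (act a (unit p)) = π a * p
  aug_act : ∀ a z, aug z = 0 → aug (act a z) = 0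
  r_unit : ∀ p, r (unit p) = 0
  q_unit : ∀ p, q (unit p) = p ⊗ₜ 1
  r_act : ∀ a z, r (act a z) = mulFirstP π a (r z) + cons P a (q z)
  r_d : ∀ z, r (d z) = barP π (r z) + q z - aug z ⊗ₜ 1

namespace Comparison

variable (C : Comparison π L)

/-- One step in the recursion defining `γ` and `t`. -/
def step : A →ₗ[K] Module.End P (L × (P ⊗[K] T)) :=
  LinearMap.mk₂' K P
    (fun a z => (C.c (C.act a z.1), -C.r (C.c (C.act a z.1)) - cons P a z.2))
    (by intro a b z; ext1 <;> simp [cons_add]; abel)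
    (by intro k a z; ext1 <;> simp [cons_smul, smul_sub])
    (by intro a z w; ext1 <;> simp; abel)
    (by intro k a z; ext1 <;> simp [smul_sub])

/-- The comparison map `a₁ ⋯ a_N ↦ c(a₁ c(a₂ ⋯ c(a_N 1)))`. -/
def γ : (P ⊗[K] T) →ₗ[P] L := LinearMap.fst P _ _ ∘ₗ wordFold C.step (C.unit 1, 0)

/-- The homotopy on the bar complex, determined by
`t(a y) = - r(γ(a y)) - a t(y)`. -/
def t : (P ⊗[K] T) →ₗ[P] P ⊗[K] T := LinearMap.snd P _ _ ∘ₗ wordFold C.step (C.unit 1, 0)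

@[simp] theorem γ_one (p : P) : C.γ (p ⊗ₜ 1) = C.unit p := by
  simp [γ, ← map_smul]

theorem γ_cons (a : A) (y : P ⊗[K] T) : C.γ (cons P a y) = C.c (C.act a (C.γ y)) := by
  simp [γ, wordFold_cons, step]

@[simp] theorem t_one (p : P) : C.t (p ⊗ₜ 1) = 0 := by simp [t]

theorem t_cons (a : A) (y : P ⊗[K] T) :
    C.t (cons P a y) = -C.r (C.γ (cons P a y)) - cons P a (C.t y) := by
  simp [t, γ, wordFold_cons, step]

/-- Apply `d c + c d = 1 - unit ∘ aug` to `a γ(y)`. The augmentation term vanishes unless `y` is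
empty, and then it is the term in which `a` is multiplied into the coefficient. In effect the
`A`-linear extension of `γ` is a chain map out of the bar resolution. -/
theorem d_γ_cons (a : A) (y : P ⊗[K] T) :
    C.d (C.γ (cons P a y)) = C.act a (C.γ y) - C.γ (barP π (cons P a y)) := by
  induction y using cons_induction generalizing a with
  | one p =>
    have h := C.d_c (C.act a (C.unit p))
    rw [C.d_act, C.d_unit, map_zero, map_zero, add_zero, C.aug_act_unit] at h
    rw [γ_cons, barP_cons, γ_one, h, mulFirstP_one, barP_one, map_zero, sub_zero, γ_one]
  | cons a' y ih =>
    have h := C.d_c (C.act a (C.γ (cons P a' y)))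
    rw [C.aug_act _ _ (by rw [γ_cons, C.aug_c]), map_zero, sub_zero, C.d_act, ih, map_sub, map_sub,
      ← C.act_mul, ← γ_cons, ← γ_cons, ← γ_cons] at h
    rw [eq_sub_iff_add_eq, ← h, barP_cons, map_sub, mulFirstP_cons]
  | add x y hx hy => simp only [map_add, hx, hy]; abel

/-- By `t_cons`, the sum `t + r γ` sends `a y` to `-a t(y)`. It leaves the first letter alone and so
commutes with multiplication into it. -/
theorem t_mulFirstP (a : A) (y : P ⊗[K] T) :
    C.t (mulFirstP π a y) - mulFirstP π a (C.t y) =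
      mulFirstP π a (C.r (C.γ y)) - C.r (C.γ (mulFirstP π a y)) := by
  induction y using cons_induction with
  | one p => simp [C.r_unit]
  | cons a' y ih => simp only [mulFirstP_cons, t_cons, map_sub, map_neg]; abel
  | add x y hx hy => simp only [map_add, add_sub_add_comm, hx, hy]

/-- Induction on the first letter. Computing `r (d (γ (a y)))` once by `r_d` and once by `d_γ_cons`
and `r_act` produces the term `q γ`; the remaining terms cancel by `t_mulFirstP` and the induction
hypothesis prefixed by `a`. -/
theorem barP_t (y : P ⊗[K] T) : barP π (C.t y) + C.t (barP π y) = C.q (C.γ y) - y := by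
  induction y using cons_induction with
  | one p => simp [C.q_unit]
  | cons a y ih =>
    have h1 := C.t_mulFirstP a y
    have h2 := congrArg C.r (C.d_γ_cons a y)
    have h3 : C.aug (C.γ (cons P a y)) = 0 := by rw [γ_cons, C.aug_c]
    rw [map_sub, C.r_act, C.r_d, h3, TensorProduct.zero_tmul, sub_zero, barP_cons, map_sub,
      map_sub] at h2
    have h5 := congrArg (cons P a) ih
    rw [map_add, map_sub] at h5
    have h6 := C.t_cons a (barP π y)
    rw [C.t_cons, barP_cons, map_sub, map_sub, map_neg, barP_cons]
    linear_combination (norm := abel) h1 - h2 + h5 - h6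
  | add x y hx hy =>
    simp only [map_add]
    rw [add_sub_add_comm, ← hx, ← hy]; abel

end Comparison

end Homotopy

/-! ### Shuffle product with one letter. -/

section Shuffle

variable {K : Type*} [Field K]

section General

variable {A : Type*} [AddCommGroup A] [Module K A]

/-- The signed shuffle product with a letter:
`x₁ ⋯ x_N ↦ ∑ (-1)^j x₁ ⋯ x_j a x_{j+1} ⋯ x_N`. -/
def shuffle : A →ₗ[K] Module.End K T where
  toFun a := conv (twist 1).toLinearMap (lm (ιT a))
  map_add' a b := by
    rw [← conv_add_right]; congr 1; ext; simp [add_mul]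
  map_smul' k a := by
    rw [RingHom.id_apply, ← conv_smul_right]; congr 1; ext; simp

@[simp] theorem shuffle_one (a : A) : shuffle a (1 : T) = ιT a := by simp [shuffle]

theorem shuffle_cons (a c : A) (x : T) :
    shuffle a (ιT c * x) = ιT a * (ιT c * x) - ιT c * shuffle a x := by
  simp only [shuffle, LinearMap.coe_mk, AddHom.coe_mk]
  rw [conv_cons, twist_lm, conv_lm]
  simp [sub_eq_add_neg]

/-- The letters are odd, so the two orders of inserting the same letter at two places cancel. Hence
shuffling factors through the exterior algebra. -/
theorem shuffle_shuffle (a : A) (x : T) : shuffle a (shuffle a x) = 0 := by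
  induction x using induction_left with
  | one =>
    have := shuffle_cons a a (1 : T)
    simp only [mul_one, shuffle_one] at this
    rw [shuffle_one, this, sub_self]
  | cons c x ih => rw [shuffle_cons, map_sub, shuffle_cons, shuffle_cons, shuffle_cons, ih]; simp [mul_sub]
  | add x y hx hy => simp [hx, hy]
  | smul r x hx => simp [hx]

theorem shuffle_mem (a : A) {n : ℕ} {x : T} (hx : x ∈ tpow K A n) :
    shuffle a x ∈ tpow K A ((n + 1 : ℕ) : ℤ) := by
  refine tpow_induction (C := fun n x => shuffle a x ∈ tpow K A ((n + 1 : ℕ) : ℤ)) ?_ ?_ ?_ ?_ n x hx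
  · rw [shuffle_one]; exact ι_mem_tpow a
  · intro n c x hx ih
    rw [shuffle_cons]
    exact sub_mem (cons_mem _ _ (cons_mem _ _ hx)) (cons_mem _ _ ih)
  · intro n x y hx hy; rw [map_add]; exact add_mem hx hy
  · intro n r x hx; rw [map_smul]; exact Submodule.smul_mem _ _ hx

end General

variable {A : Type*} [NonUnitalCommRing A] [Module K A] [IsScalarTower K A A]
  [SMulCommClass K A A] {P : Type*} [CommRing P] [Algebra K P] (π : A →ₙₐ[K] P)

variable (P) in
/-- The shuffle product on `P ⊗ T(A)`. -/
def shuffleP (a : A) : (P ⊗[K] T) →ₗ[P] P ⊗[K] T := (shuffle a).baseChange P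

theorem shuffleP_one (a : A) (p : P) : shuffleP P a (p ⊗ₜ (1 : T)) = cons P a (p ⊗ₜ 1) := by
  simp [shuffleP]

theorem shuffleP_cons (a c : A) (y : P ⊗[K] T) :
    shuffleP P a (cons P c y) = cons P a (cons P c y) - cons P c (shuffleP P a y) := by
  induction y using TensorProduct.induction_on with
  | zero => simp
  | add x y hx hy => simp only [map_add, hx, hy]; abel
  | tmul p x => simp [shuffleP, shuffle_cons, TensorProduct.tmul_sub]

theorem mulFirstP_shuffleP (a c : A) (y : P ⊗[K] T) :
    mulFirstP π c (shuffleP P a y) - shuffleP P a (mulFirstP π c y) =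
      cons P (a * c) y - cons P a (mulFirstP π c y) := by
  induction y using cons_induction with
  | one p => rw [shuffleP_one, mulFirstP_cons, mulFirstP_one, shuffleP_one, mul_comm]
  | cons a' y _ =>
    simp only [shuffleP_cons, mulFirstP_cons, map_sub]
    rw [mul_comm c a]; abel
  | add x y hx hy =>
    simp only [map_add]
    linear_combination (norm := abel) hx + hy

/-- In a commutative algebra the bar differential is a graded derivation for shuffles: the products
`a c` and `c a` arising when `a` is inserted on either side of `c` cancel. What survives is `a` at
the end of the word, multiplied into the coefficient. -/
theorem barP_shuffleP (a : A) (y : P ⊗[K] T) :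
    barP π (shuffleP P a y) + shuffleP P a (barP π y) = π a • y := by
  induction y using cons_induction with
  | one p =>
    rw [shuffleP_one, barP_cons, mulFirstP_one]; simp [TensorProduct.smul_tmul']
  | cons c y ih =>
    have h1 := mulFirstP_shuffleP π a c y
    have h2 := congrArg (cons P c) ih
    rw [map_add, map_smul] at h2
    rw [shuffleP_cons, map_sub, barP_cons, barP_cons, mulFirstP_cons, barP_cons, map_sub, map_sub,
      shuffleP_cons]
    linear_combination (norm := abel) h2 - h1
  | add x y hx hy => simp only [map_add, smul_add, ← hx, ← hy]; abel

end Shuffle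

/-! ### The antisymmetrization map from the exterior algebra to words. -/

section Antisymmetrization

variable {K : Type*} [Field K] {V : Type*} [AddCommGroup V] [Module K V]
variable {A : Type*} [NonUnitalCommRing A] [Module K A] [IsScalarTower K A A]
  [SMulCommClass K A A] (g : V →ₗ[K] A)

/-- The antisymmetrization map `Λ(V) → T(A)`. -/
def alt : Λ →ₗ[K] T :=
  LinearMap.applyₗ (1 : T) ∘ₗ
    (ExteriorAlgebra.lift K (A := Module.End K T) ⟨shuffle ∘ₗ g, fun v =>
      LinearMap.ext fun x => shuffle_shuffle (g v) x⟩).toLinearMap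

@[simp] theorem alt_one : alt g (1 : Λ) = (1 : T) := by simp [alt]

theorem alt_wedge (v : V) (w : Λ) : alt g (wedge v w) = shuffle (g v) (alt g w) := by
  simp [alt, wedge_apply]

theorem alt_mem {q : ℕ} {w : Λ} (hw : w ∈ ⋀[K]^q V) : alt g w ∈ tpow K (A) q := by
  refine extPow_induction (C := fun q (w : Λ) => alt g w ∈ tpow K (A) q) ?_ ?_ ?_ ?_ q w hw
  · rw [alt_one]; exact one_mem_tpow
  · intro q v w _ ih; rw [alt_wedge]; exact shuffle_mem _ ih
  · intro q x y hx hy; rw [map_add]; exact add_mem hx hy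
  · intro q r x hx; rw [map_smul]; exact Submodule.smul_mem _ _ hx

variable {σ : Type*} [Fintype σ] (e : Module.Basis σ K V)

theorem sum_coord_smul {M : Type*} [AddCommGroup M] [Module K M] (f : V →ₗ[K] M) (v : V) :
    ∑ i, e.coord i v • f (e i) = f v := by
  conv_rhs => rw [← e.sum_repr v]
  simp only [map_sum, map_smul, Module.Basis.coord_apply]

/-- The terms of an antisymmetrized word are sorted by their first letter; what follows the letter
`e_i` is the antisymmetrization of the contraction. The scalar part contributes the empty word. -/
theorem alt_eq (w : Λ) :
    alt g w = ∑ i, ιT (g (e i)) * alt g (contr (e.coord i) w) + extAug w • (1 : T) := by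
  refine LinearMap.congr_fun (ext_wedge (f := alt g)
    (g := ∑ i, lm (ιT (g (e i))) ∘ₗ alt g ∘ₗ contr (e.coord i) +
      LinearMap.toSpanSingleton K T 1 ∘ₗ extAug.toLinearMap) ?_ ?_) w |>.trans (by simp)
  · simp
  · intro v w h
    simp only [LinearMap.add_apply, LinearMap.sum_apply, LinearMap.comp_apply, lm_apply,
      AlgHom.toLinearMap_apply, LinearMap.toSpanSingleton_apply, extAug_wedge, zero_smul,
      add_zero] at h ⊢
    have h2 := sum_coord_smul e (LinearMap.mulRight K (alt g w) ∘ₗ ιT ∘ₗ g) v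
    simp only [LinearMap.comp_apply, LinearMap.mulRight_apply] at h2
    simp only [contr_wedge, map_sub, map_smul, mul_sub, mul_smul_comm, Finset.sum_sub_distrib, h2,
      alt_wedge]
    conv_lhs => rw [h]
    rw [map_add, map_sum, map_smul, shuffle_one]
    simp only [shuffle_cons, Finset.sum_sub_distrib]
    rw [← Finset.mul_sum]
    have h3 := congrArg (fun z => ιT (g v) * z) h
    simp only [mul_add, mul_smul_comm, mul_one] at h3
    rw [h3]; abel

variable {P : Type*} [CommRing P] [Algebra K P] (π : A →ₙₐ[K] P)

/-- By `barP_shuffleP`, inner products cancel in an antisymmetrized word, and only the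
multiplication of the last letter into the coefficients is left. -/
theorem barP_alt (p : P) (w : Λ) :
    barP π (p ⊗ₜ alt g w) = ∑ i, (π (g (e i)) * p) ⊗ₜ[K] alt g (contr (e.coord i) w) := by
  refine LinearMap.congr_fun (ext_wedge
    (f := (barP π).restrictScalars K ∘ₗ TensorProduct.mk K P T p ∘ₗ alt g)
    (g := ∑ i, TensorProduct.mk K P T (π (g (e i)) * p) ∘ₗ alt g ∘ₗ contr (e.coord i)) ?_ ?_) w
    |>.trans (by simp)
  · simp
  · intro v w h
    simp only [LinearMap.sum_apply, LinearMap.comp_apply, TensorProduct.mk_apply,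
      LinearMap.restrictScalars_apply] at h ⊢
    have h1 := barP_shuffleP π (g v) (p ⊗ₜ alt g w)
    have h2 := sum_coord_smul e (LinearMap.mulRight K p ∘ₗ (π : A →ₗ[K] P) ∘ₗ g) v
    simp only [LinearMap.comp_apply, LinearMap.mulRight_apply] at h2
    have h3 : ∑ i, (π (g (e i)) * p) ⊗ₜ[K] (e.coord i v • alt g w) = (π (g v) * p) ⊗ₜ alt g w := by
      rw [← show _ = π (g v) * p from h2, TensorProduct.sum_tmul]
      exact Finset.sum_congr rfl fun i _ => (TensorProduct.smul_tmul _ _ _).symm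
    simp only [contr_wedge, map_sub, map_smul, TensorProduct.tmul_sub, Finset.sum_sub_distrib,
      alt_wedge, h3]
    rw [h, map_sum, TensorProduct.smul_tmul'] at h1
    exact eq_sub_of_add_eq h1

end Antisymmetrization

/-! ### The Koszul complex as comparison data for the bar complex. -/

section KoszulBar

variable {K : Type*} [Field K] {V : Type*} [AddCommGroup V] [Module K V]
variable {A : Type*} [NonUnitalCommRing A] [Module K A] [IsScalarTower K A A]
  [SMulCommClass K A A]

variable (K V) in
/-- The augmentation of the symmetric algebra. -/
def symAug : S →ₐ[K] K := SymmetricAlgebra.algebraMapInv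

@[simp] theorem symAug_ι (v : V) : symAug K V (SymmetricAlgebra.ι K V v) = 0 :=
  SymmetricAlgebra.algebraMapInv_ι v

variable (K V A) in
/-- An identification of the algebra `A` with the augmentation ideal of `S(V)`. -/
structure AugIdeal where
  incl : A →ₙₐ[K] S
  redu : S →ₗ[K] A
  incl_redu : ∀ f, incl (redu f) = f - algebraMap K S (symAug K V f)
  redu_incl : ∀ a, redu (incl a) = a

namespace AugIdeal

variable (I : AugIdeal K V A)

theorem symAug_incl (a : A) : symAug K V (I.incl a) = 0 := by
  have := I.incl_redu (I.incl a)
  rw [I.redu_incl, eq_comm, sub_eq_self] at this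
  exact (SymmetricAlgebra.algebraMap_eq_zero_iff (M := V) _).mp this

theorem incl_injective : Function.Injective I.incl := Function.LeftInverse.injective I.redu_incl

@[simp] theorem redu_one : I.redu 1 = 0 := I.incl_injective (by simp [I.incl_redu])

theorem redu_mul (a : A) (f : S) : I.redu (I.incl a * f) = a * I.redu f + symAug K V f • a := by
  apply I.incl_injective
  rw [I.incl_redu, map_mul, symAug_incl]
  simp [I.incl_redu, mul_sub, Algebra.smul_def, mul_comm]

/-- The generators `V → A`. -/
def g : V →ₗ[K] A := I.redu ∘ₗ SymmetricAlgebra.ι K V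

theorem incl_g (v : V) : I.incl (I.g v) = SymmetricAlgebra.ι K V v := by
  simp [g, I.incl_redu]

theorem redu_ι_mul (v : V) (f : S) :
    I.redu (SymmetricAlgebra.ι K V v * f) = I.g v * I.redu f + symAug K V f • I.g v := by
  rw [← I.incl_g, I.redu_mul]

end AugIdeal

variable {σ : Type*} [Fintype σ] (e : Module.Basis σ K V)
variable {P : Type*} [CommRing P] [Algebra K P]

open MvPolynomial

variable (P) in
/-- A polynomial function on `V` as a polynomial in the coordinates, with coefficients in `P`. -/
def symToPoly : S →ₐ[K] MvPolynomial σ P :=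
  SymmetricAlgebra.lift (∑ i, (e.coord i).smulRight (X i))

theorem symToPoly_basis (i : σ) : symToPoly e P (SymmetricAlgebra.ι K V (e i)) = X i := by
  classical
  rw [symToPoly, SymmetricAlgebra.lift_ι_apply]
  simp [Finsupp.single_apply, ite_smul]

variable (P) in
/-- A polynomial with coefficients in `P` as an element of `P ⊗ S(V)`. -/
def polyToSym : MvPolynomial σ P →ₐ[P] P ⊗[K] S := aeval fun i => 1 ⊗ₜ SymmetricAlgebra.ι K V (e i)

theorem polyToSym_symToPoly (f : S) : polyToSym e P (symToPoly e P f) = 1 ⊗ₜ f := by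
  have : ((polyToSym e P).restrictScalars K).comp (symToPoly e P) =
      Algebra.TensorProduct.includeRight := by
    apply SymmetricAlgebra.algHom_ext
    refine e.ext fun i => ?_
    change polyToSym e P (symToPoly e P (SymmetricAlgebra.ι K V (e i))) = _
    rw [symToPoly_basis]
    simp [polyToSym]
  exact DFunLike.congr_fun this f

variable (π : SymmetricAlgebra K V →ₐ[K] P)

theorem aeval_symToPoly (f : S) :
    (aeval (fun i => π (SymmetricAlgebra.ι K V (e i))) : MvPolynomial σ P →ₐ[P] P)
      (symToPoly e P f) = π f := by
  have : ((aeval (fun i => π (SymmetricAlgebra.ι K V (e i))) :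
      MvPolynomial σ P →ₐ[P] P).restrictScalars K).comp (symToPoly e P) = π := by
    apply SymmetricAlgebra.algHom_ext
    refine e.ext fun i => ?_
    change aeval _ (symToPoly e P (SymmetricAlgebra.ι K V (e i))) = _
    rw [symToPoly_basis]
    simp
  exact DFunLike.congr_fun this f

variable (I : AugIdeal K V A)

/-- Restriction of an algebra map to the augmentation ideal. -/
def AugIdeal.restr : A →ₙₐ[K] P := (π : S →ₙₐ[K] P).comp I.incl

theorem AugIdeal.restr_apply (a : A) : I.restr π a = π (I.incl a) := rfl

/-- The `S(V)`-linear identification of the Koszul complex with `P ⊗ (S(V) ⊗ Λ(V))`. -/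
def kosToSym : Kos K V σ P →ₗ[P] P ⊗[K] (S ⊗[K] Λ) :=
  (TensorProduct.AlgebraTensorModule.assoc K K P P S Λ).toLinearMap ∘ₗ
    TensorProduct.AlgebraTensorModule.map (polyToSym e P).toLinearMap LinearMap.id

theorem kosToSym_symToPoly_smul_tmul (p : P) (f g : S) (w : Λ) :
    kosToSym e ((symToPoly e P f * (p • symToPoly e P g)) ⊗ₜ w) = p ⊗ₜ[K] ((f * g) ⊗ₜ[K] w) := by
  simp [kosToSym, polyToSym_symToPoly, TensorProduct.smul_tmul']

/-- Polynomials with coefficients in `P` are spanned by the products `p f` with `p ∈ P`,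
`f ∈ S(V)`. -/
theorem poly_induction {C : MvPolynomial σ P → Prop}
    (smul : ∀ (p : P) (f : S), C (p • symToPoly e P f))
    (add : ∀ x y, C x → C y → C (x + y)) (f : MvPolynomial σ P) : C f := by
  induction f using MvPolynomial.induction_on' with
  | add x y hx hy => exact add _ _ hx hy
  | monomial m p =>
    have : monomial m p =
        p • symToPoly e P (m.prod fun i n => SymmetricAlgebra.ι K V (e i) ^ n) := by
      rw [monomial_eq, ← C_mul', map_finsuppProd]
      simp [symToPoly_basis]
    rw [this]; exact smul _ _

/-- The Koszul complex is spanned by the products `p f ⊗ w` with `p ∈ P`, `f ∈ S(V)`. -/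
theorem kos_induction {C : Kos K V σ P → Prop}
    (tmul : ∀ (p : P) (f : S) (w : Λ), C ((p • symToPoly e P f) ⊗ₜ w))
    (add : ∀ x y, C x → C y → C (x + y)) (z : Kos K V σ P) : C z := by
  induction z using TensorProduct.induction_on with
  | zero => simpa using tmul 0 0 0
  | add x y hx hy => exact add x y hx hy
  | tmul f w =>
    exact poly_induction e (C := fun f => C (f ⊗ₜ w)) (fun p f => tmul p f w)
      (fun x y hx hy => by rw [TensorProduct.add_tmul]; exact add _ _ hx hy) f

/-- The map `p f ⊗ w ↦ p ⊗ f̄ alt(w)`, where `f̄` is the projection of `f` to `S(V)₀`. -/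
def kosToBar : Kos K V σ P →ₗ[P] P ⊗[K] T :=
  (TensorProduct.lift ((LinearMap.llcomp K Λ T T).flip (alt I.g) ∘ₗ LinearMap.mul K T ∘ₗ ιT ∘ₗ I.redu)).baseChange P ∘ₗ
    kosToSym e

/-- The map `p f ⊗ w ↦ p ⊗ ε(f) w`. -/
def kosToExt : Kos K V σ P →ₗ[P] P ⊗[K] Λ :=
  (TensorProduct.lift (LinearMap.lsmul K Λ ∘ₗ (symAug K V).toLinearMap)).baseChange P ∘ₗ
    kosToSym e

theorem kosToBar_tmul (p : P) (f : S) (w : Λ) :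
    kosToBar e I ((p • symToPoly e P f) ⊗ₜ w) = p ⊗ₜ[K] (ιT (I.redu f) * alt I.g w) := by
  have := kosToSym_symToPoly_smul_tmul e p 1 f w
  rw [map_one, one_mul, one_mul] at this
  simp [kosToBar, this]

theorem kosToExt_tmul (p : P) (f : S) (w : Λ) :
    kosToExt e ((p • symToPoly e P f) ⊗ₜ w) = p ⊗ₜ[K] (symAug K V f • w) := by
  have := kosToSym_symToPoly_smul_tmul e p 1 f w
  rw [map_one, one_mul, one_mul] at this
  simp [kosToExt, this]

theorem kosAug_smul (p : σ → P) (g : MvPolynomial σ P) (z : Kos K V σ P) :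
    kosAug p (g • z) = aeval p g * kosAug p z := by
  induction z using TensorProduct.induction_on with
  | zero => simp
  | add x y hx hy => simp only [smul_add, map_add, hx, hy, mul_add]
  | tmul f w => simp [TensorProduct.smul_tmul']

theorem kosD_smul (d : σ → MvPolynomial σ P) (g : MvPolynomial σ P) (z : Kos K V σ P) :
    kosD e d (g • z) = g • kosD e d z := by
  induction z using TensorProduct.induction_on with
  | zero => simp
  | add x y hx hy => simp only [smul_add, map_add, hx, hy]
  | tmul f w => simp [TensorProduct.smul_tmul', Finset.smul_sum, mul_left_comm]

theorem symToPoly_smul_tmul (a f : S) (p : P) (w : Λ) :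
    symToPoly e P a • ((p • symToPoly e P f) ⊗ₜ[K] w : Kos K V σ P) =
      (p • symToPoly e P (a * f)) ⊗ₜ w := by
  rw [TensorProduct.smul_tmul', smul_eq_mul, map_mul, mul_smul_comm]

/-- Removing the constant term from a product `a f` gives `a f̄ + ε(f) a`: the first summand
multiplies into an existing first letter, the second creates a new one. -/
theorem kosToBar_symToPoly_smul (a : A) (z : Kos K V σ P) :
    kosToBar e I (symToPoly e P (I.incl a) • z) = mulFirstP (I.restr π) a (kosToBar e I z) +
      cons P a ((alt I.g).baseChange P (kosToExt e z)) := by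
  induction z using kos_induction e with
  | add x y hx hy => simp only [smul_add, map_add, hx, hy]; abel
  | tmul p f w =>
    rw [symToPoly_smul_tmul, kosToBar_tmul, kosToBar_tmul, kosToExt_tmul, ← cons_tmul, ← cons_tmul,
      mulFirstP_cons, I.redu_mul, cons_add, cons_smul]
    simp

/-- The differential replaces `f ⊗ w` by the sum of `(e_i - π(e_i)) f ⊗ contr e_i w`. The parts `e_i
f̄` are the products of the first two letters, by `alt_eq`; the parts with `π(e_i)` are the last
letters multiplied into the coefficients, by `barP_alt`; the parts `ε(f) e_i` reassemble to `ε(f)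
alt w`. The scalar parts of `w` add up to the augmentation. -/
theorem kosToBar_kosD (z : Kos K V σ P) :
    kosToBar e I (kosD e (fun i => X i - C (π (SymmetricAlgebra.ι K V (e i)))) z) =
      barP (I.restr π) (kosToBar e I z) + (alt I.g).baseChange P (kosToExt e z) -
        kosAug (fun i => π (SymmetricAlgebra.ι K V (e i))) z ⊗ₜ 1 := by
  induction z using kos_induction e with
  | add x y hx hy => simp only [map_add, TensorProduct.add_tmul, hx, hy]; abel
  | tmul p f w =>
    have h1 : ∀ i, (X i - C (π (SymmetricAlgebra.ι K V (e i)))) * (p • symToPoly e P f) =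
        p • symToPoly e P (I.incl (I.g (e i)) * f) -
          (π (SymmetricAlgebra.ι K V (e i)) * p) • symToPoly e P f := by
      intro i
      rw [sub_mul, map_mul, I.incl_g, symToPoly_basis, mul_smul_comm, ← smul_eq_C_mul, smul_smul]
    have h2 : mulFirstP (I.restr π) (I.redu f) (p ⊗ₜ alt I.g w) =
        ∑ i, cons P (I.g (e i) * I.redu f) (p ⊗ₜ alt I.g (contr (e.coord i) w)) +
          extAug w • ((π (I.incl (I.redu f)) * p) ⊗ₜ 1) := by
      conv_lhs => rw [alt_eq I.g e w]
      simp only [TensorProduct.tmul_add, TensorProduct.tmul_sum, map_add, map_sum, ← cons_tmul,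
        mulFirstP_cons, TensorProduct.tmul_smul]
      rw [LinearMap.map_smul_of_tower, mulFirstP_one, I.restr_apply]
      simp only [mul_comm]
    have h3 : symAug K V f • (p ⊗ₜ[K] alt I.g w) =
        ∑ i, symAug K V f • cons P (I.g (e i)) (p ⊗ₜ alt I.g (contr (e.coord i) w)) +
          (symAug K V f * extAug w) • (p ⊗ₜ 1) := by
      conv_lhs => rw [alt_eq I.g e w]
      simp only [TensorProduct.tmul_add, TensorProduct.tmul_sum, ← cons_tmul,
        TensorProduct.tmul_smul, smul_add, smul_smul, Finset.smul_sum]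
    have h4 : π f = algebraMap K P (symAug K V f) + π (I.incl (I.redu f)) := by
      rw [I.incl_redu, map_sub, AlgHom.commutes]; abel
    rw [kosD_tmul, kosAug_tmul, map_smul, aeval_symToPoly, kosToBar_tmul, kosToExt_tmul,
      LinearMap.baseChange_tmul, map_smul (alt I.g), TensorProduct.tmul_smul, h3,
      ← cons_tmul, barP_cons, h2, barP_alt I.g e]
    simp only [h1, TensorProduct.sub_tmul, Finset.sum_sub_distrib, map_sub, map_sum,
      kosToBar_tmul, I.redu_ι_mul, I.incl_g,
      ← cons_tmul, cons_add, cons_smul, Finset.sum_add_distrib, I.restr_apply]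
    have h5 : (extAug w • p • π f) ⊗ₜ[K] (1 : T) = extAug w • ((π (I.incl (I.redu f)) * p) ⊗ₜ 1) +
        (symAug K V f * extAug w) • (p ⊗ₜ 1) := by
      rw [h4, smul_add, smul_add, TensorProduct.add_tmul, add_comm]
      simp [mul_comm, Algebra.algebraMap_eq_smul_one, TensorProduct.smul_tmul', smul_smul]
    rw [h5]; abel

/-- The comparison data given by the Koszul complex. -/
def AugIdeal.koszul [CharZero K] : Comparison (I.restr π) (Kos K V σ P) where
  act := LinearMap.mk₂' K P (fun a z => symToPoly e P (I.incl a) • z)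
    (by intro a b z; simp [add_smul])
    (by intro k a z; simp)
    (by intro a z w; simp)
    (by intro p a z; rw [smul_comm])
  d := kosD e fun i => X i - C (π (SymmetricAlgebra.ι K V (e i)))
  c := kosC e fun i => π (SymmetricAlgebra.ι K V (e i))
  unit := kosUnit K V σ P
  aug := kosAug fun i => π (SymmetricAlgebra.ι K V (e i))
  r := kosToBar e I
  q := (alt I.g).baseChange P ∘ₗ kosToExt e
  act_mul a b z := by simp [mul_smul]
  d_act a z := kosD_smul e _ _ _
  d_unit p := by simp [kosUnit_apply]
  d_c z := kosD_kosC e _ z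
  aug_c z := kosAug_kosC e _ z
  aug_act_unit a p := by
    rw [LinearMap.mk₂'_apply, kosAug_smul, aeval_symToPoly, kosUnit_apply]; simp [I.restr_apply]
  aug_act a z h := by rw [LinearMap.mk₂'_apply, kosAug_smul, h, mul_zero]
  r_unit p := by
    have := kosToBar_tmul e I p 1 (1 : Λ)
    rw [map_one, ← C_mul', mul_one] at this
    rw [kosUnit_apply, this]; simp
  q_unit p := by
    have := kosToExt_tmul e p 1 (1 : Λ)
    rw [map_one, ← C_mul', mul_one] at this
    rw [kosUnit_apply, LinearMap.comp_apply, this]; simp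
  r_act a z := kosToBar_symToPoly_smul e π I a z
  r_d z := kosToBar_kosD e π I z

theorem AugIdeal.koszul_c_act [CharZero K] (a : A) (z : Kos K V σ P) :
    (I.koszul e π).c ((I.koszul e π).act a z) =
      kosC e (fun i => π (SymmetricAlgebra.ι K V (e i))) (symToPoly e P (I.incl a) • z) := rfl

end KoszulBar

/-! ### Word length under the comparison map and the homotopy. -/

section Degrees

variable {K : Type*} [Field K] {V : Type*} [AddCommGroup V] [Module K V]
variable {A : Type*} [NonUnitalCommRing A] [Module K A] [IsScalarTower K A A]
  [SMulCommClass K A A]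
variable {σ : Type*} [Fintype σ] (e : Module.Basis σ K V)
variable {P : Type*} [CommRing P] [Algebra K P]
variable (π : SymmetricAlgebra K V →ₐ[K] P) (I : AugIdeal K V A)

open MvPolynomial

variable (A P) in
/-- The component `P ⊗ A^{⊗n}` of `P ⊗ T(A)`. -/
def barDeg (n : ℤ) : Submodule P (P ⊗[K] T) :=
  LinearMap.range (TensorProduct.AlgebraTensorModule.map
    (LinearMap.id : P →ₗ[P] _) (tpow K A n).subtype)

theorem tmul_mem_barDeg (p : P) {n : ℤ} {x : T} (hx : x ∈ tpow K A n) :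
    p ⊗ₜ[K] x ∈ barDeg A P n := ⟨p ⊗ₜ ⟨x, hx⟩, by simp⟩

theorem barDeg_le {n : ℤ} {N : Submodule K (P ⊗[K] T)}
    (h : ∀ p : P, ∀ x ∈ tpow K A n, p ⊗ₜ[K] x ∈ N) :
    (barDeg A P n).restrictScalars K ≤ N := by
  rintro _ ⟨z, rfl⟩
  induction z using TensorProduct.induction_on with
  | zero => simp
  | add x y hx hy => rw [map_add]; exact add_mem hx hy
  | tmul f w => exact h f w w.2

theorem cons_mem_barDeg (a : A) {n : ℕ} {y : P ⊗[K] T} (hy : y ∈ barDeg A P n) :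
    cons P a y ∈ barDeg A P ((n + 1 : ℕ) : ℤ) :=
  barDeg_le (N := ((barDeg A P ((n + 1 : ℕ) : ℤ)).comap (cons P a)).restrictScalars K)
    (fun p _ hx => tmul_mem_barDeg p (cons_mem n a hx)) hy

theorem kosToBar_mem {q : ℕ} {z : Kos K V σ P} (hz : z ∈ kosDeg K V σ P q) :
    kosToBar e I z ∈ barDeg A P ((q + 1 : ℕ) : ℤ) := by
  refine kosDeg_le (N := (barDeg A P ((q + 1 : ℕ) : ℤ)).comap (kosToBar e I)) ?_ hz
  intro f w hw
  refine poly_induction e (C := fun f => f ⊗ₜ[K] w ∈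
    (barDeg A P ((q + 1 : ℕ) : ℤ)).comap (kosToBar e I)) ?_ ?_ f
  · intro p f
    rw [Submodule.mem_comap, kosToBar_tmul]
    exact tmul_mem_barDeg _ (cons_mem q _ (alt_mem _ hw))
  · intro f g hf hg
    rw [TensorProduct.add_tmul]; exact add_mem hf hg

theorem act_mem [CharZero K] (a : A) {q : ℕ} {z : Kos K V σ P} (hz : z ∈ kosDeg K V σ P q) :
    (I.koszul e π).act a z ∈ kosDeg K V σ P q :=
  kosDeg_le (N := (kosDeg K V σ P q).comap ((I.koszul e π).act a))
    (fun f _ hw => tmul_mem_kosDeg (symToPoly e P (I.incl a) * f) hw) hz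

theorem γ_mem [CharZero K] (p : P) (n : ℕ) (x : T) (hx : x ∈ tpow K A n) :
    (I.koszul e π).γ (p ⊗ₜ x) ∈ kosDeg K V σ P n := by
  refine tpow_induction (C := fun n x => (I.koszul e π).γ (p ⊗ₜ x) ∈ kosDeg K V σ P n)
    ?_ ?_ ?_ ?_ n x hx
  · rw [Comparison.γ_one]
    exact tmul_mem_kosDeg (C p) one_mem_extPow
  · intro n a x _ ih
    rw [← cons_tmul, Comparison.γ_cons]
    exact kosC_mem e _ (act_mem e π I a ih)
  · intro n x y hx hy
    rw [TensorProduct.tmul_add, map_add]; exact add_mem hx hy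
  · intro n r x hx
    rw [TensorProduct.tmul_smul, LinearMap.map_smul_of_tower]
    exact Submodule.smul_of_tower_mem _ r hx

theorem t_mem [CharZero K] (p : P) (n : ℕ) (x : T) (hx : x ∈ tpow K A n) :
    (I.koszul e π).t (p ⊗ₜ x) ∈ barDeg A P ((n + 1 : ℕ) : ℤ) := by
  have := tpow_induction (C := fun n x => x ∈ tpow K A n ∧
    (I.koszul e π).t (p ⊗ₜ x) ∈ barDeg A P ((n + 1 : ℕ) : ℤ)) ?_ ?_ ?_ ?_ n x hx
  · exact this.2
  · rw [Comparison.t_one]; exact ⟨one_mem_tpow, zero_mem _⟩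
  · intro n a x _ ih
    refine ⟨cons_mem n a ih.1, ?_⟩
    rw [← cons_tmul, Comparison.t_cons]
    exact sub_mem (neg_mem (kosToBar_mem e I (γ_mem e π I p (n + 1) _ (cons_mem n a ih.1))))
      (cons_mem_barDeg a ih.2)
  · intro n x y hx hy
    rw [TensorProduct.tmul_add, map_add]; exact ⟨add_mem hx.1 hy.1, add_mem hx.2 hy.2⟩
  · intro n r x hx
    rw [TensorProduct.tmul_smul, LinearMap.map_smul_of_tower]
    exact ⟨Submodule.smul_mem _ r hx.1, Submodule.smul_of_tower_mem _ r hx.2⟩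

end Degrees

/-! ### The bar homology of the augmentation ideal is the exterior algebra. -/

section BarHomology

variable {K : Type*} [Field K] {V : Type*} [AddCommGroup V] [Module K V]
variable {A : Type*} [NonUnitalCommRing A] [Module K A] [IsScalarTower K A A]
  [SMulCommClass K A A]
variable {σ : Type*} [Fintype σ] (e : Module.Basis σ K V) (I : AugIdeal K V A)

open MvPolynomial

theorem restr_symAug (a : A) : I.restr (symAug K V) a = 0 := I.symAug_incl a

/-- When the coefficients are `K` through the augmentation, `A` acts on them by zero, so the bar
differential with coefficients is the plain one. -/
theorem lastToCoeff_restr (x : T) : lastToCoeff (I.restr (symAug K V)) x = 0 := by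
  induction x using induction_left with
  | one => exact lastToCoeff_one _
  | cons a x h => rw [lastToCoeff_cons, restr_symAug, h]; simp
  | add x y hx hy => rw [map_add, hx, hy, add_zero]
  | smul r x hx => rw [map_smul, hx, smul_zero]

theorem barP_restr (x : T) : barP (I.restr (symAug K V)) ((1 : K) ⊗ₜ x) = 1 ⊗ₜ bar K A x := by
  rw [barP_tmul, lastToCoeff_restr, smul_zero, add_zero]

theorem bar_alt [FiniteDimensional K V] (w : Λ) : bar K A (alt I.g w) = 0 := by
  have h := barP_alt I.g (Module.finBasis K V) (I.restr (symAug K V)) 1 w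
  simpa [barP_restr, restr_symAug] using congrArg (TensorProduct.lid K T) h

variable [CharZero K]

/-- The projection of `T(A)` onto its homology `Λ(V)`. -/
def toExt : T →ₗ[K] Λ :=
  (TensorProduct.lid K Λ).toLinearMap ∘ₗ kosToExt e ∘ₗ (I.koszul e (symAug K V)).γ ∘ₗ
    TensorProduct.mk K K T 1

/-- The homotopy on `T(A)`. -/
def htpy : Module.End K T :=
  (TensorProduct.lid K T).toLinearMap ∘ₗ (I.koszul e (symAug K V)).t ∘ₗ TensorProduct.mk K K T 1

theorem kosToExt_one_tmul (w : Λ) : kosToExt e ((1 : MvPolynomial σ K) ⊗ₜ w) = 1 ⊗ₜ[K] w := by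
  have := kosToExt_tmul e (1 : K) 1 w
  rwa [map_one, one_smul, map_one, one_smul] at this

/-- Induction on the degree. By `alt_eq` the left side is `c` applied to the sum of the `X_i ⊗ contr
e_i w`, that is, to `d (1 ⊗ w)`. Since `c (1 ⊗ w) = 0`, the homotopy identity returns `1 ⊗ w`. -/
theorem γ_alt (w : Λ) :
    (I.koszul e (symAug K V)).γ (1 ⊗ₜ alt I.g w) = (1 : MvPolynomial σ K) ⊗ₜ w := by
  have key : ∀ q : ℕ, ∀ w ∈ ⋀[K]^q V,
      (I.koszul e (symAug K V)).γ (1 ⊗ₜ alt I.g w) = (1 : MvPolynomial σ K) ⊗ₜ w := by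
    intro q
    induction q with
    | zero =>
      intro w hw
      rw [eq_extAug_of_mem hw, map_smul, alt_one,
        TensorProduct.tmul_smul, LinearMap.map_smul_of_tower, Comparison.γ_one]
      simp [AugIdeal.koszul, kosUnit_apply]
    | succ q ih =>
      intro w hw
      have h0 := extAug_of_mem hw
      rw [alt_eq I.g e w, h0, zero_smul, add_zero, TensorProduct.tmul_sum, map_sum]
      have h1 : ∀ i, (I.koszul e (symAug K V)).γ
          (1 ⊗ₜ (ιT (I.g (e i)) * alt I.g (contr (e.coord i) w))) =
          kosC e (fun i => symAug K V (SymmetricAlgebra.ι K V (e i)))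
            ((X i : MvPolynomial σ K) ⊗ₜ contr (e.coord i) w) := by
        intro i
        rw [← cons_tmul, Comparison.γ_cons, ih _ (contr_succ_mem _ hw)]
        refine (I.koszul_c_act e _ _ _).trans ?_
        rw [I.incl_g, symToPoly_basis, TensorProduct.smul_tmul', smul_eq_mul, mul_one]
      have h2 := kosD_kosC e (fun i => symAug K V (SymmetricAlgebra.ι K V (e i)))
        ((1 : MvPolynomial σ K) ⊗ₜ w)
      have h3 : kosC e (fun i => symAug K V (SymmetricAlgebra.ι K V (e i)))
          ((1 : MvPolynomial σ K) ⊗ₜ w) = 0 := by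
        simp [kosC, kosC₀_one_tmul]
      rw [h3, map_zero, zero_add, kosAug_tmul, h0, zero_smul, map_zero, sub_zero, kosD_tmul] at h2
      simp only [h1]
      rw [← map_sum, ← h2]
      simp
  refine DirectSum.Decomposition.inductionOn (fun q : ℕ => ⋀[K]^q V) ?_ ?_ ?_ w
  · simp
  · intro i w; exact key i w w.2
  · intro w w' h h'; rw [map_add, TensorProduct.tmul_add, map_add, h, h', TensorProduct.tmul_add]

theorem toExt_alt (w : Λ) : toExt e I (alt I.g w) = w := by
  simp [toExt, γ_alt, kosToExt_one_tmul]

theorem kosToExt_act (a : A) (z : Kos K V σ K) :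
    kosToExt e ((I.koszul e (symAug K V)).act a z) = 0 := by
  change kosToExt e (symToPoly e K (I.incl a) • z) = 0
  induction z using kos_induction e with
  | add x y hx hy => rw [smul_add, map_add, hx, hy, add_zero]
  | tmul p f w =>
    rw [symToPoly_smul_tmul, kosToExt_tmul, map_mul, I.symAug_incl, zero_mul, zero_smul,
      TensorProduct.tmul_zero]

theorem kosToExt_d (z : Kos K V σ K) : kosToExt e ((I.koszul e (symAug K V)).d z) = 0 := by
  change kosToExt e (kosD e _ z) = 0
  induction z using kos_induction e with
  | add x y hx hy => rw [map_add, map_add, hx, hy, add_zero]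
  | tmul p f w =>
    rw [kosD_tmul, map_sum]
    refine Finset.sum_eq_zero fun i _ => ?_
    rw [symAug_ι, map_zero, sub_zero, ← symToPoly_basis e, mul_smul_comm, ← map_mul,
      kosToExt_tmul, map_mul, symAug_ι, zero_mul, zero_smul, TensorProduct.tmul_zero]

/-- By `d_γ_cons`, `γ` of a boundary is a difference of an element of `A` acting and a value of `d`.
At the augmentation point both lie in the part with positive polynomial degree, which `kosToExt`
discards. -/
theorem toExt_bar (x : T) : toExt e I (bar K A x) = 0 := by
  have h : kosToExt e ((I.koszul e (symAug K V)).γ (barP (I.restr (symAug K V)) (1 ⊗ₜ x))) = 0 := by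
    induction x using induction_left with
    | one => rw [barP_one, map_zero, map_zero]
    | cons a x _ =>
      have := congrArg (kosToExt e) ((I.koszul e (symAug K V)).d_γ_cons a (1 ⊗ₜ x))
      rwa [kosToExt_d, map_sub, kosToExt_act, zero_sub, eq_comm, neg_eq_zero, cons_tmul] at this
    | add x y hx hy => rw [TensorProduct.tmul_add, map_add, map_add, map_add, hx, hy, add_zero]
    | smul r x hx =>
      rw [TensorProduct.tmul_smul, LinearMap.map_smul, map_smul, map_smul, hx, smul_zero]
  rw [barP_restr] at h
  simp [toExt, h]

/-- This is `barP_t` for the coefficients `K`. Together with `toExt_alt`, `toExt_bar` and `bar_alt`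
it makes Λ(V), with zero differential, a deformation retract of the bar complex. -/
theorem bar_htpy (x : T) :
    bar K A (htpy e I x) + htpy e I (bar K A x) = alt I.g (toExt e I x) - x := by
  have h := (I.koszul e (symAug K V)).barP_t (1 ⊗ₜ x)
  have h1 : ∀ y : K ⊗[K] T, TensorProduct.lid K T (barP (I.restr (symAug K V)) y) =
      bar K A (TensorProduct.lid K T y) := by
    intro y
    obtain ⟨z, rfl⟩ := (TensorProduct.lid K T).symm.surjective y
    rw [TensorProduct.lid_symm_apply, barP_restr]; simp
  have h2 : ∀ y : K ⊗[K] Λ, TensorProduct.lid K T ((alt I.g).baseChange K y) =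
      alt I.g (TensorProduct.lid K Λ y) := by
    intro y
    obtain ⟨z, rfl⟩ := (TensorProduct.lid K Λ).symm.surjective y
    simp
  have h3 := congrArg (TensorProduct.lid K T) h
  rw [map_add, map_sub, h1, barP_restr] at h3
  change _ = TensorProduct.lid K T ((alt I.g).baseChange K (kosToExt e _)) - _ at h3
  rw [h2] at h3
  simpa [htpy, toExt] using h3

theorem htpy_mem : htpy e I ∈ degHom K A (-1) := by
  intro n x hx
  refine mem_tpow_of_eq (p := ((n + 1 : ℕ) : ℤ)) ?_ (by push_cast; ring)
  exact barDeg_le (N := (tpow K A ((n + 1 : ℕ) : ℤ)).comap (TensorProduct.lid K T).toLinearMap)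
    (fun p y hy => by simpa using Submodule.smul_mem _ p hy) (t_mem e _ I 1 n x hx)

theorem toExt_mem {n : ℕ} {x : T} (hx : x ∈ tpow K A n) : toExt e I x ∈ ⋀[K]^n V := by
  refine kosDeg_le (N := (⋀[K]^n V).comap ((TensorProduct.lid K Λ).toLinearMap ∘ₗ kosToExt e))
    ?_ (γ_mem e _ I 1 n x hx)
  intro f w hw
  refine poly_induction e (C := fun f => f ⊗ₜ[K] w ∈ (⋀[K]^n V).comap
    ((TensorProduct.lid K Λ).toLinearMap ∘ₗ kosToExt e)) ?_ ?_ f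
  · intro p f
    rw [Submodule.mem_comap, LinearMap.comp_apply, kosToExt_tmul]
    simpa using Submodule.smul_mem _ _ (Submodule.smul_mem _ p hw)
  · intro f g hf hg
    rw [TensorProduct.add_tmul]; exact add_mem hf hg

end BarHomology

/-! ### The bar differential seen from the last letter. -/

section Last

variable {K : Type*} [Field K]

section Module

variable {A : Type*} [AddCommGroup A] [Module K A]

theorem induction_right {C : T → Prop} (one : C 1) (snoc : ∀ x c, C x → C (x * ιT c))
    (add : ∀ x y, C x → C y → C (x + y)) (smul : ∀ (r : K) x, C x → C (r • x)) (x : T) : C x := by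
  have h : ∀ n : ℕ, ∀ x ∈ tpow K A n, C x := fun n x hx =>
    tpow_induction_right (C := fun _ x => C x) one (fun _ x c _ h => snoc x c h)
      (fun _ x y => add x y) (fun _ r x => smul r x) n x hx
  have hz : C 0 := by simpa using smul 0 1 one
  exact DirectSum.Decomposition.inductionOn
    (fun n : ℕ => LinearMap.range ιT ^ n) hz (fun {i} m => h i m m.2) (fun m m' => add m m') x

theorem tpow_succ_cons {C : T → Prop} {n : ℕ} (cons : ∀ a, ∀ y ∈ tpow K A n, C (ιT a * y))
    (add : ∀ x y, C x → C y → C (x + y)) {x : T} (hx : x ∈ tpow K A ((n + 1 : ℕ) : ℤ)) : C x := by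
  rw [tpow_natCast, pow_succ'] at hx
  refine Submodule.mul_induction_on hx ?_ add
  rintro _ ⟨a, rfl⟩ y hy
  exact cons a y hy

theorem tpow_succ_snoc {C : T → Prop} {n : ℕ} (snoc : ∀ c, ∀ y ∈ tpow K A n, C (y * ιT c))
    (add : ∀ x y, C x → C y → C (x + y)) {x : T} (hx : x ∈ tpow K A ((n + 1 : ℕ) : ℤ)) : C x := by
  rw [tpow_natCast, pow_succ] at hx
  refine Submodule.mul_induction_on hx ?_ add
  rintro y hy _ ⟨a, rfl⟩
  exact snoc a y hy

theorem tproj_zero_snoc (x : T) (c : A) : tproj 0 (x * ιT c) = 0 := by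
  induction x using induction_left with
  | one => rw [one_mul, ← mul_one (ιT c), tproj_zero_cons]
  | cons a x _ => rw [mul_assoc, tproj_zero_cons]
  | add x y hx hy => rw [add_mul, map_add, hx, hy, add_zero]
  | smul r x hx => rw [smul_mul_assoc, map_smul, hx, smul_zero]

end Module

variable {A : Type*} [NonUnitalRing A] [Module K A] [IsScalarTower K A A] [SMulCommClass K A A]

/-- Multiplication of the last letter by `c` on the right, with the sign `(-1)^(N - 1)` on words
with `N` letters (zero on the empty word). -/
def mulLast (c : A) : Module.End K T :=
  conv (twist 1).toLinearMap (mulMap K A) ∘ₗ rm (ιT c)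

theorem bar_snoc (x : T) (c : A) : bar K A (x * ιT c) = bar K A x * ιT c + mulLast c x :=
  ins_snoc 1 (mulMap K A) x c

@[simp] theorem mulLast_one (c : A) : mulLast c (1 : T) = 0 := by
  have h := bar_snoc (1 : T) c
  have h' := bar_cons c (1 : T)
  rw [mul_one, mulFirst_one, ins_mulMap_one, mul_zero, sub_zero] at h'
  rw [one_mul, h', ins_mulMap_one, zero_mul, zero_add] at h
  exact h.symm

theorem mulLast_snoc (x : T) (d c : A) : mulLast c (x * ιT d) = twist 1 x * ιT (d * c) := by
  have h1 : (mulMap K A ∘ₗ rm (ιT c)) ∘ₗ rm (ιT d) = rm (ιT (d * c)) ∘ₗ tproj 0 := by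
    refine ext_tpow fun n x hx => ?_
    simp only [LinearMap.comp_apply, rm_apply]
    by_cases h : n = 0
    · subst h
      rw [tproj_same hx]
      rw [tpow_natCast, pow_zero, Submodule.mem_one] at hx
      obtain ⟨r, rfl⟩ := hx
      simp [Algebra.algebraMap_eq_smul_one, mulMap_two]
    · rw [tproj_ne hx h, mulMap_ne (mul_snoc_mem c (mul_snoc_mem d hx)) (by omega), zero_mul]
  rw [mulLast, LinearMap.comp_apply, rm_apply, conv_snoc, conv_snoc, h1, conv_rm, conv_tproj_right]
  simp [mulMap_one, mulMap_ι]

theorem mulLast_lm_snoc (x : T) (a d c : A) :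
    mulLast c (ιT a * (x * ιT d)) = -(ιT a * mulLast c (x * ιT d)) := by
  rw [← mul_assoc, mulLast_snoc, mulLast_snoc, map_mul, twist_ι, sgn_one]
  simp [mul_assoc]

theorem letter_cons_snoc (a c : A) (x : T) : letter (ιT a * (x * ιT c)) = 0 := by
  induction x using induction_left with
  | one => rw [one_mul, ← mul_one (ιT c), letter_cons_cons]
  | cons b x _ => rw [mul_assoc, letter_cons_cons]
  | add x y hx hy => rw [add_mul, mul_add, map_add, hx, hy, add_zero]
  | smul r x hx => rw [smul_mul_assoc, mul_smul_comm, map_smul, hx, smul_zero]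

/-- The linear map `x c ↦ B(x, c)` splitting off the last letter (zero on the empty word). -/
def snocLift {M : Type*} [AddCommGroup M] [Module K M] (B : T →ₗ[K] A →ₗ[K] M) : T →ₗ[K] M :=
  TensorProduct.lift B ∘ₗ TensorProduct.map LinearMap.id letter ∘ₗ deconc

section

variable {M : Type*} [AddCommGroup M] [Module K M] (B : TensorAlgebra K A →ₗ[K] A →ₗ[K] M)

@[simp] theorem snocLift_one : snocLift B (1 : T) = 0 := by simp [snocLift, deconc_one]

theorem snocLift_cons (a : A) (x : T) :
    snocLift B (ιT a * x) = B 1 (letter (ιT a * x)) + snocLift (B ∘ₗ lm (ιT a)) x := by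
  simp only [snocLift, LinearMap.comp_apply, deconc_cons, map_add]
  congr 1
  generalize deconc x = d
  induction d with
  | zero => simp
  | add x y hx hy => simp only [mul_add, map_add, hx, hy]
  | tmul x y => simp

@[simp] theorem snocLift_snoc (x : T) (c : A) : snocLift B (x * ιT c) = B x c := by
  induction x using induction_left generalizing B with
  | one =>
    have := snocLift_cons B c 1
    rwa [mul_one, letter_ι, snocLift_one, add_zero, ← one_mul (ιT c)] at this
  | cons a x ih => rw [mul_assoc, snocLift_cons, letter_cons_snoc, map_zero, zero_add, ih]; rfl
  | add x y hx hy => simp only [add_mul, map_add, hx, hy, LinearMap.add_apply]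
  | smul r x hx => simp only [smul_mul_assoc, map_smul, hx, LinearMap.smul_apply]

end

theorem lastToCoeff_snoc {P : Type*} [CommRing P] [Algebra K P] (π : A →ₙₐ[K] P) (x : T) (c : A) :
    lastToCoeff π (x * ιT c) = π c ⊗ₜ twist 1 x := by
  induction x using induction_left with
  | one =>
    rw [one_mul, ← mul_one (ιT c), lastToCoeff_cons, lastToCoeff_one, map_zero, sub_zero, tproj_one,
      TensorProduct.smul_tmul', smul_eq_mul, mul_one, map_one]
  | cons a x ih =>
    rw [mul_assoc, lastToCoeff_cons, tproj_zero_snoc, TensorProduct.tmul_zero, smul_zero, zero_sub,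
      ih, cons_tmul, map_mul, twist_ι, sgn_one]
    simp [TensorProduct.tmul_neg]
  | add x y hx hy => simp only [add_mul, map_add, hx, hy, TensorProduct.tmul_add]
  | smul r x hx => simp only [smul_mul_assoc, map_smul, hx, TensorProduct.tmul_smul]

end Last

/-! ### A contraction of long words compatible with both outer letters. -/

section LocalHomotopy

variable {K : Type*} [Field K] {V : Type*} [AddCommGroup V] [Module K V]
variable {A : Type*} [NonUnitalCommRing A] [Module K A] [IsScalarTower K A A]
  [SMulCommClass K A A]
variable {σ : Type*} [Fintype σ] (e : Module.Basis σ K V) (I : AugIdeal K V A)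

/-- The map `x c ↦ c ⊗ x` which makes the last letter of a word into a coefficient. -/
def takeLast : T →ₗ[K] S ⊗[K] T :=
  snocLift ((TensorProduct.mk K S T).flip.compl₂ (I.incl : A →ₗ[K] S))

/-- The map `f ⊗ x ↦ x f̄` which makes a coefficient into the last letter of a word. -/
def putLast : (S ⊗[K] T) →ₗ[K] T :=
  TensorProduct.lift ((LinearMap.mul K T).flip ∘ₗ ιT ∘ₗ I.redu)

@[simp] theorem takeLast_one : takeLast I 1 = 0 := snocLift_one _

@[simp] theorem takeLast_snoc (x : T) (c : A) : takeLast I (x * ιT c) = I.incl c ⊗ₜ x := by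
  simp [takeLast]

@[simp] theorem putLast_tmul (f : S) (x : T) : putLast I (f ⊗ₜ x) = x * ιT (I.redu f) := by
  simp [putLast]

theorem putLast_cons (a : A) (z : S ⊗[K] T) :
    putLast I (cons S a z) = ιT a * putLast I z := by
  induction z using TensorProduct.induction_on with
  | zero => simp
  | add x y hx hy => simp only [map_add, hx, hy, mul_add]
  | tmul f x => simp [mul_assoc]

theorem incl_smul_tmul (c : A) (f : S) (x : T) :
    I.incl c • (f ⊗ₜ[K] x) = I.incl (I.redu (I.incl c * f)) ⊗ₜ x := by
  rw [I.incl_redu, map_mul, I.symAug_incl, zero_mul, map_zero, sub_zero, TensorProduct.smul_tmul',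
    smul_eq_mul]

/-- Once the last letter is a coefficient in `S(V)`, the product of the last two letters multiplies
the last remaining letter into the coefficient. This is the bar complex with coefficients for the
identity of `S(V)`. -/
theorem takeLast_bar (x : T) :
    takeLast I (bar K A x) = barP (I.restr (AlgHom.id K S)) (takeLast I x) := by
  induction x using induction_right with
  | one => simp [ins_mulMap_one]
  | add x y hx hy => simp only [map_add, hx, hy]
  | smul r x hx => rw [map_smul, map_smul, map_smul, hx, LinearMap.map_smul_of_tower]
  | snoc y c ih =>
    clear ih
    rw [bar_snoc, map_add, takeLast_snoc, takeLast_snoc, barP_tmul]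
    congr 1
    induction y using induction_right with
    | one => simp [lastToCoeff_one]
    | add x y hx hy => simp only [map_add, hx, hy, smul_add]
    | smul r x hx => rw [map_smul, map_smul, map_smul, hx, smul_comm]
    | snoc z d _ =>
      rw [mulLast_snoc, takeLast_snoc, lastToCoeff_snoc, TensorProduct.smul_tmul', map_mul, mul_comm]
      rfl

/-- `putLast` drops the constant term of a coefficient, so it is compatible with the differentials
only on coefficients in the augmentation ideal; the factor `I.incl c` ensures this. -/
theorem putLast_barP (c : A) (z : S ⊗[K] T) :
    putLast I (barP (I.restr (AlgHom.id K S)) (I.incl c • z)) =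
      bar K A (putLast I (I.incl c • z)) := by
  induction z using TensorProduct.induction_on with
  | zero => simp
  | add x y hx hy => simp only [smul_add, map_add, hx, hy]
  | tmul f x =>
    rw [incl_smul_tmul]
    generalize I.redu (I.incl c * f) = c
    rw [barP_tmul, map_add, putLast_tmul, putLast_tmul, I.redu_incl, bar_snoc]
    congr 1
    induction x using induction_right with
    | one => simp [lastToCoeff_one]
    | add x y hx hy => simp only [map_add, hx, hy, smul_add]
    | smul r x hx => rw [map_smul (lastToCoeff _), smul_comm, (putLast I).map_smul, (mulLast c).map_smul, hx]
    | snoc z d _ =>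
      rw [mulLast_snoc, lastToCoeff_snoc, TensorProduct.smul_tmul', smul_eq_mul]
      change putLast I ((I.incl c * I.incl d) ⊗ₜ _) = _
      rw [← map_mul, putLast_tmul, I.redu_incl, mul_comm]

theorem putLast_mul (c d : A) {k : ℤ} {z : S ⊗[K] T} (hz : z ∈ barDeg A S k) :
    mulLast d (putLast I (I.incl c • z)) = sgn K k • putLast I (I.incl (c * d) • z) := by
  refine barDeg_le (N := LinearMap.eqLocus
    (mulLast d ∘ₗ putLast I ∘ₗ DistribSMul.toLinearMap K (S ⊗[K] T) (I.incl c))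
    (sgn K k • putLast I ∘ₗ DistribSMul.toLinearMap K (S ⊗[K] T) (I.incl (c * d)))) ?_ hz
  intro f x hx
  change mulLast d (putLast I (I.incl c • (f ⊗ₜ[K] x))) =
    sgn K k • putLast I (I.incl (c * d) • (f ⊗ₜ[K] x))
  rw [incl_smul_tmul, incl_smul_tmul, putLast_tmul, putLast_tmul, mulLast_snoc, twist_apply 1 hx,
    one_mul, I.redu_incl, I.redu_incl, smul_mul_assoc, I.redu_mul, I.redu_mul]
  rw [add_mul, mul_right_comm, smul_mul_assoc]

theorem mulLast_lm_putLast (a d : A) (z : S ⊗[K] T) :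
    mulLast d (ιT a * putLast I z) = -(ιT a * mulLast d (putLast I z)) := by
  induction z using TensorProduct.induction_on with
  | zero => simp
  | add x y hx hy => simp only [map_add, mul_add, neg_add, hx, hy]
  | tmul f x => rw [putLast_tmul, mulLast_lm_snoc]

theorem putLast_mem {k : ℕ} {z : S ⊗[K] T} (hz : z ∈ barDeg A S k) :
    putLast I z ∈ tpow K A ((k + 1 : ℕ) : ℤ) :=
  barDeg_le (N := (tpow K A ((k + 1 : ℕ) : ℤ)).comap (putLast I))
    (fun f x hx => by
      rw [Submodule.mem_comap, putLast_tmul]; exact mul_snoc_mem _ hx) hz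

theorem extPow_eq_bot [FiniteDimensional K V] {q : ℕ} (hq : Module.finrank K V < q) :
    ⋀[K]^q V = ⊥ := by
  rw [← Submodule.finrank_eq_zero, exteriorPower.finrank_eq, Nat.choose_eq_zero_of_lt hq]

theorem kosDeg_eq_zero (e : Module.Basis σ K V) {P : Type*} [CommRing P] [Algebra K P] {q : ℕ} (hq : Fintype.card σ < q)
    {z : Kos K V σ P} (hz : z ∈ kosDeg K V σ P q) : z = 0 := by
  have := Module.Finite.of_basis e
  refine kosDeg_le (N := ⊥) (fun f w hw => ?_) hz
  rw [extPow_eq_bot (by rwa [Module.finrank_eq_card_basis e]), Submodule.mem_bot] at hw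
  rw [hw, TensorProduct.tmul_zero]; exact zero_mem _

variable [CharZero K]

/-- The homotopy on `T(A)` with the last letter as a coefficient. -/
def rhtpy : Module.End K T :=
  putLast I ∘ₗ (I.koszul e (AlgHom.id K S)).t.restrictScalars K ∘ₗ takeLast I

theorem rhtpy_snoc (y : T) (c : A) : rhtpy e I (y * ιT c) =
    putLast I (I.incl c • (I.koszul e (AlgHom.id K S)).t (1 ⊗ₜ y)) := by
  rw [← map_smul, TensorProduct.smul_tmul', smul_eq_mul, mul_one]
  simp [rhtpy]

@[simp] theorem rhtpy_one : rhtpy e I 1 = 0 := by simp [rhtpy]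

/-- Above dimension `dim V` the Koszul complex is zero, so `γ` vanishes and `barP_t` over `S(V)`
reads `b t + t b = -1`. -/
theorem bar_rhtpy {m : ℕ} (hm : Fintype.card σ < m) {y : T} (hy : y ∈ tpow K A m) (c : A) :
    bar K A (rhtpy e I (y * ιT c)) + rhtpy e I (bar K A (y * ιT c)) = -(y * ιT c) := by
  have h := (I.koszul e (AlgHom.id K S)).barP_t (I.incl c ⊗ₜ y)
  rw [kosDeg_eq_zero e hm (γ_mem e _ I (I.incl c) m y hy), map_zero, zero_sub] at h
  have h1 := congrArg (putLast I) h
  have h2 : I.incl c ⊗ₜ[K] y = I.incl c • ((1 : S) ⊗ₜ[K] y) := by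
    rw [TensorProduct.smul_tmul', smul_eq_mul, mul_one]
  rw [map_add, map_neg, putLast_tmul, I.redu_incl, ← takeLast_snoc, ← takeLast_bar,
    takeLast_snoc, h2, map_smul, putLast_barP, ← rhtpy_snoc] at h1
  exact h1

/-- In the recursion for `t` the only obstruction to compatibility with a new first letter is the
term `r γ`, and it vanishes on words this long. -/
theorem rhtpy_cons {m : ℕ} (hm : Fintype.card σ ≤ m) {y : T} (hy : y ∈ tpow K A m) (a c : A) :
    rhtpy e I (ιT a * (y * ιT c)) = -(ιT a * rhtpy e I (y * ιT c)) := by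
  rw [← mul_assoc, rhtpy_snoc, rhtpy_snoc, ← cons_tmul, Comparison.t_cons, cons_tmul,
    kosDeg_eq_zero e (Nat.lt_succ_of_le hm) (γ_mem e _ I 1 (m + 1) _ (cons_mem m a hy)), map_zero,
    neg_zero, zero_sub, smul_neg, map_neg, ← map_smul, putLast_cons]

/-- `t` is linear over `S(V)` and the last letter is a coefficient. The sign appears because `t`
lengthens the word by one letter. -/
theorem mulLast_rhtpy {m : ℕ} {y : T} (hy : y ∈ tpow K A m) (c d : A) :
    mulLast d (rhtpy e I (y * ιT c)) = -rhtpy e I (mulLast d (y * ιT c)) := by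
  rw [mulLast_snoc, twist_apply 1 hy, rhtpy_snoc, putLast_mul I c d (t_mem e _ I 1 m y hy),
    smul_mul_assoc, (rhtpy e I).map_smul, rhtpy_snoc, Nat.cast_succ, sgn_add, sgn_one, one_mul]
  simp

/-- The homotopy on words with at least `dim V + 3` letters which is linear with respect to the
first and the last letter. -/
def lhtpy : Module.End K T := conv (tproj 1) (rhtpy e I)

theorem lhtpy_cons (a : A) (y : T) : lhtpy e I (ιT a * y) = ιT a * rhtpy e I y := by
  rw [lhtpy, conv_cons, tproj_one_one, zero_mul, zero_add, tproj_succ_lm 0, conv_lm,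
    conv_tproj_left]
  rfl

@[simp] theorem lhtpy_one : lhtpy e I 1 = 0 := by simp [lhtpy]

theorem rhtpy_mem : rhtpy e I ∈ degHom K A (-1) := by
  intro n x hx
  refine mem_tpow_of_eq (p := ((n + 1 : ℕ) : ℤ)) ?_ (by push_cast; ring)
  cases n with
  | zero =>
    rw [tpow_natCast, pow_zero, Submodule.mem_one] at hx
    obtain ⟨r, rfl⟩ := hx
    simp [Algebra.algebraMap_eq_smul_one]
  | succ m =>
    refine tpow_succ_snoc (C := fun x => rhtpy e I x ∈ tpow K A ((m + 1 + 1 : ℕ) : ℤ)) ?_ ?_ hx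
    · intro c y hy
      rw [rhtpy_snoc]
      exact putLast_mem I (Submodule.smul_mem _ _ (t_mem e _ I 1 m y hy))
    · intro x y hx hy; rw [map_add]; exact add_mem hx hy

theorem lhtpy_mem : lhtpy e I ∈ degHom K A (-1) :=
  conv_mem (tproj_mem 1) (rhtpy_mem e I) (zero_add _)

theorem lhtpy_mulFirst (a : A) (x : T) :
    lhtpy e I (mulFirst a x) = mulFirst a (lhtpy e I x) := by
  induction x using induction_left with
  | one => simp
  | cons c x _ => simp only [mulFirst_cons, lhtpy_cons]
  | add x y hx hy => simp only [map_add, hx, hy]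
  | smul r x hx => simp only [map_smul, hx]

theorem lhtpy_mulLast {n : ℕ} (hn : 2 ≤ n) {x : T} (hx : x ∈ tpow K A n) (d : A) :
    lhtpy e I (mulLast d x) = -mulLast d (lhtpy e I x) := by
  obtain ⟨m, rfl⟩ : ∃ m, n = m + 1 + 1 := ⟨n - 2, by omega⟩
  refine tpow_succ_cons (C := fun x => lhtpy e I (mulLast d x) = -mulLast d (lhtpy e I x))
    (fun a y hy => ?_) (fun x y hx hy => by simp only [map_add, neg_add, hx, hy]) hx
  refine tpow_succ_snoc (C := fun y => lhtpy e I (mulLast d (ιT a * y)) =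
    -mulLast d (lhtpy e I (ιT a * y)))
    (fun c y hy => ?_) (fun x y hx hy => by simp only [mul_add, map_add, neg_add, hx, hy]) hy
  rw [mulLast_lm_snoc, map_neg, lhtpy_cons, lhtpy_cons, rhtpy_snoc, mulLast_lm_putLast,
    ← rhtpy_snoc, mulLast_rhtpy e I hy]
  simp

/-- Passing the untouched first letter reverses the sign in `bar_rhtpy`, turning `-1` into `1`. The
product of the first two letters is respected because of `rhtpy_cons`. -/
theorem bar_lhtpy {n : ℕ} (hn : Fintype.card σ + 3 ≤ n) {x : T} (hx : x ∈ tpow K A n) :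
    bar K A (lhtpy e I x) + lhtpy e I (bar K A x) = x := by
  -- Three letters play special roles: the first is kept fixed, the second may be multiplied into
  -- it, and the last is the coefficient. At least `dim V` letters must remain between them.
  obtain ⟨m, rfl⟩ : ∃ m, n = m + 1 + 1 + 1 := ⟨n - 3, by omega⟩
  refine tpow_succ_cons (C := fun x => bar K A (lhtpy e I x) + lhtpy e I (bar K A x) = x)
    (fun a y hy => ?_) (fun x y hx hy => by
      simp only [map_add]; linear_combination (norm := abel) hx + hy) hx
  refine tpow_succ_cons (C := fun y => bar K A (lhtpy e I (ιT a * y)) +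
    lhtpy e I (bar K A (ιT a * y)) = ιT a * y)
    (fun a' y hy => ?_) (fun x y hx hy => by
      simp only [mul_add, map_add]; linear_combination (norm := abel) hx + hy) hy
  refine tpow_succ_snoc (C := fun y => bar K A (lhtpy e I (ιT a * (ιT a' * y))) +
    lhtpy e I (bar K A (ιT a * (ιT a' * y))) = ιT a * (ιT a' * y))
    (fun c z hz => ?_) (fun x y hx hy => by
      simp only [mul_add, map_add]; linear_combination (norm := abel) hx + hy) hy
  have h1 := congrArg (fun w => ιT a * w) (bar_rhtpy e I (by omega) (cons_mem m a' hz) c)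
  simp only [mul_add, mul_neg, mul_assoc] at h1
  have h2 := congrArg (mulFirst a) (rhtpy_cons e I (by omega) hz a' c)
  rw [map_neg, mulFirst_cons] at h2
  rw [lhtpy_cons, bar_cons, bar_cons (K := K) a, map_sub, mulFirst_cons, lhtpy_cons, lhtpy_cons]
  linear_combination (norm := abel) h2 - h1

end LocalHomotopy

/-! ### Lowest components of convolutions and truncation. -/

section Leading

variable {K : Type*} [Field K] {A : Type*} [AddCommGroup A] [Module K A]

theorem conv_of_vanish_right {g : Module.End K T} {k : ℕ}
    (hg : ∀ j < k, ∀ x ∈ tpow K A j, g x = 0) (f : Module.End K T) {n : ℕ} (hn : n ≤ k) {x : T}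
    (hx : x ∈ tpow K A n) : conv f g x = f 1 * g x := by
  revert f hn
  refine tpow_induction (C := fun n x => ∀ f : Module.End K T, n ≤ k → conv f g x = f 1 * g x ∧
    x ∈ tpow K A n) ?_ ?_ ?_ ?_ n x hx |> fun h f hn => (h f hn).1
  · intro f _; exact ⟨conv_one f g, one_mem_tpow⟩
  · intro n a x hx ih f hn
    have h := ih (f ∘ₗ lm (ιT a)) (by omega)
    rw [conv_cons, h.1, hg n (by omega) x h.2, mul_zero, add_zero]
    exact ⟨rfl, cons_mem n a hx⟩
  · intro n x y hx hy f hn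
    rw [map_add, (hx f hn).1, (hy f hn).1, map_add, mul_add]
    exact ⟨rfl, add_mem (hx f hn).2 (hy f hn).2⟩
  · intro n r x hx f hn
    rw [map_smul, (hx f hn).1, map_smul, mul_smul_comm]
    exact ⟨rfl, Submodule.smul_mem _ _ (hx f hn).2⟩

theorem conv_of_vanish_left {f : Module.End K T} {k : ℕ}
    (hf : ∀ j < k, ∀ x ∈ tpow K A j, f x = 0) (g : Module.End K T) {n : ℕ} (hn : n ≤ k) {x : T}
    (hx : x ∈ tpow K A n) : conv f g x = f x * g 1 := by
  revert g hn
  refine tpow_induction_right (C := fun n x => ∀ g : Module.End K T, n ≤ k →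
    conv f g x = f x * g 1 ∧ x ∈ tpow K A n) ?_ ?_ ?_ ?_ n x hx |> fun h f hn => (h f hn).1
  · intro g _; exact ⟨conv_one f g, one_mem_tpow⟩
  · intro n x b hx ih g hn
    have h := ih (g ∘ₗ rm (ιT b)) (by omega)
    rw [conv_snoc, h.1, hf n (by omega) x h.2, zero_mul, add_zero]
    exact ⟨rfl, mul_snoc_mem b hx⟩
  · intro n x y hx hy g hn
    rw [map_add, (hx g hn).1, (hy g hn).1, map_add, add_mul]
    exact ⟨rfl, add_mem (hx g hn).2 (hy g hn).2⟩
  · intro n r x hx g hn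
    rw [map_smul, (hx g hn).1, map_smul, smul_mul_assoc]
    exact ⟨rfl, Submodule.smul_mem _ _ (hx g hn).2⟩

/-- In a factorization of a short word the middle factor must be the whole word, since the map
vanishes on anything shorter; `f` and `g` only see the empty word. This covers both i and its
inverse, so a map and its operator have the same lowest component. -/
theorem conv_conv_of_vanish {Ψ : Module.End K T} {k : ℕ}
    (h : ∀ j < k, ∀ x ∈ tpow K A j, Ψ x = 0) {f g : Module.End K T} (hf : f 1 = 1) (hg : g 1 = 1)
    {n : ℕ} (hn : n ≤ k) {x : T} (hx : x ∈ tpow K A n) : conv f (conv Ψ g) x = Ψ x := by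
  have h1 : ∀ j ≤ k, ∀ x ∈ tpow K A j, conv Ψ g x = Ψ x := fun j hj x hx => by
    rw [conv_of_vanish_left h g hj hx, hg, mul_one]
  rw [conv_of_vanish_right (fun j hj x hx => by rw [h1 j hj.le x hx, h j hj x hx]) f hn hx, hf,
    one_mul, h1 n hn x hx]

theorem ins_of_vanish (i : ℤ) {Ψ : Module.End K T} {k : ℕ}
    (h : ∀ j < k, ∀ x ∈ tpow K A j, Ψ x = 0) {n : ℕ} (hn : n ≤ k) {x : T}
    (hx : x ∈ tpow K A n) : ins i Ψ x = Ψ x :=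
  conv_conv_of_vanish h (map_one (twist i)) rfl hn hx

theorem insEquiv_symm_of_vanish (i : ℤ) {F : Module.End K T} {k : ℕ}
    (h : ∀ j < k, ∀ x ∈ tpow K A j, F x = 0) {n : ℕ} (hn : n ≤ k) {x : T}
    (hx : x ∈ tpow K A n) : (insEquiv i).symm F x = F x :=
  conv_conv_of_vanish h (untwist_one i) (untwist_one 0) hn hx

/-- The projection of `T(A)` onto the components `A^{⊗m}` with `m > N`. -/
def truncGT (N : ℕ) : Module.End K T := LinearMap.id - ∑ m ∈ Finset.range (N + 1), tproj m

theorem truncGT_of_le {N m : ℕ} (h : m ≤ N) {x : T} (hx : x ∈ tpow K A m) : truncGT N x = 0 := by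
  rw [truncGT, LinearMap.sub_apply, LinearMap.sum_apply, Finset.sum_eq_single m
    (fun j _ hj => tproj_ne hx hj.symm) (fun hm => absurd (Finset.mem_range.mpr (by omega)) hm),
    tproj_same hx]
  simp

theorem truncGT_of_lt {N m : ℕ} (h : N < m) {x : T} (hx : x ∈ tpow K A m) : truncGT N x = x := by
  rw [truncGT, LinearMap.sub_apply, LinearMap.sum_apply, Finset.sum_eq_zero fun j hj =>
    tproj_ne hx (by rw [Finset.mem_range] at hj; omega)]
  simp

theorem truncGT_mem (N : ℕ) : truncGT N ∈ degHom K A 0 :=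
  sub_mem id_mem (sum_mem fun m _ => tproj_mem m)

end Leading

/-! ### The differential evaluated on long words. -/

section Tail

variable {K : Type*} [Field K] {A : Type*} [NonUnitalRing A] [Module K A] [IsScalarTower K A A]
  [SMulCommClass K A A]

/-- The bar differential shortens words, so the commutator with it preserves vanishing on short
words, and so does the inverse of i. -/
theorem diff_of_vanish (i : ℤ) {Φ : Module.End K T} {N : ℕ}
    (h : ∀ j ≤ N, ∀ x ∈ tpow K A j, Φ x = 0) : ∀ j ≤ N, ∀ x ∈ tpow K A j, diff K A i Φ x = 0 := by
  have h1 : ∀ j < N + 1, ∀ x ∈ tpow K A j, ins i Φ x = 0 := fun j hj x hx => by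
    rw [ins_of_vanish i (k := N + 1) (fun j hj => h j (by omega)) hj.le hx, h j (by omega) x hx]
  have hb : bar K A ∈ degHom K A 1 := ins_mem (mulMap_mem .directProduct)
  have h2 : ∀ j < N + 1, ∀ x ∈ tpow K A j, comm 1 i (bar K A) (ins i Φ) x = 0 := by
    intro j hj x hx
    have h3 : ins i Φ (bar K A x) = 0 := by
      cases j with
      | zero =>
        have := hb 0 x hx
        rw [tpow_of_neg (by norm_num), Submodule.mem_bot] at this
        rw [this, map_zero]
      | succ j =>
        exact h1 j (by omega) _ (mem_tpow_of_eq (hb _ x hx) (by push_cast; ring))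
    simp [comm_apply, h1 j hj x hx, h3]
  intro j hj x hx
  have : diff K A i Φ = (insEquiv (1 + i)).symm (comm 1 i (bar K A) (ins i Φ)) := rfl
  rw [this, insEquiv_symm_of_vanish (1 + i) h2 (by omega) hx, h2 j (by omega) x hx]

theorem mulMap_of_ne {p : ℤ} (hp : p ≠ 2) {x : T} (hx : x ∈ tpow K A p) : mulMap K A x = 0 := by
  rcases lt_or_ge p 0 with h | h
  · rw [tpow_of_neg h, Submodule.mem_bot] at hx; simp [hx]
  · lift p to ℕ using h
    exact mulMap_ne hx (by omega)

/-- Blocks that do not start at the first letter of `y` are unaffected by multiplication into that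
letter and cancel. Only the block that is the whole word remains. -/
theorem conv_twist_mulFirst (i : ℤ) (Ψ : Module.End K T) (a e : A) {m : ℕ} {y : T}
    (hy : y ∈ tpow K A ((m + 1 : ℕ) : ℤ)) :
    mulFirst a (conv (twist i).toLinearMap Ψ (y * ιT e)) -
      conv (twist i).toLinearMap Ψ (mulFirst a y * ιT e) =
    mulFirst a (Ψ (y * ιT e)) - Ψ (mulFirst a y * ιT e) := by
  refine tpow_succ_cons (C := fun y => mulFirst a (conv (twist i).toLinearMap Ψ (y * ιT e)) -
      conv (twist i).toLinearMap Ψ (mulFirst a y * ιT e) =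
    mulFirst a (Ψ (y * ιT e)) - Ψ (mulFirst a y * ιT e)) (fun c z _ => ?_) (fun x y hx hy => ?_) hy
  · rw [mulFirst_cons, mul_assoc, mul_assoc, conv_twist_cons, conv_twist_cons, map_add, map_smul,
      mulFirst_cons]
    abel
  · simp only [add_mul, map_add]
    linear_combination (norm := abel) hx + hy

/-- The mirror image at the right end: initial blocks that stop before the last letter cancel, now
with the sign of the degree of `Ψ`. -/
theorem mulLast_conv_id {i : ℤ} {Ψ : Module.End K T} (hΨ : Ψ ∈ degHom K A i) (a e : A) {m : ℕ}
    {y : T} (hy : y ∈ tpow K A ((m + 1 : ℕ) : ℤ)) :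
    mulLast e (conv Ψ LinearMap.id (ιT a * y)) +
      sgn K i • conv Ψ LinearMap.id (ιT a * mulLast e y) =
    mulLast e (Ψ (ιT a * y)) + sgn K i • Ψ (ιT a * mulLast e y) := by
  refine tpow_succ_snoc (C := fun y => mulLast e (conv Ψ LinearMap.id (ιT a * y)) +
      sgn K i • conv Ψ LinearMap.id (ιT a * mulLast e y) =
    mulLast e (Ψ (ιT a * y)) + sgn K i • Ψ (ιT a * mulLast e y))
    (fun c z hz => ?_) (fun x y hx hy => ?_) hy
  · have h1 := conv_mem hΨ id_mem (add_zero i) _ _ (cons_mem m a hz)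
    have h2 : sgn K (((m + 1 : ℕ) : ℤ) - i) = -(sgn K i * sgn K m) := by
      rw [sub_eq_add_neg, sgn_add, sgn_neg, Nat.cast_succ, sgn_add, sgn_one]; ring
    rw [mulLast_snoc, twist_apply 1 hz, ← mul_assoc, conv_id_snoc, map_add, mulLast_snoc,
      twist_apply 1 h1, smul_mul_assoc, smul_mul_assoc, mul_smul_comm, map_smul, map_smul,
      ← mul_assoc,
      conv_id_snoc, one_mul, one_mul, h2]
    simp only [smul_add, neg_smul, smul_smul]
    abel
  · simp only [mul_add, map_add, smul_add]
    linear_combination (norm := abel) hx + hy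

theorem bar_cons_snoc (a e : A) {m : ℕ} {y : T} (hy : y ∈ tpow K A ((m + 1 : ℕ) : ℤ)) :
    bar K A (ιT a * y * ιT e) =
      mulFirst a y * ιT e - ιT a * bar K A y * ιT e - ιT a * mulLast e y := by
  have h : mulFirst a (y * ιT e) = mulFirst a y * ιT e := by
    refine tpow_succ_cons (C := fun y => mulFirst a (y * ιT e) = mulFirst a y * ιT e)
      (fun c z _ => ?_) (fun x y hx hy => ?_) hy
    · rw [mul_assoc, mulFirst_cons, mulFirst_cons, mul_assoc]
    · simp only [add_mul, map_add, hx, hy]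
  rw [mul_assoc, bar_cons, h, bar_snoc]
  simp only [mul_add, mul_assoc]
  abel

/-- The differential on long words, in terms of the bar differential of the inner letters. -/
theorem diff_cons_snoc {i : ℤ} {Ψ : Module.End K T} (hΨ : Ψ ∈ degHom K A i) (a e : A) {m : ℕ}
    (hmi : ((m + 1 : ℕ) : ℤ) ≠ i) {y : T} (hy : y ∈ tpow K A ((m + 1 : ℕ) : ℤ)) :
    diff K A i Ψ (ιT a * y * ιT e) = bar K A (Ψ (ιT a * y * ιT e)) -
      sgn K i • Ψ (bar K A (ιT a * y * ιT e)) + sgn K i • mulFirst a (Ψ (y * ιT e)) +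
        mulLast e (Ψ (ιT a * y)) := by
  have h0 := cons_snoc_formula (1 + i) (diff K A i Ψ) a e y
  have h1 := comp_formula 1 i (mulMap K A) Ψ a e y
  have h2 := comp_formula i 1 Ψ (mulMap K A) a e y
  -- The product would see this word only if the inner part `ins i Ψ y` had no letters, that is, if
  -- `m + 1 = i`.
  have h3 : mulMap K A (ιT a * ins i Ψ y * ιT e) = 0 :=
    mulMap_of_ne (p := 1 + (((m + 1 : ℕ) : ℤ) - i) + 1) (by omega)
      (mul_mem_tpow (mul_mem_tpow (ι_mem_tpow a) (ins_mem hΨ _ _ hy)) (ι_mem_tpow e))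
  have h4 : mulMap K A (ιT a * y * ιT e) = 0 :=
    mulMap_ne (mul_snoc_mem e (cons_mem _ a hy)) (by omega)
  have h5 := conv_twist_mulFirst i Ψ a e hy
  have h6 := mulLast_conv_id hΨ a e hy
  have h7 := congrArg Ψ (bar_cons_snoc a e hy)
  rw [map_sub, map_sub] at h7
  rw [ins_diff] at h0
  simp only [comm_apply, LinearMap.sub_apply, LinearMap.smul_apply, LinearMap.comp_apply, one_mul,
    sgn_add, sgn_one, mul_one, mul_sub, sub_mul, mul_smul_comm, smul_mul_assoc, neg_smul,
    mul_neg, neg_mul] at h0 h1 h2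
  rw [h3] at h1
  rw [h4] at h2
  have e1 : ∀ z, conv (mulMap K A) LinearMap.id (ιT a * z) = mulFirst a z := fun z => rfl
  have e2 : ∀ z, conv (twist 1).toLinearMap (mulMap K A) (z * ιT e) = mulLast e z := fun z => rfl
  rw [e1, e2] at h1
  rw [e1, e2] at h2
  simp only [map_zero, smul_zero, add_zero, zero_add] at h1 h2
  rw [h7, h0]
  linear_combination (norm := module) h1 - sgn K i • h2 + sgn K i • h5 + h6

end Tail

/-! ### Removing infinite tails of cochains. -/

section TailRemoval

variable {K : Type*} [Field K] [CharZero K] {V : Type*} [AddCommGroup V] [Module K V]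
variable {A : Type*} [NonUnitalCommRing A] [Module K A] [IsScalarTower K A A]
  [SMulCommClass K A A]
variable [FiniteDimensional K V]

/-- A map with finitely supported differential is finitely supported up to a coboundary. -/
theorem AugIdeal.exists_diff_sub_mem_finHom (I : AugIdeal K V A) (N : ℕ) {i : ℤ} {Ψ : Module.End K T} (hΨ : Ψ ∈ degHom K A (1 + i))
    (hd : diff K A (1 + i) Ψ ∈ finHom K A) :
    ∃ Φ ∈ degHom K A i, (∀ j ≤ N, ∀ x ∈ tpow K A j, Φ x = 0) ∧
      Ψ - diff K A i Φ ∈ finHom K A := by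
  obtain ⟨p, hp⟩ := hd
  set e := Module.finBasis K V
  set h := lhtpy e I with h_def
  have hdeg : h ∘ₗ Ψ ∘ₗ truncGT N ∈ degHom K A i :=
    comp_mem (lhtpy_mem e I) (comp_mem hΨ (truncGT_mem N) (add_zero _)) (by ring)
  -- Truncation makes the witness vanish on short words. The bound places words beyond the support
  -- bound `p` and beyond `N`, and leaves room for `Ψ` to shorten them by `1 + i` letters while
  -- keeping the `dim V + 3` letters that `bar_lhtpy` needs.
  refine ⟨h ∘ₗ Ψ ∘ₗ truncGT N, hdeg, fun j hj x hx => by simp [truncGT_of_le hj hx],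
    p + N + i.natAbs + Module.finrank K V + 10, fun n hn x hx => ?_⟩
  obtain ⟨m, rfl⟩ : ∃ m, n = m + 1 + 1 + 1 := ⟨n - 3, by omega⟩
  refine tpow_succ_snoc (C := fun x => (Ψ - diff K A i (h ∘ₗ Ψ ∘ₗ truncGT N)) x = 0)
    (fun c y hy => ?_) (fun x y hx hy => by rw [map_add, hx, hy, add_zero]) hx
  refine tpow_succ_cons (C := fun y => (Ψ - diff K A i (h ∘ₗ Ψ ∘ₗ truncGT N)) (y * ιT c) = 0)
    (fun a y hy => ?_) (fun x y hx hy => by rw [add_mul, map_add, hx, hy, add_zero]) hy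
  have m1 := mul_snoc_mem c hy
  have m2 := cons_mem _ a hy
  have m3 := mul_snoc_mem c m2
  have m4 : bar K A (ιT a * y * ιT c) ∈ tpow K A ((m + 1 + 1 : ℕ) : ℤ) :=
    degHom_apply (ins_mem (mulMap_mem .directProduct)) m3 (by push_cast; ring)
  have lift : ∀ {n : ℕ} {z : T}, z ∈ tpow K A n → i.natAbs + Module.finrank K V + 6 ≤ n →
      ∃ k : ℕ, Module.finrank K V + 3 ≤ k ∧ Ψ z ∈ tpow K A k := by
    intro n z hz hn
    refine ⟨(n - (1 + i)).toNat, by omega, mem_tpow_of_eq (hΨ n z hz) (by omega)⟩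
  have d1 := diff_cons_snoc hΨ a c (by omega) hy
  rw [hp _ (by omega) _ m3] at d1
  have d2 := diff_cons_snoc hdeg a c (by omega) hy
  simp only [LinearMap.comp_apply] at d2
  rw [truncGT_of_lt (by omega) m1, truncGT_of_lt (by omega) m2, truncGT_of_lt (by omega) m3,
    truncGT_of_lt (by omega) m4] at d2
  obtain ⟨k1, hk1, l1⟩ := lift m3 (by omega)
  obtain ⟨k2, hk2, l2⟩ := lift m2 (by omega)
  have b1 := bar_lhtpy e I (by simpa using hk1) l1
  have b2 := lhtpy_mulFirst e I a (Ψ (y * ιT c))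
  have b3 := lhtpy_mulLast e I (by omega) l2 c
  rw [← h_def] at b1 b2 b3
  have d3 := congrArg h d1
  simp only [map_add, map_sub, map_smul, map_zero, sgn_add, sgn_one] at d3
  rw [LinearMap.sub_apply, d2]
  -- Apply `h` to the vanishing differential of `Ψ` and add the differential of `h Ψ`. The terms at
  -- the outer letters cancel, and `b h + h b = 1` leaves `Ψ` itself.
  linear_combination (norm := module) -b1 - d3 + sgn K i • b2 - b3

end TailRemoval

/-! ### The Clifford algebra as the endomorphism algebra of Λ(V). -/

section Clifford

variable {K : Type*} [Field K] {V : Type*} [AddCommGroup V] [Module K V]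

/-- The representation of `Clif(V ⊕ V*)` on `Λ(V)`, with `V` acting by exterior multiplication and
`V*` by contraction. -/
def cliffRep : Clif K V →ₐ[K] Module.End K Λ :=
  CliffordAlgebra.lift (QuadraticForm.dualProd K V)
    ⟨wedge ∘ₗ LinearMap.snd K _ _ + contr ∘ₗ LinearMap.fst K _ _, fun x => by
      refine LinearMap.ext fun w => ?_
      have : (wedge x.2 (wedge x.2 w) : Λ) = 0 := by
        rw [wedge_apply, wedge_apply, ← mul_assoc, ExteriorAlgebra.ι_sq_zero, zero_mul]
      simp [contr_wedge, contr_contr, this, QuadraticForm.dualProd_apply,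
        Algebra.algebraMap_eq_smul_one]⟩

theorem cliffRep_ι (x : Module.Dual K V × V) :
    cliffRep (CliffordAlgebra.ι _ x) = (wedge x.2 + contr x.1 : Module.End K Λ) := by
  simp [cliffRep]

theorem extV_ι (v : V) : extV (ExteriorAlgebra.ι K v) =
    CliffordAlgebra.ι (QuadraticForm.dualProd K V) (0, v) := by
  simp [extV]

theorem extDual_ι (ξ : Module.Dual K V) : extDual (ExteriorAlgebra.ι K ξ) =
    CliffordAlgebra.ι (QuadraticForm.dualProd K V) (ξ, 0) := by
  simp [extDual]

theorem cliffRep_extV (w u : Λ) : cliffRep (extV w) u = w * u := by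
  have : cliffRep.comp extV = Algebra.lmul K Λ := by
    apply ExteriorAlgebra.hom_ext
    ext v : 1
    refine LinearMap.ext fun w => ?_
    simp [extV_ι, cliffRep_ι, wedge_apply]
  exact LinearMap.congr_fun (DFunLike.congr_fun this w) u

/-- Iterated contraction. -/
def contrExt : ΛD →ₐ[K] Module.End K Λ := cliffRep.comp extDual

theorem contrExt_ι (ξ : Module.Dual K V) : contrExt (ExteriorAlgebra.ι K ξ) = contr ξ := by
  simp [contrExt, extDual_ι, cliffRep_ι]

variable (K V) in
/-- The map `w ⊗ η ↦ w η`. -/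
def ordMap : Λ ⊗[K] ΛD →ₗ[K] Clif K V :=
  TensorProduct.lift ((LinearMap.mul K (Clif K V)).compl₁₂ extV.toLinearMap extDual.toLinearMap)

@[simp] theorem ordMap_tmul (w : Λ) (η : ΛD) : ordMap K V (w ⊗ₜ η) = extV w * extDual η := rfl

theorem cliffRep_ordMap (w : Λ) (η : ΛD) (u : Λ) :
    cliffRep (ordMap K V (w ⊗ₜ η)) u = w * contrExt η u := by
  rw [ordMap_tmul, map_mul, Module.End.mul_apply, cliffRep_extV]; rfl

theorem extDual_ι_mul_extV (ξ : Module.Dual K V) (w : Λ) :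
    extDual (ExteriorAlgebra.ι K ξ) * extV w = extV (contr ξ w) +
      extV (CliffordAlgebra.involute w) * extDual (ExteriorAlgebra.ι K ξ) := by
  refine LinearMap.congr_fun (ext_wedge
    (f := LinearMap.mulLeft K (extDual (ExteriorAlgebra.ι K ξ)) ∘ₗ extV.toLinearMap)
    (g := extV.toLinearMap ∘ₗ contr ξ + LinearMap.mulRight K (extDual (ExteriorAlgebra.ι K ξ)) ∘ₗ
      extV.toLinearMap ∘ₗ CliffordAlgebra.involute.toLinearMap) ?_ ?_) w
  · simp
  · intro v w h
    have h1 := CliffordAlgebra.ι_mul_ι_add_swap (Q := QuadraticForm.dualProd K V) (ξ, 0) (0, v)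
    rw [← extV_ι, ← extDual_ι, show QuadraticMap.polar (QuadraticForm.dualProd K V) (ξ, 0) (0, v) =
      ξ v by simp [QuadraticMap.polar, QuadraticForm.dualProd_apply]] at h1
    have h2 : CliffordAlgebra.involute (wedge v w) =
        -(wedge v (CliffordAlgebra.involute w) : Λ) := by
      rw [wedge_apply, map_mul, ExteriorAlgebra.ι, CliffordAlgebra.involute_ι, neg_mul]; rfl
    simp only [LinearMap.comp_apply, LinearMap.add_apply, LinearMap.mulLeft_apply,
      LinearMap.mulRight_apply, AlgHom.toLinearMap_apply] at h ⊢
    rw [h2, contr_wedge, map_sub, map_smul, map_neg]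
    simp only [wedge_apply, map_mul]
    rw [← mul_assoc, eq_sub_of_add_eq h1, sub_mul, mul_assoc (extV _), h, Algebra.smul_def,
      mul_add, ← mul_assoc, neg_mul]
    abel

/-- Normal ordering: by `extDual_ι_mul_extV` a covector on the left can be moved past the V-factors,
so the span of the ordered products is stable under left multiplication by generators. -/
theorem ordMap_surjective : Function.Surjective (ordMap K V) := by
  have hV : ∀ v z, extV (ExteriorAlgebra.ι K v) * ordMap K V z ∈ LinearMap.range (ordMap K V) := by
    intro v z
    induction z using TensorProduct.induction_on with
    | zero => simp
    | add x y hx hy => rw [map_add, mul_add]; exact add_mem hx hy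
    | tmul w η =>
      refine ⟨(ExteriorAlgebra.ι K v * w) ⊗ₜ η, ?_⟩
      simp [mul_assoc]
  have hD : ∀ ξ z, extDual (ExteriorAlgebra.ι K ξ) * ordMap K V z ∈
      LinearMap.range (ordMap K V) := by
    intro ξ z
    induction z using TensorProduct.induction_on with
    | zero => simp
    | add x y hx hy => rw [map_add, mul_add]; exact add_mem hx hy
    | tmul w η =>
      refine ⟨contr ξ w ⊗ₜ η +
        CliffordAlgebra.involute w ⊗ₜ (ExteriorAlgebra.ι K ξ * η), ?_⟩
      rw [map_add, ordMap_tmul, ordMap_tmul, ordMap_tmul, ← mul_assoc, extDual_ι_mul_extV, map_mul,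
        add_mul, mul_assoc]
  rw [← LinearMap.range_eq_top, eq_top_iff]
  rintro x -
  induction x using CliffordAlgebra.left_induction with
  | algebraMap r => exact ⟨r • (1 ⊗ₜ 1), by simp [Algebra.algebraMap_eq_smul_one]⟩
  | add x y hx hy => exact add_mem hx hy
  | ι_mul x m hx =>
    obtain ⟨z, rfl⟩ := hx
    rw [show m = (0, m.2) + (m.1, 0) by simp, map_add, add_mul, ← extV_ι, ← extDual_ι]
    exact add_mem (hV _ _) (hD _ _)

section Separation

variable [CharZero K] {σ : Type*} [Fintype σ] (e : Module.Basis σ K V)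

/-- The element `1 ⊗ u` of the Koszul complex is closed and is killed by the homotopy, so the
homotopy identity reduces it to its augmentation. -/
theorem eq_smul_one_of_contr {u : Λ} (h : ∀ i, contr (e.coord i) u = 0) : u = extAug u • (1 : Λ) := by
  have h1 := kosD_kosC₀ e ((1 : MvPolynomial σ K) ⊗ₜ[K] u)
  rw [kosC₀_one_tmul, kosD_tmul] at h1
  simp only [h, TensorProduct.tmul_zero, Finset.sum_const_zero, map_zero, add_zero,
    kosUnit_apply, kosAug_tmul, map_one] at h1
  have h2 := congrArg (kosToExt e) (sub_eq_zero.mp h1.symm)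
  rw [smul_eq_mul, mul_one, ← mul_one (MvPolynomial.C _), MvPolynomial.C_mul',
    TensorProduct.smul_tmul, kosToExt_one_tmul, kosToExt_one_tmul] at h2
  simpa using congrArg (TensorProduct.lid K Λ) h2

/-- Contracting a nonzero element of `N` as long as the result is nonzero would end at a nonzero
scalar. Formally, the induction is on the set of indices whose contraction may be nonzero, using
that contractions anticommute and square to zero. -/
theorem eq_bot_of_contr_mem {N : Submodule K Λ} (hN : ∀ i, ∀ u ∈ N, contr (e.coord i) u ∈ N)
    (h : ∀ u ∈ N, extAug u = 0) : N = ⊥ := by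
  classical
  have key : ∀ s : Finset σ, ∀ u ∈ N, (∀ i ∉ s, contr (e.coord i) u = 0) → u = 0 := by
    intro s
    induction s using Finset.induction_on with
    | empty =>
      intro u hu h0
      rw [eq_smul_one_of_contr e (fun i => h0 i (Finset.notMem_empty i)), h u hu, zero_smul]
    | insert j s _ ih =>
      intro u hu h0
      have h1 : contr (e.coord j) u = 0 := by
        refine ih _ (hN j u hu) fun i hi => ?_
        by_cases hij : i = j
        · rw [hij, contr_contr]
        · have := CliffordAlgebra.contractLeft_comm (Q := (0 : QuadraticForm K V))
            (e.coord i) (e.coord j) u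
          change contr (e.coord i) (contr (e.coord j) u) =
            -contr (e.coord j) (contr (e.coord i) u) at this
          rw [this, h0 i (by simp [hij, hi]), map_zero, neg_zero]
      refine ih u hu fun i hi => ?_
      by_cases hij : i = j
      · rw [hij, h1]
      · exact h0 i (by simp [hij, hi])
  rw [eq_bot_iff]
  intro u hu
  exact (Submodule.mem_bot K).mpr (key Finset.univ u hu fun i hi => absurd (Finset.mem_univ i) hi)

end Separation

section FiniteDimensional

variable [FiniteDimensional K V]

variable (K V) in
theorem finrank_exteriorAlgebra :
    Module.finrank K Λ = 2 ^ Module.finrank K V := by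
  rw [Module.finrank_eq_card_basis (Module.finBasis K V).ExteriorAlgebra]; simp

instance finite_exteriorAlgebra : Module.Finite K Λ :=
  Module.Finite.of_basis (Module.finBasis K V).ExteriorAlgebra

variable [CharZero K]

/-- The kernel, on the side of Λ(V), of the pairing `extAug (contrExt η u)` is stable under
contraction and has no scalar part, so it is zero. In finite dimension nondegeneracy gives every
linear form. -/
theorem exists_contrExt (f : Module.Dual K Λ) : ∃ η : ΛD, ∀ u, extAug (contrExt η u) = f u := by
  let B : ΛD →ₗ[K] Module.Dual K Λ :=
    (LinearMap.llcomp K Λ Λ K extAug.toLinearMap) ∘ₗ contrExt.toLinearMap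
  have hB : Function.Injective B.flip := by
    rw [← LinearMap.ker_eq_bot]
    refine eq_bot_of_contr_mem (Module.finBasis K V) (fun i u hu => ?_) (fun u hu => ?_)
    · rw [LinearMap.mem_ker] at hu ⊢
      refine LinearMap.ext fun η => ?_
      -- Multiplying `η` on the right makes the new contraction act first, directly on `u`.
      have := LinearMap.congr_fun hu (η * ExteriorAlgebra.ι K ((Module.finBasis K V).coord i))
      change extAug (contrExt (η * _) u) = 0 at this
      rw [map_mul, contrExt_ι] at this
      exact this
    · have := LinearMap.congr_fun (LinearMap.mem_ker.mp hu) 1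
      change extAug (contrExt 1 u) = 0 at this
      rwa [map_one] at this
  obtain ⟨η, rfl⟩ := LinearMap.flip_injective_iff₁.mp hB f
  exact ⟨η, fun u => rfl⟩

/-- The projection onto scalars is a polynomial in the number operator: the product of `1 - X/q` for
`1 ≤ q ≤ dim V` is 1 at 0 and vanishes at every other eigenvalue. -/
theorem vacuum_mem : Algebra.linearMap K Λ ∘ₗ extAug.toLinearMap ∈ (cliffRep (K := K) (V := V)).range := by
  set e := Module.finBasis K V
  set n := Module.finrank K V
  let ν : Module.End K Λ := ∑ i, wedge (e i) * contr (e.coord i)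
  have hν : ν ∈ (cliffRep (K := K) (V := V)).range := sum_mem fun i _ => mul_mem
    ⟨CliffordAlgebra.ι _ (0, e i), by rw [AlgHom.toRingHom_eq_coe, RingHom.coe_coe, cliffRep_ι]; simp⟩
    ⟨CliffordAlgebra.ι _ (e.coord i, 0), by rw [AlgHom.toRingHom_eq_coe, RingHom.coe_coe, cliffRep_ι]; simp⟩
  have hν' : ∀ q : ℕ, ∀ w ∈ ⋀[K]^q V, ν w = (q : K) • w := fun q w hw => by
    simpa [ν] using sum_wedge_contr e q w hw
  let f : Polynomial K := ∏ q ∈ Finset.Icc 1 n, (1 - Polynomial.C (q : K)⁻¹ * Polynomial.X)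
  have hf : ∀ q : ℕ, ∀ w ∈ ⋀[K]^q V, Polynomial.aeval ν f w = f.eval (q : K) • w := by
    intro q w hw
    by_cases h0 : w = 0
    · simp [h0]
    · exact Module.End.aeval_apply_of_hasEigenvector
        ⟨Module.End.mem_eigenspace_iff.mpr (hν' q w hw), h0⟩
  suffices h : Algebra.linearMap K Λ ∘ₗ extAug.toLinearMap = Polynomial.aeval ν f by
    rw [h]
    exact Algebra.adjoin_le (Set.singleton_subset_iff.mpr hν)
      (Polynomial.aeval_mem_adjoin_singleton K ν)
  refine ext_extPow fun q w hw => ?_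
  rw [hf q w hw, LinearMap.comp_apply, AlgHom.toLinearMap_apply, Algebra.linearMap_apply,
    Algebra.algebraMap_eq_smul_one]
  rcases q with _ | q
  · rw [← eq_extAug_of_mem hw]
    simp [f, Polynomial.eval_prod]
  · rw [extAug_of_mem hw, zero_smul]
    by_cases hq : q + 1 ≤ n
    · rw [show f.eval ((q + 1 : ℕ) : K) = 0 from ?_, zero_smul]
      rw [Polynomial.eval_prod]
      refine Finset.prod_eq_zero (Finset.mem_Icc.mpr ⟨by omega, hq⟩) ?_
      have : ((q + 1 : ℕ) : K) ≠ 0 := Nat.cast_ne_zero.mpr (by omega)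
      rw [Polynomial.eval_sub, Polynomial.eval_mul, Polynomial.eval_C, Polynomial.eval_X,
        Polynomial.eval_one, inv_mul_cancel₀ this, sub_self]
    · rw [extPow_eq_bot (by omega), Submodule.mem_bot] at hw
      rw [hw, smul_zero]

/-- Rank-one operators suffice: contraction by a suitable element followed by the vacuum projection
gives any linear form, and left multiplication then places the value. -/
theorem cliffRep_surjective : Function.Surjective (cliffRep (K := K) (V := V)) := by
  rw [← AlgHom.range_eq_top, eq_top_iff]
  rintro F -
  let b := Module.finBasis K Λ
  choose η hη using fun j => exists_contrExt (b.coord j)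
  have h : F = ∑ j, cliffRep (extV (F (b j))) *
      ((Algebra.linearMap K Λ ∘ₗ extAug.toLinearMap) * cliffRep (extDual (η j))) := by
    refine LinearMap.ext fun u => ?_
    have h1 : ∀ j, cliffRep (extV (F (b j))) ((Algebra.linearMap K Λ ∘ₗ extAug.toLinearMap)
        (cliffRep (extDual (η j)) u)) = b.coord j u • F (b j) := by
      intro j
      rw [← hη, cliffRep_extV, LinearMap.comp_apply, AlgHom.toLinearMap_apply,
        Algebra.linearMap_apply, Algebra.algebraMap_eq_smul_one, mul_smul_comm, mul_one]
      rfl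
    simp only [LinearMap.sum_apply, Module.End.mul_apply, h1]
    exact (sum_coord_smul b F u).symm
  rw [h]
  exact sum_mem fun j _ => mul_mem ⟨_, rfl⟩ (mul_mem vacuum_mem ⟨_, rfl⟩)

/-- Source and target both have dimension `2 ^ (2 dim V)`, so surjectivity is enough. Injectivity of
`ordMap` follows without knowing the dimension of the Clifford algebra beforehand. -/
theorem cliffRep_ordMap_bijective :
    Function.Bijective (cliffRep.toLinearMap ∘ₗ ordMap K V : _ →ₗ[K] Module.End K Λ) := by
  have hs : Function.Surjective (cliffRep.toLinearMap ∘ₗ ordMap K V : _ →ₗ[K] Module.End K Λ) :=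
    cliffRep_surjective.comp ordMap_surjective
  refine ⟨(LinearMap.injective_iff_surjective_of_finrank_eq_finrank ?_).mpr hs, hs⟩
  rw [Module.finrank_tensorProduct, Module.finrank_linearMap, finrank_exteriorAlgebra,
    finrank_exteriorAlgebra, Subspace.dual_finrank_eq]

theorem ordMap_bijective : Function.Bijective (ordMap K V) :=
  ⟨Function.Injective.of_comp (f := cliffRep) cliffRep_ordMap_bijective.1, ordMap_surjective⟩

end FiniteDimensional

end Clifford

/-! ### Evaluating linear forms on letters, and explicit antisymmetrization. -/

section Forms

variable {K : Type*} [Field K]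

section Module

variable {A : Type*} [AddCommGroup A] [Module K A]

/-- One step in the recursion defining `firstForm`. -/
def firstStep (f : A →ₗ[K] K) : A →ₗ[K] Module.End K (T × T) :=
  LinearMap.mk₂ K (fun a z => (ιT a * z.1, f a • z.1))
    (by intro a b z; simp [add_mul, add_smul])
    (by intro r a z; simp [mul_smul])
    (by intro a z w; simp [mul_add])
    (by intro r a z; simp [smul_comm (f a)])

theorem firstStep_apply (f : A →ₗ[K] K) (a : A) (z : T × T) :
    firstStep f a z = (ιT a * z.1, f a • z.1) := rfl

/-- Removal of the first letter: `a x ↦ f(a) x`, and `1 ↦ 0`. -/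
def firstForm (f : A →ₗ[K] K) : Module.End K T :=
  LinearMap.snd K T T ∘ₗ LinearMap.applyₗ ((1 : T), (0 : T)) ∘ₗ
    (TensorAlgebra.lift K (firstStep f)).toLinearMap

@[simp] theorem firstForm_one (f : A →ₗ[K] K) : firstForm f 1 = 0 := by simp [firstForm]

@[simp] theorem firstForm_cons (f : A →ₗ[K] K) (a : A) (x : T) :
    firstForm f (ιT a * x) = f a • x := by
  have : ∀ x : T, (TensorAlgebra.lift K (firstStep f) x ((1 : T), (0 : T))).1 = x := by
    intro x
    induction x using induction_left with
    | one => simp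
    | cons a x h => simp [firstStep_apply, h]
    | add x y hx hy => simp [hx, hy]
    | smul r x hx => simp [hx]
  simp [firstForm, firstStep_apply, this]

theorem firstForm_mem (f : A →ₗ[K] K) : firstForm f ∈ degHom K A 1 := by
  intro n x hx
  cases n with
  | zero =>
    rw [tpow_natCast, pow_zero, Submodule.mem_one] at hx
    obtain ⟨r, rfl⟩ := hx
    simp [Algebra.algebraMap_eq_smul_one]
  | succ n =>
    refine tpow_succ_cons (C := fun x => firstForm f x ∈ tpow K A (((n + 1 : ℕ) : ℤ) - 1))
      (fun a y hy => ?_) (fun x y hx hy => by rw [map_add]; exact add_mem hx hy) hx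
    rw [firstForm_cons]
    exact Submodule.smul_mem _ _ (mem_tpow_of_eq hy (by push_cast; ring))

/-- The removal of the first `k` letters, evaluated on linear forms in reverse order. -/
def formsOp : (k : ℕ) → (Fin k → A →ₗ[K] K) → Module.End K T
  | 0, _ => LinearMap.id
  | k + 1, f => firstForm (f 0) ∘ₗ formsOp k (Matrix.vecTail f)

theorem formsOp_mem (k : ℕ) (f : Fin k → A →ₗ[K] K) : formsOp k f ∈ degHom K A k := by
  induction k with
  | zero => exact id_mem
  | succ k ih => exact comp_mem (firstForm_mem _) (ih _) (by push_cast; ring)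

theorem formsOp_tprod_mul (k : ℕ) (f : Fin k → A →ₗ[K] K) (a : Fin k → A) (y : T) :
    formsOp k f (TensorAlgebra.tprod K A k a * y) = (∏ i, f i.rev (a i)) • y := by
  induction k generalizing y with
  | zero => simp [formsOp, TensorAlgebra.tprod_apply]
  | succ k ih =>
    have : TensorAlgebra.tprod K A (k + 1) a =
        TensorAlgebra.tprod K A k (Fin.init a) * ιT (a (Fin.last k)) := by
      rw [TensorAlgebra.tprod_apply, TensorAlgebra.tprod_apply, List.ofFn_succ',
        List.concat_eq_append, List.prod_append]
      simp [Fin.init]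
    rw [this, mul_assoc, formsOp, LinearMap.comp_apply, ih, map_smul, firstForm_cons, smul_smul,
      Fin.prod_univ_castSucc]
    simp [Fin.rev_castSucc, Matrix.vecTail, Fin.init]

theorem formsOp_tprod (k : ℕ) (f : Fin k → A →ₗ[K] K) (a : Fin k → A) :
    formsOp k f (TensorAlgebra.tprod K A k a) = (∏ i, f i.rev (a i)) • 1 := by
  rw [← formsOp_tprod_mul, mul_one]

end Module

section Algebra

variable {A : Type*} [NonUnitalRing A] [Module K A] [IsScalarTower K A A] [SMulCommClass K A A]

/-- A form that kills products does not see the term of the bar differential that multiplies the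
first two letters; the rest acts behind the removed odd letter, with a sign. -/
theorem firstForm_bar {f : A →ₗ[K] K} (hf : ∀ a c, f (a * c) = 0) (x : T) :
    firstForm f (bar K A x) = -bar K A (firstForm f x) := by
  induction x using induction_left with
  | one => simp [ins_mulMap_one]
  | add x y hx hy => simp only [map_add, neg_add, hx, hy]
  | smul r x hx => simp only [map_smul, hx, smul_neg]
  | cons a x ih =>
    clear ih
    have h : firstForm f (mulFirst a x) = 0 := by
      induction x using induction_left with
      | one => simp
      | cons c x _ => simp [hf]
      | add x y hx hy => rw [map_add, map_add, hx, hy, add_zero]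
      | smul r x hx => rw [map_smul, map_smul, hx, smul_zero]
    rw [bar_cons, map_sub, h, firstForm_cons, firstForm_cons, map_smul, zero_sub]

theorem formsOp_bar (k : ℕ) {f : Fin k → A →ₗ[K] K} (hf : ∀ i a c, f i (a * c) = 0) (x : T) :
    formsOp k f (bar K A x) = sgn K k • bar K A (formsOp k f x) := by
  induction k with
  | zero => simp [formsOp]
  | succ k ih =>
    rw [formsOp, LinearMap.comp_apply, LinearMap.comp_apply, ih (f := Matrix.vecTail f) fun i => hf _, map_smul,
      firstForm_bar (hf 0), Nat.cast_succ, sgn_add, sgn_one]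
    simp

theorem bar_of_mem_one {x : T} (hx : x ∈ tpow K A 1) : bar K A x = 0 := by
  have h : x ∈ tpow K A ((1 : ℕ) : ℤ) := hx
  rw [tpow_natCast, pow_one] at h
  obtain ⟨a, rfl⟩ := h
  rw [← mul_one (ιT a), bar_cons, mulFirst_one, ins_mulMap_one, mul_zero, sub_zero]

end Algebra

section Commutative

variable {V : Type*} [AddCommGroup V] [Module K V]
variable {A : Type*} [NonUnitalCommRing A] [Module K A] [IsScalarTower K A A]
  [SMulCommClass K A A] (g : V →ₗ[K] A)

theorem firstForm_shuffle (f : A →ₗ[K] K) (a : A) (x : T) :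
    firstForm f (shuffle a x) = f a • x - shuffle a (firstForm f x) := by
  induction x using induction_left with
  | one => have := firstForm_cons f a 1; rw [mul_one] at this; simp [this]
  | cons c x _ => rw [shuffle_cons, map_sub, firstForm_cons, firstForm_cons, firstForm_cons, map_smul]
  | add x y hx hy => simp only [map_add, smul_add, hx, hy]; abel
  | smul r x hx => simp only [map_smul, hx, smul_sub, smul_comm r]

theorem firstForm_alt {f : A →ₗ[K] K} {ξ : Module.Dual K V} (hf : ∀ v, f (g v) = ξ v) (w : Λ) :
    firstForm f (alt g w) = alt g (contr ξ w) := by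
  refine LinearMap.congr_fun (ext_wedge (f := firstForm f ∘ₗ alt g) (g := alt g ∘ₗ contr ξ)
    ?_ ?_) w
  · simp
  · intro v w h
    simp only [LinearMap.comp_apply] at h ⊢
    rw [alt_wedge, firstForm_shuffle, h, contr_wedge, map_sub, map_smul, alt_wedge, hf]

/-- Removing the first letter of an antisymmetrized word by a linear form is contraction with the
restriction of the form to V, and this is iterated. -/
theorem formsOp_alt (k : ℕ) {f : Fin k → A →ₗ[K] K} {ξ : Fin k → Module.Dual K V}
    (hf : ∀ i v, f i (g v) = ξ i v) (w : Λ) :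
    formsOp k f (alt g w) = alt g (contrExt (ExteriorAlgebra.ιMulti K k ξ) w) := by
  induction k with
  | zero => simp [formsOp]
  | succ k ih =>
    rw [formsOp, LinearMap.comp_apply, ih (f := Matrix.vecTail f) (ξ := Matrix.vecTail ξ) fun i => hf _,
      firstForm_alt g (hf 0), ExteriorAlgebra.ιMulti_succ_apply, map_mul, contrExt_ι]
    rfl

theorem contr_ιMulti (ξ : Module.Dual K V) (n : ℕ) (v : Fin (n + 1) → V) :
    contr ξ (ExteriorAlgebra.ιMulti K (n + 1) v) = ∑ j : Fin (n + 1),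
      ((-1 : K) ^ (j : ℕ) * ξ (v j)) • ExteriorAlgebra.ιMulti K n (v ∘ j.succAbove) := by
  induction n with
  | zero =>
    have := contr_ι_mul ξ (v 0) 1
    rw [mul_one] at this
    simp [ExteriorAlgebra.ιMulti_succ_apply, this]
  | succ n ih =>
    conv_rhs => rw [Fin.sum_univ_succ]
    rw [ExteriorAlgebra.ιMulti_succ_apply, contr_ι_mul, ih, Finset.mul_sum, sub_eq_add_neg, ← Finset.sum_neg_distrib]
    congr 1
    · simp [Matrix.vecTail, Function.comp_def]
    · refine Finset.sum_congr rfl fun j _ => ?_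
      rw [ExteriorAlgebra.ιMulti_succ_apply (v := v ∘ j.succ.succAbove)]
      have : Matrix.vecTail (v ∘ j.succ.succAbove) = Matrix.vecTail v ∘ j.succAbove := by
        ext i; simp [Matrix.vecTail]
      rw [this]
      simp [pow_succ, Matrix.vecTail]

/-- The antisymmetrization of a product of vectors. -/
def altSum (l : ℕ) : V [⋀^Fin l]→ₗ[K] T :=
  MultilinearMap.alternatization ((TensorAlgebra.tprod K A l).compLinearMap fun _ => g)

theorem altSum_apply (l : ℕ) (v : Fin l → V) : altSum g l v = ∑ σ : Equiv.Perm (Fin l),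
    (Equiv.Perm.sign σ : ℤ) • TensorAlgebra.tprod K A l fun i => g (v (σ i)) := by
  simp [altSum, MultilinearMap.alternatization_apply, Units.smul_def]

/-- Permutations are grouped by the image of the first index, which gives an expansion along the
first letter. -/
theorem altSum_succ (l : ℕ) (v : Fin (l + 1) → V) : altSum g (l + 1) v =
    ∑ j : Fin (l + 1), (-1 : K) ^ (j : ℕ) • (ιT (g (v j)) * altSum g l (v ∘ j.succAbove)) := by
  rw [altSum_apply, Finset.univ_perm_fin_succ, ← Finset.univ_product_univ]
  simp only [Finset.sum_map, Equiv.toEmbedding_apply, Finset.sum_product]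
  refine Finset.sum_congr rfl fun j _ => ?_
  have h : ∀ τ : Equiv.Perm (Fin l), TensorAlgebra.tprod K A (l + 1)
      (fun i => g (v (Equiv.Perm.decomposeFin.symm (j, τ) i))) =
      ιT (g (v j)) * TensorAlgebra.tprod K A l fun i => g (v (Equiv.swap 0 j (τ i).succ)) := by
    intro τ
    simp [TensorAlgebra.tprod_apply, List.ofFn_succ]
  simp only [h, Equiv.Perm.decomposeFin.symm_sign]
  refine Fin.cases ?_ (fun i => ?_) j
  · simp [altSum_apply, Finset.mul_sum, -zsmul_eq_mul]
  · have h2 := (altSum g l).map_perm (v ∘ i.succ.succAbove) i.cycleRange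
    rw [Fin.sign_cycleRange, altSum_apply] at h2
    simp only [Function.comp_apply, Fin.succAbove_cycleRange] at h2
    simp only [Fin.succ_ne_zero, if_false, neg_one_mul, Units.val_neg, neg_smul, ← mul_smul_comm]
    rw [← Finset.mul_sum, Finset.sum_neg_distrib, h2]
    rcases Nat.even_or_odd (i : ℕ) with h3 | h3 <;> simp [h3.neg_one_pow, pow_succ]

/-- The recursive antisymmetrization and the sum over permutations have the same expansion along the
first letter, by `alt_eq` with `contr_ιMulti` and by `altSum_succ`. -/
theorem alt_ιMulti [FiniteDimensional K V] (l : ℕ) (v : Fin l → V) :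
    alt g (ExteriorAlgebra.ιMulti K l v) = altSum g l v := by
  induction l with
  | zero => simp [altSum_apply, TensorAlgebra.tprod_apply]
  | succ l ih =>
    have h0 : extAug (ExteriorAlgebra.ιMulti K (l + 1) v) = 0 := by
      rw [ExteriorAlgebra.ιMulti_succ_apply]; exact extAug_wedge _ _
    rw [alt_eq g (Module.finBasis K V), altSum_succ, h0, zero_smul, add_zero]
    simp only [contr_ιMulti, map_sum, map_smul, Finset.mul_sum, ih]
    rw [Finset.sum_comm]
    refine Finset.sum_congr rfl fun j _ => ?_
    have h2 := sum_coord_smul (Module.finBasis K V)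
      (LinearMap.mulRight K (altSum g l (v ∘ j.succAbove)) ∘ₗ ιT ∘ₗ g) (v j)
    simp only [LinearMap.comp_apply, LinearMap.mulRight_apply] at h2
    simp only [mul_smul_comm, mul_smul, ← Finset.smul_sum, h2]

end Commutative

end Forms

/-! ### Homogeneous endomorphisms of the exterior algebra. -/

section ExteriorDegrees

variable {K : Type*} [Field K] {V : Type*} [AddCommGroup V] [Module K V]

variable (K V) in
/-- The component `Λ^n(V)` of the exterior algebra, for `n : ℤ` (zero for negative `n`). -/
def extZ : ℤ → Submodule K Λ
  | Int.ofNat n => ⋀[K]^n V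
  | Int.negSucc _ => ⊥

theorem extZ_natCast (n : ℕ) : extZ K V n = ⋀[K]^n V := rfl

theorem extZ_of_neg {n : ℤ} (h : n < 0) : extZ K V n = ⊥ := by
  cases n with
  | ofNat n => simp at h; omega
  | negSucc n => rfl

variable (K V) in
/-- The linear endomorphisms of `Λ(V)` mapping `Λ^n(V)` to `Λ^{n-i}(V)` for all `n`. -/
def extHom (i : ℤ) : Submodule K (Module.End K Λ) where
  carrier := {f | ∀ n : ℕ, ∀ w ∈ ⋀[K]^n V, f w ∈ extZ K V (n - i)}
  add_mem' h h' k x hx := add_mem (h k x hx) (h' k x hx)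
  zero_mem' _ _ _ := zero_mem _
  smul_mem' r _ h k x hx := Submodule.smul_mem _ r (h k x hx)

theorem extHom_apply {i : ℤ} {f : Module.End K Λ} (hf : f ∈ extHom K V i) {n m : ℤ} {w : Λ}
    (hw : w ∈ extZ K V n) (h : n - i = m) : f w ∈ extZ K V m := by
  subst h
  rcases lt_or_ge n 0 with hn | hn
  · rw [extZ_of_neg hn, Submodule.mem_bot] at hw; simp [hw]
  lift n to ℕ using hn
  exact hf n w hw

theorem extHom_comp {i j k : ℤ} {f g : Module.End K Λ} (hf : f ∈ extHom K V i)
    (hg : g ∈ extHom K V j) (h : i + j = k) : f ∘ₗ g ∈ extHom K V k := fun n x hx =>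
  extHom_apply hf (hg n x hx) (by omega)

theorem contr_mem_extHom (ξ : Module.Dual K V) : contr ξ ∈ extHom K V 1 := by
  intro n w hw
  cases n with
  | zero => rw [contr_zero_mem ξ hw]; exact zero_mem _
  | succ n =>
    rw [show ((n + 1 : ℕ) : ℤ) - 1 = n by push_cast; ring]
    exact contr_succ_mem ξ hw

theorem contrExt_mem (k : ℕ) (ξ : Fin k → Module.Dual K V) :
    contrExt (ExteriorAlgebra.ιMulti K k ξ) ∈ extHom K V k := by
  induction k with
  | zero =>
    intro n w hw
    rw [Nat.cast_zero, sub_zero, extZ_natCast]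
    simpa using hw
  | succ k ih =>
    rw [ExteriorAlgebra.ιMulti_succ_apply, map_mul, contrExt_ι]
    exact extHom_comp (contr_mem_extHom _) (ih _) (by push_cast; ring)

theorem mulLeft_mem_extHom {l : ℕ} {w : Λ} (hw : w ∈ ⋀[K]^l V) :
    LinearMap.mulLeft K w ∈ extHom K V (-l) := by
  intro n u hu
  rw [show (n : ℤ) - -l = ((l + n : ℕ) : ℤ) by push_cast; ring, extZ_natCast,
    ExteriorAlgebra.exteriorPower, pow_add]
  exact Submodule.mul_mem_mul hw hu

end ExteriorDegrees

/-! ### From cohomology classes to endomorphisms of Λ(V). -/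

section Transfer

variable {K : Type*} [Field K] [CharZero K] {V : Type*} [AddCommGroup V] [Module K V]
  [FiniteDimensional K V]
variable {A : Type*} [NonUnitalCommRing A] [Module K A] [IsScalarTower K A A]
  [SMulCommClass K A A]

namespace AugIdeal

/-- The endomorphism of `Λ(V)` which an endomorphism of `T(A)` induces. -/
def transfer (I : AugIdeal K V A) : Module.End K T →ₗ[K] Module.End K Λ where
  toFun F := toExt (Module.finBasis K V) I ∘ₗ F ∘ₗ alt I.g
  map_add' F G := by rw [LinearMap.add_comp, LinearMap.comp_add]
  map_smul' r F := by rw [LinearMap.smul_comp, LinearMap.comp_smul]; rfl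

variable (I : AugIdeal K V A)

theorem transfer_apply (F : Module.End K T) (w : Λ) :
    I.transfer F w = toExt (Module.finBasis K V) I (F (alt I.g w)) := rfl

theorem alt_memZ {n : ℤ} {w : Λ} (hw : w ∈ extZ K V n) : alt I.g w ∈ tpow K A n := by
  rcases lt_or_ge n 0 with hn | hn
  · rw [extZ_of_neg hn, Submodule.mem_bot] at hw; simp [hw]
  lift n to ℕ using hn
  exact alt_mem I.g hw

theorem toExt_memZ {n : ℤ} {x : T} (hx : x ∈ tpow K A n) :
    toExt (Module.finBasis K V) I x ∈ extZ K V n := by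
  rcases lt_or_ge n 0 with hn | hn
  · rw [tpow_of_neg hn, Submodule.mem_bot] at hx; simp [hx]
  lift n to ℕ using hn
  exact toExt_mem _ I hx

theorem transfer_mem {i : ℤ} {F : Module.End K T} (hF : F ∈ degHom K A i) :
    I.transfer F ∈ extHom K V i := fun n _ hw => I.toExt_memZ (hF n _ (alt_mem I.g hw))

theorem transfer_comm_bar (i j : ℤ) (G : Module.End K T) :
    I.transfer (comm i j (bar K A) G) = 0 := by
  refine LinearMap.ext fun w => ?_
  simp [transfer_apply, comm_apply, toExt_bar, bar_alt]

theorem bar_comm_apply {i : ℤ} {F : Module.End K T} (hF : comm 1 i (bar K A) F = 0) (x : T) :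
    bar K A (F x) = sgn K i • F (bar K A x) := by
  have := LinearMap.congr_fun hF x
  rwa [comm_apply, one_mul, LinearMap.sub_apply, LinearMap.zero_apply, sub_eq_zero] at this

theorem toExt_comm_bar {i : ℤ} {F : Module.End K T} (hF : comm 1 i (bar K A) F = 0) (x : T) :
    toExt (Module.finBasis K V) I (F (bar K A x)) = 0 := by
  have h : F (bar K A x) = sgn K i • bar K A (F x) := by
    rw [bar_comm_apply hF, smul_smul, sgn_mul_self, one_smul]
  rw [h, map_smul, toExt_bar, smul_zero]

/-- `G (alt w)` is a cycle, so by `bar_htpy` it differs from `alt (toExt (G (alt w)))` by a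
boundary. `F` maps boundaries to boundaries, and `toExt` kills these. -/
theorem transfer_comp {i j : ℤ} {F G : Module.End K T} (hF : comm 1 i (bar K A) F = 0)
    (hG : comm 1 j (bar K A) G = 0) : I.transfer (F ∘ₗ G) = I.transfer F ∘ₗ I.transfer G := by
  refine LinearMap.ext fun w => ?_
  have h1 : bar K A (G (alt I.g w)) = 0 := by
    rw [bar_comm_apply hG, bar_alt, map_zero, smul_zero]
  have h2 := bar_htpy (Module.finBasis K V) I (G (alt I.g w))
  rw [h1, map_zero, add_zero, eq_sub_iff_add_eq] at h2
  rw [LinearMap.comp_apply, transfer_apply, transfer_apply, transfer_apply, LinearMap.comp_apply,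
    ← h2, map_add, map_add, I.toExt_comm_bar hF, zero_add]

theorem transfer_comm {i j : ℤ} {F G : Module.End K T} (hF : comm 1 i (bar K A) F = 0)
    (hG : comm 1 j (bar K A) G = 0) : I.transfer (comm i j F G) =
      I.transfer F ∘ₗ I.transfer G - sgn K (i * j) • (I.transfer G ∘ₗ I.transfer F) := by
  rw [comm_apply, map_sub, map_smul, I.transfer_comp hF hG, I.transfer_comp hG hF]

/-- Write `s = alt`, `p = toExt`, `h = htpy`. The commutator of `b` with `-h F` is `F - s p F`. As
`p F s = 0` and `p F b = 0`, the retraction identity gives `p F = -p F h b`, so `s p F` is the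
commutator of `b` with the second summand of the witness. -/
theorem exists_comm_eq {k : ℤ} {F : Module.End K T} (hdeg : F ∈ degHom K A (1 + k))
    (hF : comm 1 (1 + k) (bar K A) F = 0) (h : I.transfer F = 0) :
    ∃ G ∈ degHom K A k, comm 1 k (bar K A) G = F := by
  set e := Module.finBasis K V
  have hsp : alt I.g ∘ₗ toExt e I ∈ degHom K A 0 := fun n x hx =>
    mem_tpow_of_eq (alt_mem I.g (toExt_mem e I hx)) (by ring)
  refine ⟨-(htpy e I ∘ₗ F) + sgn K k • ((alt I.g ∘ₗ toExt e I) ∘ₗ F ∘ₗ htpy e I),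
    add_mem (neg_mem (comp_mem (htpy_mem e I) hdeg (by ring))) (Submodule.smul_mem _ _
      (comp_mem hsp (comp_mem hdeg (htpy_mem e I) (by ring : (1 + k) + -1 = k)) (zero_add k))), ?_⟩
  refine LinearMap.ext fun x => ?_
  have h1 := bar_htpy e I (F x)
  have h2 := congrArg (fun y => alt I.g (toExt e I (F y))) (bar_htpy e I x)
  have h3 : toExt e I (F (alt I.g (toExt e I x))) = 0 := LinearMap.congr_fun h (toExt e I x)
  simp only [map_add, map_sub, h3, I.toExt_comm_bar hF, map_zero, e] at h2
  simp only [comm_apply, LinearMap.sub_apply, LinearMap.add_apply, LinearMap.smul_apply,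
    LinearMap.neg_apply, LinearMap.comp_apply, map_add, map_neg, map_smul, bar_alt, smul_zero,
    one_mul]
  rw [bar_comm_apply hF, map_smul, sgn_add, sgn_one] at h1
  have h4 := congrArg (fun r : K => r • alt I.g (toExt e I (F (htpy e I (bar K A x)))))
    (sgn_mul_self (K := K) k)
  simp only [mul_smul, one_smul] at h4
  linear_combination (norm := module) -h1 - h2 - h4

theorem comm_bar_of_cocycle {t : Totalization} {i : ℤ} (Ψ : cocycles K A t i) :
    comm 1 i (bar K A) (ins i Ψ.1) = 0 := by
  rw [← ins_diff, show diff K A i Ψ.1 = 0 from Ψ.2.2, map_zero]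

/-- The map which a cocycle induces on the exterior algebra. -/
def cocycleTransfer (t : Totalization) (i : ℤ) : cocycles K A t i →ₗ[K] Module.End K Λ :=
  I.transfer ∘ₗ ins i ∘ₗ (cocycles K A t i).subtype

theorem cocycleTransfer_apply (t : Totalization) (i : ℤ) (Ψ : cocycles K A t i) :
    I.cocycleTransfer t i Ψ = I.transfer (ins i Ψ.1) := rfl

theorem ker_cocycleTransfer (t : Totalization) (i : ℤ) : LinearMap.ker (I.cocycleTransfer t i) =
    (coboundaries K A t i).submoduleOf (cocycles K A t i) := by
  obtain ⟨k, rfl⟩ : ∃ k, i = 1 + k := ⟨i - 1, by ring⟩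
  ext Ψ
  change _ ↔ Ψ.1 ∈ coboundaries K A t (1 + k)
  rw [LinearMap.mem_ker, coboundaries, add_sub_cancel_left, cocycleTransfer_apply,
    Submodule.mem_map]
  constructor
  · intro h
    have hdeg := homDeg_le_degHom t _ Ψ.2.1
    obtain ⟨G, hG, hGF⟩ := I.exists_comm_eq (ins_mem hdeg) (comm_bar_of_cocycle Ψ) h
    have hX : diff K A k ((insEquiv k).symm G) = Ψ.1 := by
      apply ins_injective (1 + k)
      rw [ins_diff, ins_insEquiv_symm, hGF]
    have hXdeg := insEquiv_symm_mem hG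
    cases t with
    | directProduct => exact ⟨_, hXdeg, hX⟩
    | directSum =>
      obtain ⟨j, rfl⟩ : ∃ j, k = 1 + j := ⟨k - 1, by ring⟩
      -- The primitive found so far may have an infinite tail, but its differential has finite
      -- support, so subtracting a coboundary makes the primitive finite without changing its
      -- differential. Low degrees are irrelevant here, hence the cut-off `0`.
      obtain ⟨Φ, hΦ, -, hfin⟩ := I.exists_diff_sub_mem_finHom 0 hXdeg (hX ▸ Ψ.2.1.2)
      refine ⟨_, ⟨sub_mem hXdeg ?_, hfin⟩, by rw [map_sub, diff_diff, sub_zero, hX]⟩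
      exact diff_mem (t := .directProduct) hΦ
  · rintro ⟨X, -, hX⟩
    rw [← hX, ins_diff, transfer_comm_bar]

/-- The map which a cohomology class induces on the exterior algebra. -/
def classTransfer (t : Totalization) (i : ℤ) : Cohomology K A t i →ₗ[K] Module.End K Λ :=
  Submodule.liftQ _ (I.cocycleTransfer t i) (I.ker_cocycleTransfer t i).ge

theorem classTransfer_injective (t : Totalization) (i : ℤ) :
    Function.Injective (I.classTransfer t i) := by
  rw [← LinearMap.ker_eq_bot, classTransfer, Submodule.ker_liftQ, ker_cocycleTransfer,
    Submodule.mkQ_map_self]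

theorem classTransfer_mem (t : Totalization) (i : ℤ) (x : Cohomology K A t i) :
    I.classTransfer t i x ∈ extHom K V i := by
  obtain ⟨Ψ, rfl⟩ := Submodule.mkQ_surjective _ x
  exact I.transfer_mem (ins_mem (homDeg_le_degHom t _ Ψ.2.1))

/-- The map from the total cohomology to the endomorphisms of the exterior algebra. -/
def totalTransfer (t : Totalization) : TotalCohomology K A t →ₗ[K] Module.End K Λ :=
  DirectSum.toModule K ℤ _ (I.classTransfer t)

theorem totalTransfer_cls (t : Totalization) (i : ℤ) (Ψ : cocycles K A t i) :
    I.totalTransfer t (cls t i Ψ) = I.transfer (ins i Ψ.1) := by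
  rw [totalTransfer, cls, LinearMap.comp_apply, DirectSum.toModule_lof]
  rfl

theorem totalTransfer_bracket (t : Totalization) (i j : ℤ) (x : cocycles K A t i)
    (y : cocycles K A t j) :
    I.totalTransfer t (totalBracket t (cls t i x) (cls t j y)) =
      I.totalTransfer t (cls t i x) ∘ₗ I.totalTransfer t (cls t j y) -
        sgn K (i * j) • (I.totalTransfer t (cls t j y) ∘ₗ I.totalTransfer t (cls t i x)) := by
  rw [totalBracket_cls, totalTransfer_cls, totalTransfer_cls, totalTransfer_cls, ins_bracket]
  exact I.transfer_comm (comm_bar_of_cocycle x) (comm_bar_of_cocycle y)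

theorem extScale_of_mem {i j : ℤ} {n : ℕ} {f : Module.End K Λ} (hf : f ∈ extHom K V j) {w : Λ}
    (hw : w ∈ ⋀[K]^n V) :
    extScale (fun q => if (q : ℤ) = n - i then 1 else 0) (f w) = if j = i then f w else 0 := by
  have h := hf n w hw
  rcases lt_or_ge ((n : ℤ) - j) 0 with hn | hn
  · rw [extZ_of_neg hn, Submodule.mem_bot] at h; simp [h]
  obtain ⟨m, hm⟩ := Int.eq_ofNat_of_zero_le hn
  rw [hm] at h
  rw [extScale_apply _ h]
  by_cases hij : j = i
  · rw [if_pos hij, if_pos (by omega), one_smul]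
  · rw [if_neg hij, if_neg (by omega), zero_smul]

/-- Classes of different degrees shift the exterior degree differently, so the component of degree
`i` is recovered on Λ^n by projecting onto Λ^{n-i}. -/
theorem totalTransfer_injective (t : Totalization) : Function.Injective (I.totalTransfer t) := by
  classical
  have key : ∀ (i : ℤ) (n : ℕ), ∀ w ∈ ⋀[K]^n V, ∀ x : TotalCohomology K A t,
      extScale (fun q => if (q : ℤ) = n - i then 1 else 0) (I.totalTransfer t x w) =
        I.classTransfer t i (x i) w := by
    intro i n w hw x
    induction x using DirectSum.induction_on with
    | zero => simp
    | add x y hx hy => simp only [map_add, LinearMap.add_apply, DirectSum.add_apply, hx, hy]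
    | of j y =>
      have h : I.totalTransfer t (DirectSum.of (fun i => Cohomology K A t i) j y) =
          I.classTransfer t j y := DirectSum.toModule_lof K j y
      rw [h, extScale_of_mem (I.classTransfer_mem t j y) hw]
      by_cases hij : j = i
      · subst hij; rw [if_pos rfl, DirectSum.of_eq_same]
      · rw [if_neg hij, DirectSum.of_eq_of_ne _ _ _ (Ne.symm hij), map_zero, LinearMap.zero_apply]
  intro x y hxy
  refine DFinsupp.ext fun i => I.classTransfer_injective t i (ext_extPow fun n w hw => ?_)
  rw [← key i n w hw x, ← key i n w hw y, hxy]

end AugIdeal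

end Transfer

/-! ### Cocycles with prescribed leading symbol and the isomorphism κ. -/

section Symbols

variable {K : Type*} [Field K] [CharZero K] {V : Type*} [AddCommGroup V] [Module K V]
  [FiniteDimensional K V]
variable {A : Type*} [NonUnitalCommRing A] [Module K A] [IsScalarTower K A A]
  [SMulCommClass K A A]

theorem tproj_bar (k : ℕ) (x : T) : tproj k (bar K A x) = bar K A (tproj (k + 1) x) := by
  suffices h : tproj k ∘ₗ bar K A = bar K A ∘ₗ tproj (k + 1) from LinearMap.congr_fun h x
  refine ext_tpow fun n x hx => ?_
  rw [LinearMap.comp_apply, LinearMap.comp_apply]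
  have hb := (ins_mem (mulMap_mem (K := K) (A := A) .directProduct) : bar K A ∈ degHom K A 1) n x hx
  cases n with
  | zero =>
    rw [tpow_of_neg (by norm_num), Submodule.mem_bot] at hb
    rw [hb, tproj_ne hx (by omega), map_zero, map_zero]
  | succ n =>
    rw [show ((n + 1 : ℕ) : ℤ) - 1 = n by push_cast; ring] at hb
    by_cases h : n = k
    · subst h; rw [tproj_same hb, tproj_same hx]
    · rw [tproj_ne hb h, tproj_ne hx (by omega), map_zero]

theorem bar_smul_one_mul {y : T} (hy : y ∈ tpow K A 0) {z : T} (hz : bar K A z = 0) :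
    bar K A (y * z) = 0 := by
  have h : y ∈ tpow K A ((0 : ℕ) : ℤ) := hy
  rw [tpow_natCast, pow_zero, Submodule.mem_one] at h
  obtain ⟨r, rfl⟩ := h
  rw [← Algebra.smul_def, map_smul, hz, smul_zero]

namespace AugIdeal

variable (I : AugIdeal K V A)

/-- A cocycle in the direct product is cohomologous to one in either totalization, without change
in low degrees. -/
theorem exists_cocycle (t : Totalization) {i : ℤ} {Ψ : Module.End K T} (hΨ : Ψ ∈ degHom K A i)
    (hd : diff K A i Ψ = 0) (N : ℕ) : ∃ Φ : cocycles K A t i,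
      (∀ n ≤ N, ∀ x ∈ tpow K A n, Φ.1 x = Ψ x) ∧
        I.transfer (ins i Φ.1) = I.transfer (ins i Ψ) := by
  cases t with
  | directProduct => exact ⟨⟨Ψ, hΨ, hd⟩, fun _ _ _ _ => rfl, rfl⟩
  | directSum =>
    obtain ⟨j, rfl⟩ : ∃ j, i = 1 + j := ⟨i - 1, by ring⟩
    obtain ⟨X, hX, hv, hfin⟩ := I.exists_diff_sub_mem_finHom N hΨ (by rw [hd]; exact zero_mem _)
    refine ⟨⟨Ψ - diff K A j X, ⟨sub_mem hΨ (diff_mem (t := .directProduct) hX), hfin⟩, ?_⟩,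
      fun n hn x hx => ?_, ?_⟩
    · change diff K A (1 + j) (Ψ - diff K A j X) = 0
      rw [map_sub, hd, diff_diff, sub_zero]
    · rw [LinearMap.sub_apply, diff_of_vanish j hv n hn x hx, sub_zero]
    · rw [map_sub, map_sub, ins_diff, transfer_comm_bar, sub_zero]

variable {k l : ℕ} (w : ExteriorAlgebra K V)
  (η : ExteriorAlgebra K (Module.Dual K V)) (f : Fin k → A →ₗ[K] K)

/-- The operator on the bar complex with leading symbol `w ⊗ η`. -/
def symbolOp : Module.End K T :=
  alt I.g ∘ₗ LinearMap.mulLeft K w ∘ₗ contrExt η ∘ₗ toExt (Module.finBasis K V) I ∘ₗ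
      (LinearMap.id - tproj k) +
    rm (alt I.g w) ∘ₗ formsOp k f ∘ₗ tproj k

/-- Away from `A^{⊗k}` the operator is the Clifford operator transported through the retraction.
That operator need not take the required value on `A^{⊗k}`, so there it is replaced by the product
of linear forms times `alt w`. -/
theorem symbolOp_apply (x : T) : I.symbolOp w η f x =
    alt I.g (w * contrExt η (toExt (Module.finBasis K V) I (x - tproj k x))) +
      formsOp k f (tproj k x) * alt I.g w := rfl

theorem formsOp_tproj_mem (x : T) : formsOp k f (tproj k x) ∈ tpow K A 0 := by
  have : tproj k x ∈ tpow K A k := by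
    rw [tpow_natCast]
    exact (DirectSum.decompose (fun n : ℕ => LinearMap.range ιT ^ n) x k).2
  exact degHom_apply (formsOp_mem k f) this (by ring)

theorem bar_symbolOp (x : T) : bar K A (I.symbolOp w η f x) = 0 := by
  rw [symbolOp_apply, map_add, bar_alt,
    bar_smul_one_mul (formsOp_tproj_mem f x) (bar_alt I w), add_zero]

variable {f} in
-- On words of length `k + 1` the forms kill products, so evaluating them on a boundary leaves, up
-- to sign, the boundary of a one-letter word, which is zero. Elsewhere `toExt` kills boundaries.
theorem symbolOp_bar (hf : ∀ i a c, f i (a * c) = 0) (x : T) :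
    I.symbolOp w η f (bar K A x) = 0 := by
  have h : tproj (k + 1) x ∈ tpow K A ((k + 1 : ℕ) : ℤ) := by
    rw [tpow_natCast]
    exact (DirectSum.decompose (fun n : ℕ => LinearMap.range ιT ^ n) x (k + 1)).2
  rw [symbolOp_apply, tproj_bar, formsOp_bar k hf,
    bar_of_mem_one (degHom_apply (formsOp_mem k f) h (by push_cast; ring)), map_sub, toExt_bar,
    toExt_bar]
  simp

variable {f} in
-- On antisymmetrized words of length `k` the forms act as iterated contraction to a scalar, by
-- `formsOp_alt`, so the replacement in that degree does not affect the map on homology.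
theorem transfer_symbolOp {ξ : Fin k → Module.Dual K V} (hf : ∀ i v, f i (I.g v) = ξ i v) :
    I.transfer (I.symbolOp w (ExteriorAlgebra.ιMulti K k ξ) f) =
      cliffRep (ordMap K V (w ⊗ₜ ExteriorAlgebra.ιMulti K k ξ)) := by
  refine ext_extPow fun n u hu => ?_
  rw [cliffRep_ordMap, transfer_apply, symbolOp_apply]
  by_cases h : n = k
  · subst h
    have h0 := contrExt_mem n ξ n u hu
    rw [sub_self] at h0
    rw [tproj_same (alt_mem I.g hu), sub_self, map_zero, map_zero, mul_zero, map_zero, zero_add,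
      formsOp_alt I.g n hf, eq_extAug_of_mem (w := contrExt _ u) h0]
    simp [toExt_alt]
  · rw [tproj_ne (alt_mem I.g hu) h]
    simp [toExt_alt]

variable {w} in
theorem symbolOp_mem (hw : w ∈ ⋀[K]^l V) (ξ : Fin k → Module.Dual K V) :
    I.symbolOp w (ExteriorAlgebra.ιMulti K k ξ) f ∈ degHom K A ((k : ℤ) - l) := by
  refine add_mem (fun n x hx => ?_) ?_
  · have h1 := I.toExt_memZ (sub_mem id_mem (tproj_mem k) n x hx)
    have h2 := extHom_apply (contrExt_mem k ξ) h1 rfl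
    exact I.alt_memZ (extHom_apply (mulLeft_mem_extHom hw) h2 (by ring))
  · refine comp_mem (i := -l) (fun n x hx => ?_)
      (comp_mem (formsOp_mem k f) (tproj_mem k) (add_zero _)) (by ring)
    exact mem_tpow_of_eq (mul_mem_tpow hx (alt_mem I.g hw)) (by ring)

theorem symbolOp_of_lt (ξ : Fin k → Module.Dual K V) {n : ℕ} (hn : n < k) {x : T}
    (hx : x ∈ tpow K A n) : I.symbolOp w (ExteriorAlgebra.ιMulti K k ξ) f x = 0 := by
  have h := contrExt_mem k ξ n _ (toExt_mem (Module.finBasis K V) I hx)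
  rw [extZ_of_neg (by omega), Submodule.mem_bot] at h
  rw [symbolOp_apply, tproj_ne hx (by omega), sub_zero, h]
  simp

theorem symbolOp_same {x : T} (hx : x ∈ tpow K A k) :
    I.symbolOp w η f x = formsOp k f x * alt I.g w := by
  rw [symbolOp_apply, tproj_same hx]
  simp

theorem tprod_mem (k : ℕ) (a : Fin k → A) : TensorAlgebra.tprod K A k a ∈ tpow K A k := by
  rw [tpow_natCast, TensorAlgebra.tprod_apply]
  induction k with
  | zero => simp [Submodule.mem_one]
  | succ k ih =>
    rw [List.ofFn_succ, List.prod_cons, pow_succ']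
    exact Submodule.mul_mem_mul ⟨_, rfl⟩ (ih _)

variable {f} in
/-- Cocycles with a given leading symbol. -/
theorem exists_symbol (t : Totalization) (v : Fin l → V) (ξ : Fin k → Module.Dual K V)
    (hf : ∀ i v, f i (I.g v) = ξ i v) (hmul : ∀ i a c, f i (a * c) = 0) :
    ∃ Ψ : cocycles K A t ((k : ℤ) - l),
      I.totalTransfer t (cls t _ Ψ) = cliffRep (ordMap K V
        (ExteriorAlgebra.ιMulti K l v ⊗ₜ ExteriorAlgebra.ιMulti K k ξ)) ∧
      (∀ n < k, ∀ x ∈ tpow K A n, Ψ.1 x = 0) ∧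
      ∀ a : Fin k → A, Ψ.1 (TensorAlgebra.tprod K A k a) =
        (∏ i, f i.rev (a i)) • altSum I.g l v := by
  set w := ExteriorAlgebra.ιMulti K l v with hw
  have hwl : w ∈ ⋀[K]^l V := by
    rw [← ExteriorAlgebra.ιMulti_span_fixedDegree]; exact Submodule.subset_span ⟨v, rfl⟩
  set F := I.symbolOp w (ExteriorAlgebra.ιMulti K k ξ) f with hF
  have hvan : ∀ j < k, ∀ x ∈ tpow K A j, F x = 0 := fun j hj x hx => I.symbolOp_of_lt w f ξ hj hx
  -- The closing argument `k` is the cut-off: passing to finite support leaves the components up to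
  -- `A^{⊗k}` unchanged, and these carry the symbol.
  obtain ⟨Ψ, h1, h2⟩ := I.exists_cocycle t
    (insEquiv_symm_mem (i := (k : ℤ) - l) (I.symbolOp_mem f hwl ξ)) (by
      rw [diff_eq_zero_iff, ins_insEquiv_symm]
      refine LinearMap.ext fun x => ?_
      rw [comm_apply, LinearMap.sub_apply, LinearMap.smul_apply, LinearMap.comp_apply,
        LinearMap.comp_apply, bar_symbolOp, symbolOp_bar _ _ _ hmul]
      simp) k
  refine ⟨Ψ, ?_, fun n hn x hx => ?_, fun a => ?_⟩
  · rw [totalTransfer_cls, h2, ins_insEquiv_symm, I.transfer_symbolOp w hf]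
  · rw [h1 n hn.le x hx, insEquiv_symm_of_vanish _ hvan hn.le hx, hvan n hn x hx]
  · have ha := tprod_mem (K := K) k a
    rw [h1 k le_rfl _ ha, insEquiv_symm_of_vanish _ hvan le_rfl ha, I.symbolOp_same _ _ _ ha,
      formsOp_tprod, smul_mul_assoc, one_mul, hw, alt_ιMulti]

variable {lin : Module.Dual K V → A →ₗ[K] K}

theorem exists_cls (hlin : ∀ ξ v, lin ξ (I.g v) = ξ v) (hmul : ∀ ξ a c, lin ξ (a * c) = 0)
    (t : Totalization) {w : Λ} (hw : w ∈ ⋀[K]^l V) {η : ΛD} (hη : η ∈ ⋀[K]^k (Module.Dual K V)) :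
    ∃ Ψ : cocycles K A t ((k : ℤ) - l),
      I.totalTransfer t (cls t _ Ψ) = cliffRep (ordMap K V (w ⊗ₜ η)) := by
  let C := LinearMap.range (I.totalTransfer t ∘ₗ cls t ((k : ℤ) - l))
  let B := (TensorProduct.mk K Λ ΛD).compr₂ (cliffRep.toLinearMap ∘ₗ ordMap K V)
  have h1 : ∀ v : Fin l → V, ⋀[K]^k (Module.Dual K V) ≤
      C.comap (B (ExteriorAlgebra.ιMulti K l v)) := by
    intro v
    rw [← ExteriorAlgebra.ιMulti_span_fixedDegree, Submodule.span_le]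
    rintro _ ⟨ξ, rfl⟩
    obtain ⟨Ψ, hΨ, -⟩ := I.exists_symbol t v ξ (f := fun i => lin (ξ i)) (fun i => hlin _)
      (fun i => hmul _)
    exact ⟨Ψ, hΨ⟩
  have h2 : ⋀[K]^l V ≤ C.comap (B.flip η) := by
    rw [← ExteriorAlgebra.ιMulti_span_fixedDegree, Submodule.span_le]
    rintro _ ⟨v, rfl⟩
    exact h1 v hη
  exact h2 hw

/-- Every endomorphism of Λ(V) comes from a sum of homogeneous tensors by
`cliffRep_ordMap_bijective`, and each of these is realized by a cocycle through its symbol. -/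
theorem totalTransfer_bijective (hlin : ∀ ξ v, lin ξ (I.g v) = ξ v)
    (hmul : ∀ ξ a c, lin ξ (a * c) = 0) (t : Totalization) :
    Function.Bijective (I.totalTransfer t) := by
  refine ⟨I.totalTransfer_injective t, ?_⟩
  rw [← LinearMap.range_eq_top, eq_top_iff]
  rintro F -
  obtain ⟨z, rfl⟩ := cliffRep_ordMap_bijective.2 F
  induction z using TensorProduct.induction_on with
  | zero => rw [map_zero]; exact zero_mem _
  | add x y hx hy => rw [map_add]; exact add_mem hx hy
  | tmul w η =>
    refine DirectSum.Decomposition.inductionOn (fun q : ℕ => ⋀[K]^q V) (by simp) ?_ ?_ w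
    · intro l w
      refine DirectSum.Decomposition.inductionOn (fun q : ℕ => ⋀[K]^q (Module.Dual K V))
        (by simp) ?_ ?_ η
      · intro k η
        obtain ⟨Ψ, hΨ⟩ := I.exists_cls hlin hmul t w.2 η.2
        exact ⟨_, hΨ⟩
      · intro x y hx hy; rw [TensorProduct.tmul_add, map_add]; exact add_mem hx hy
    · intro x y hx hy; rw [TensorProduct.add_tmul, map_add]; exact add_mem hx hy

/-- The isomorphism between the Clifford algebra and the cohomology. -/
theorem exists_cohomology_equiv (hlin : ∀ ξ v, lin ξ (I.g v) = ξ v)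
    (hmul : ∀ ξ a c, lin ξ (a * c) = 0) (t : Totalization) :
    ∃ (ord : (Λ ⊗[K] ΛD) ≃ₗ[K] Clif K V) (κ : (Λ ⊗[K] ΛD) ≃ₗ[K] TotalCohomology K A t),
      (∀ w η, ord (w ⊗ₜ[K] η) = extV w * extDual η) ∧
      (∀ (k l : ℕ) (v : Fin l → V) (ξ : Fin k → Module.Dual K V),
        ∃ Ψ : cocycles K A t ((k : ℤ) - l),
          κ (ExteriorAlgebra.ιMulti K l v ⊗ₜ[K] ExteriorAlgebra.ιMulti K k ξ) =
              cls t ((k : ℤ) - l) Ψ ∧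
            (∀ n < k, ∀ x ∈ tpow K A n, Ψ.1 x = 0) ∧
            ∀ a : Fin k → A, Ψ.1 (TensorAlgebra.tprod K A k a) =
              (∏ i, lin (ξ i.rev) (a i)) • altSum I.g l v) ∧
      (∀ (k l k' l' : ℕ) (w : ⋀[K]^l V) (η : ⋀[K]^k (Module.Dual K V))
        (w' : ⋀[K]^l' V) (η' : ⋀[K]^k' (Module.Dual K V)),
        totalBracket t (κ (w.1 ⊗ₜ[K] η.1)) (κ (w'.1 ⊗ₜ[K] η'.1)) =
          κ (ord.symm (ord (w.1 ⊗ₜ[K] η.1) * ord (w'.1 ⊗ₜ[K] η'.1) -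
            sgn K (((k : ℤ) - l) * ((k' : ℤ) - l')) •
              (ord (w'.1 ⊗ₜ[K] η'.1) * ord (w.1 ⊗ₜ[K] η.1))))) := by
  let ord := LinearEquiv.ofBijective (ordMap K V) ordMap_bijective
  let Θ := LinearEquiv.ofBijective _ (I.totalTransfer_bijective hlin hmul t)
  -- Both sides are identified with End Λ(V). An equation for κ can then be checked after
  -- `totalTransfer`, which turns the bracket into a graded commutator of endomorphisms.
  let κ := (LinearEquiv.ofBijective _ (cliffRep_ordMap_bijective (K := K) (V := V))).trans Θ.symm
  have hκ : ∀ z, I.totalTransfer t (κ z) = cliffRep (ord z) := fun z =>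
    Θ.apply_symm_apply (cliffRep (ord z))
  have hκ' : ∀ z y, I.totalTransfer t y = cliffRep (ord z) → κ z = y := fun z y h =>
    I.totalTransfer_injective t ((hκ z).trans h.symm)
  refine ⟨ord, κ, fun w η => rfl, fun k l v ξ => ?_, fun k l k' l' w η w' η' => ?_⟩
  · obtain ⟨Ψ, h1, h2⟩ := I.exists_symbol t v ξ (f := fun i => lin (ξ i)) (fun i => hlin _)
      (fun i => hmul _)
    exact ⟨Ψ, hκ' _ _ h1, h2⟩
  · obtain ⟨x, hx⟩ := I.exists_cls hlin hmul t w.2 η.2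
    obtain ⟨y, hy⟩ := I.exists_cls hlin hmul t w'.2 η'.2
    rw [hκ' _ _ hx, hκ' _ _ hy]
    refine (hκ' _ _ ?_).symm
    rw [totalTransfer_bracket, hx, hy, LinearEquiv.apply_symm_apply, map_sub, map_smul, map_mul,
      map_mul]
    rfl

end AugIdeal

end Symbols

/-! ### The algebra of polynomials without constant term. -/

section Polynomials

variable {K : Type*} [Field K] {V : Type*} [AddCommGroup V] [Module K V]

variable (K V) in
/-- The augmentation ideal of the symmetric algebra. -/
def augIdealS₀ : AugIdeal K V (S₀ K V) where
  incl := NonUnitalSubalgebraClass.subtype (S₀ K V)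
  redu := LinearMap.codRestrict (S₀ K V).toSubmodule
    (LinearMap.id - Algebra.linearMap K (SymmetricAlgebra K V) ∘ₗ (symAug K V).toLinearMap)
    fun f => by
      change symAug K V (f - algebraMap K _ (symAug K V f)) = 0
      rw [map_sub, AlgHom.commutes]; exact sub_self _
  incl_redu f := rfl
  redu_incl a := by
    apply Subtype.ext
    change a.1 - algebraMap K _ (symAug K V a.1) = a.1
    rw [show symAug K V a.1 = 0 from a.2, map_zero, sub_zero]

theorem coe_augIdealS₀_redu (f : SymmetricAlgebra K V) :
    ((augIdealS₀ K V).redu f).1 = f - algebraMap K _ (symAug K V f) := rfl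

theorem augIdealS₀_g : (augIdealS₀ K V).g = gen := by
  refine LinearMap.ext fun v => Subtype.ext ?_
  refine (coe_augIdealS₀_redu _).trans ?_
  rw [symAug_ι, map_zero, sub_zero]
  rfl

theorem linForm_gen (ξ : Module.Dual K V) (v : V) : linForm ξ (gen v) = ξ v := by
  change (SymmetricAlgebra.lift (TrivSqZeroExt.inrHom K K ∘ₗ ξ) (SymmetricAlgebra.ι K V v)).snd = _
  rw [SymmetricAlgebra.lift_ι_apply]
  simp

/-- The scalar part of the map to the dual numbers is the augmentation, so it vanishes on S(V)₀; two
elements of the ideal generated by ε have product zero. -/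
theorem linForm_mul (ξ : Module.Dual K V) (a c : S₀ K V) : linForm ξ (a * c) = 0 := by
  have h : ∀ a : S₀ K V, (SymmetricAlgebra.lift (TrivSqZeroExt.inrHom K K ∘ₗ ξ) a.1).fst = 0 := by
    intro a
    have : (TrivSqZeroExt.fstHom K K K).comp
        (SymmetricAlgebra.lift (TrivSqZeroExt.inrHom K K ∘ₗ ξ)) = symAug K V := by
      apply SymmetricAlgebra.algHom_ext
      ext v
      simp
    exact (DFunLike.congr_fun this a.1).trans a.2
  change (SymmetricAlgebra.lift (TrivSqZeroExt.inrHom K K ∘ₗ ξ) (a.1 * c.1)).snd = 0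
  rw [map_mul, TrivSqZeroExt.snd_mul, h, h]
  simp

end Polynomials

end TensorHom

end

set_option maxHeartbeats 4000000 in
theorem mainTheorem3 (K : Type*) [Field K] [CharZero K] (V : Type*) [AddCommGroup V] [Module K V]
    [FiniteDimensional K V] (t : TensorHom.Totalization) :
    ∃ (ord : (ExteriorAlgebra K V ⊗[K] ExteriorAlgebra K (Module.Dual K V)) ≃ₗ[K]
        TensorHom.Clif K V)
      (κ : (ExteriorAlgebra K V ⊗[K] ExteriorAlgebra K (Module.Dual K V)) ≃ₗ[K]
        TensorHom.TotalCohomology K (TensorHom.S₀ K V) t),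
      (∀ (w : ExteriorAlgebra K V) (η : ExteriorAlgebra K (Module.Dual K V)),
        ord (w ⊗ₜ[K] η) = TensorHom.extV w * TensorHom.extDual η) ∧
      (∀ (k l : ℕ) (v : Fin l → V) (ξ : Fin k → Module.Dual K V),
        ∃ Ψ : TensorHom.cocycles K (TensorHom.S₀ K V) t ((k : ℤ) - l),
          κ (ExteriorAlgebra.ιMulti K l v ⊗ₜ[K] ExteriorAlgebra.ιMulti K k ξ) =
              TensorHom.cls t ((k : ℤ) - l) Ψ ∧
            TensorHom.HasSymbol v ξ Ψ.1) ∧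
      (∀ (k l k' l' : ℕ) (w : ⋀[K]^l V) (η : ⋀[K]^k (Module.Dual K V))
        (w' : ⋀[K]^l' V) (η' : ⋀[K]^k' (Module.Dual K V)),
        TensorHom.totalBracket t (κ (w.1 ⊗ₜ[K] η.1)) (κ (w'.1 ⊗ₜ[K] η'.1)) =
          κ (ord.symm (ord (w.1 ⊗ₜ[K] η.1) * ord (w'.1 ⊗ₜ[K] η'.1) -
            TensorHom.sgn K (((k : ℤ) - l) * ((k' : ℤ) - l')) •
              (ord (w'.1 ⊗ₜ[K] η'.1) * ord (w.1 ⊗ₜ[K] η.1))))) := by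
  obtain ⟨ord, κ, h1, h2, h3⟩ := (TensorHom.augIdealS₀ K V).exists_cohomology_equiv
    (lin := TensorHom.linForm) (fun ξ v => by
      rw [TensorHom.augIdealS₀_g]; exact TensorHom.linForm_gen ξ v) TensorHom.linForm_mul t
  refine ⟨ord, κ, h1, fun k l v ξ => ?_, h3⟩
  obtain ⟨Ψ, h4, h5, h6⟩ := h2 k l v ξ
  refine ⟨Ψ, h4, h5, fun a => (h6 a).trans ?_⟩
  rw [TensorHom.altSum_apply, TensorHom.augIdealS₀_g]
  rfl
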